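/- Let $(\mathcal C,\otimes,1_\otimes)$ be a symmetric monoidal category with all small limits; write $\star_{\mathcal C}$ for its final object. Notation. Let $\Sigma_*$ be the category of finite sets and bijections; a symmetric sequence is a functor $\Sigma_*\to\mathcal C$. Let $\Sigma_*^{\wr n}$ be the category of chains of maps of finite sets $S_0\leftarrow S_1\leftarrow\cdots\leftarrow S_n$ with $|S_0|=1$ (level trees with $n$ levels) and their isomorphisms. Let $\gamma^n:\Sigma_*^{\wr n}\to\Sigma_*$ be $S_\bullet\mapsto S_n$. For $1\le i\le n-1$ let $\partial^n_i:\Sigma_*^{\wr n}\to\Sigma_*^{\wr(n-1)}$ forget $S_i$ (composing the two adjacent maps), and for $0\le i\le n$ let $s^n_i:\Sigma_*^{\wr n}\to\Sigma_*^{\wr(n+1)}$ repeat $S_i$ (inserting an identity map); then $\gamma^{n-1}\partial^n_i=\gamma^n$ and $\gamma^{n+1}s^n_i=\gamma^n$. For symmetric sequences $A_1,\dots,A_n$ let $A_1\circledcirc\cdots\circledcirc A_n:\Sigma_*^{\wr n}\to\mathcal C$ be the functor $$S_\bullet\longmapsto\bigotimes_{0\le i<n}\ \bigotimes_{s\in S_i}A_{i+1}(f_i^{-1}(s)),\qquad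 f_i:S_{i+1}\to S_i ,$$ where the tensor products are unordered. Write $R_{\gamma^n}$ for right Kan extension along $\gamma^n$, let $A^{\hat\circ n}=R_{\gamma^n}(A^{\circledcirc n})$, and let $\iota_n:A^{\hat\circ n}\gamma^n\to A^{\circledcirc n}$ be the universal transformation. Let $\mathbb 1$ be the symmetric sequence with $\mathbb 1(T)=1_\otimes$ if $|T|=1$ and $\mathbb 1(T)=\star_{\mathcal C}$ otherwise. Let $\mathcal O$ be a symmetric sequence with natural transformations $\tilde\Delta:\mathcal O\gamma^2\to\mathcal O\circledcirc\mathcal O$ and $\tilde\epsilon:\mathcal O\to\mathbb 1$. Let $\tilde\Delta^n_i:\mathcal O^{\circledcirc(n-1)}\partial^n_i\to\mathcal O^{\circledcirc n}$ ($1\le i\le n-1$) apply $\tilde\Delta$ at every vertex $s\in S_{i-1}$ and the identity at all other vertices, and let $\tilde\epsilon^n_i:\mathcal O^{\circledcirc(n+1)}s^n_i\to\mathcal O^{\circledcirc n}$ ($0\le i\le n$) apply $\tilde\epsilon$ at every vertex of height $i$ and the identity at all other vertices. Then $(\mathcal O,\tilde\Delta,\tilde\epsilon)$ is a counital cooperad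 if the two composites $$\mathcal O\gamma^3=\mathcal O\gamma^2\partial^3_i\xrightarrow{\tilde\Delta\,\partial^3_i}(\mathcal O\circledcirc\mathcal O)\,\partial^3_i\xrightarrow{\tilde\Delta^3_i}\mathcal O\circledcirc\mathcal O\circledcirc\mathcal O\qquad(i=1,2)$$ agree, and the two composites $$\mathcal O\gamma^1=\mathcal O\gamma^2s^1_i\xrightarrow{\tilde\Delta\,s^1_i}(\mathcal O\circledcirc\mathcal O)\,s^1_i\xrightarrow{\tilde\epsilon^1_i}\mathcal O^{\circledcirc 1}\qquad(i=0,1)$$ are the canonical identification of $\mathcal O\gamma^1$ with $\mathcal O^{\circledcirc 1}$. Define the coface maps $\Delta^n_i:\mathcal O^{\hat\circ(n-1)}\to\mathcal O^{\hat\circ n}$ ($1\le i\le n-1$) and the codegeneracy maps $\epsilon^n_i:\mathcal O^{\hat\circ(n+1)}\to\mathcal O^{\hat\circ n}$ ($0\le i\le n$) as the composites $$\mathcal O^{\hat\circ(n-1)}\to R_{\gamma^n}\bigl(\mathcal O^{\circledcirc(n-1)}\partial^n_i\bigr)\xrightarrow{R_{\gamma^n}(\tilde\Delta^n_i)}\mathcal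 O^{\hat\circ n},\qquad \mathcal O^{\hat\circ(n+1)}\to R_{\gamma^n}\bigl(\mathcal O^{\circledcirc(n+1)}s^n_i\bigr)\xrightarrow{R_{\gamma^n}(\tilde\epsilon^n_i)}\mathcal O^{\hat\circ n},$$ in which the first maps are induced by $\iota_{n-1}\partial^n_i$ and $\iota_{n+1}s^n_i$. Theorem. Let $(\mathcal O,\tilde\Delta,\tilde\epsilon)$ be a counital cooperad. Then the symmetric sequences $\mathcal O^{\hat\circ n}$, $n\ge1$, with the cofaces $\Delta^n_i$ and the codegeneracies $\epsilon^n_i$ ($n\ge1$) form a coaugmented cosimplicial symmetric sequence with two extra codegeneracies, $$\mathcal O\to\mathcal O\,\hat\circ\,\mathcal O\rightrightarrows\mathcal O^{\hat\circ3}\cdots ;$$ that is, whenever the maps are defined, * $\Delta^{n+1}_j\Delta^n_i=\Delta^{n+1}_i\Delta^n_{j-1}$ for $j>i$; * $\epsilon^{n-1}_i\epsilon^n_j=\epsilon^{n-1}_{j-1}\epsilon^n_i$ for $j>i$; * $\epsilon^n_j\Delta^{n+1}_i=\mathrm{id}$ for $j=i-1,i$; $\ \epsilon^n_j\Delta^{n+1}_i=\Delta^n_{i-1}\epsilon^{n-1}_j$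 for $j<i-1$; $\ \epsilon^n_j\Delta^{n+1}_i=\Delta^n_i\epsilon^{n-1}_{j-1}$ for $j>i$. Moreover the canonical map $\mathcal O\to\mathcal O^{\hat\circ1}$ is an isomorphism, and composed with $\Delta^2_1$ it is the map $\mathcal O\to\mathcal O\,\hat\circ\,\mathcal O$ corresponding to $\tilde\Delta$; $\Delta^n_i$ is the only map with $\iota_n\circ(\Delta^n_i\gamma^n)=\tilde\Delta^n_i\circ(\iota_{n-1}\partial^n_i)$, and $\epsilon^n_i$ is the only map with $\iota_n\circ(\epsilon^n_i\gamma^n)=\tilde\epsilon^n_i\circ(\iota_{n+1}s^n_i)$. -/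

import Mathlib

open CategoryTheory MonoidalCategory Limits

universe v u

noncomputable section

namespace WreathCooperad

section UnorderedTensor

variable {C : Type u} [Category.{v} C] [MonoidalCategory C]

/-- The tensor product of a family along a list of indices, bracketed to the right. -/
def listTensor {ι : Type} (X : ι → C) : List ι → C
  | [] => 𝟙_ C
  | a :: l => X a ⊗ listTensor X l

/-- Ways of rearranging a list by adjacent transpositions. -/
inductive Rearr {ι : Type} : List ι → List ι → Type
  | nil : Rearr [] []
  | cons (a : ι) {l l' : List ι} (p : Rearr l l') : Rearr (a :: l) (a :: l')
  | swap (a b : ι) (l : List ι) : Rearr (a :: b :: l) (b :: a :: l)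
  | trans {l l' l'' : List ι} (p : Rearr l l') (q : Rearr l' l'') : Rearr l l''

namespace Rearr

variable {ι κ : Type}

def refl : (l : List ι) → Rearr l l
  | [] => nil
  | a :: l => cons a (refl l)

def symm : {l l' : List ι} → Rearr l l' → Rearr l' l
  | _, _, nil => nil
  | _, _, cons a p => cons a p.symm
  | _, _, swap a b l => swap b a l
  | _, _, trans p q => trans q.symm p.symm

def map (e : ι → κ) : {l l' : List ι} → Rearr l l' → Rearr (l.map e) (l'.map e)
  | _, _, nil => nil
  | _, _, cons a p => cons (e a) (p.map e)
  | _, _, swap a b l => swap (e a) (e b) (l.map e)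
  | _, _, trans p q => trans (p.map e) (q.map e)

theorem perm {l l' : List ι} (p : Rearr l l') : l.Perm l' := by
  induction p with
  | nil => exact .nil
  | cons a _ ih => exact ih.cons a
  | swap a b l => exact .swap b a l
  | trans _ _ ih₁ ih₂ => exact ih₁.trans ih₂

theorem nonempty_of_perm {l l' : List ι} (h : l.Perm l') : Nonempty (Rearr l l') := by
  induction h with
  | nil => exact ⟨nil⟩
  | cons a _ ih => exact ih.map (cons a)
  | swap a b l => exact ⟨swap b a l⟩
  | trans _ _ ih₁ ih₂ => exact ⟨trans ih₁.some ih₂.some⟩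

end Rearr

variable [SymmetricCategory C]

/-- Exchange of the first two factors by the symmetry of `C`. -/
def swapHom (A B Z : C) : A ⊗ (B ⊗ Z) ⟶ B ⊗ (A ⊗ Z) :=
  (α_ A B Z).inv ≫ (β_ A B).hom ▷ Z ≫ (α_ B A Z).hom

theorem swapHom_swapHom (A B Z : C) : swapHom A B Z ≫ swapHom B A Z = 𝟙 _ := by
  simp [swapHom, ← comp_whiskerRight_assoc]

theorem swapHom_naturality {A A' B B' Z Z' : C} (f : A ⟶ A') (g : B ⟶ B') (h : Z ⟶ Z') :
    (f ⊗ₘ (g ⊗ₘ h)) ≫ swapHom A' B' Z' = swapHom A B Z ≫ (g ⊗ₘ (f ⊗ₘ h)) := by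
  simp only [swapHom, Category.assoc]
  rw [associator_inv_naturality_assoc, ← tensorHom_id, ← tensorHom_id,
    tensorHom_comp_tensorHom_assoc, BraidedCategory.braiding_naturality, Category.comp_id,
    ← associator_naturality, tensorHom_comp_tensorHom_assoc, Category.id_comp]

theorem swapHom_tensor_right (A B B' Z : C) :
    swapHom A (B ⊗ B') Z = (A ◁ (α_ B B' Z).hom) ≫ swapHom A B (B' ⊗ Z) ≫
      B ◁ swapHom A B' Z ≫ (α_ B B' (A ⊗ Z)).inv := by
  simp [swapHom]

theorem swapHom_tensor_left (A A' B Z : C) :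
    swapHom (A ⊗ A') B Z = (α_ A A' (B ⊗ Z)).hom ≫ A ◁ swapHom A' B Z ≫ swapHom A B (A' ⊗ Z) ≫
      B ◁ (α_ A A' Z).inv := by
  simp [swapHom]

theorem swapHom_yangBaxter (A B D Z : C) :
    swapHom A B (D ⊗ Z) ≫ B ◁ swapHom A D Z ≫ swapHom B D (A ⊗ Z) =
      A ◁ swapHom B D Z ≫ swapHom A D (B ⊗ Z) ≫ D ◁ swapHom A B Z := by
  have h := swapHom_naturality (𝟙 A) (β_ B D).hom (𝟙 Z)
  rw [swapHom_tensor_right, swapHom_tensor_right] at h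
  have h' := congrArg (fun t => A ◁ (α_ B D Z).inv ≫ t ≫ (α_ D B (A ⊗ Z)).hom) h
  simp only [Category.assoc, Iso.inv_hom_id, Category.comp_id, id_tensorHom, tensorHom_id,
    id_whiskerRight, whiskerLeft_inv_hom_assoc] at h'
  rw [show swapHom B D (A ⊗ Z) = (α_ B D (A ⊗ Z)).inv ≫ (β_ B D).hom ▷ (A ⊗ Z) ≫
    (α_ D B (A ⊗ Z)).hom from rfl, ← h']
  simp [swapHom]

variable {ι κ μ : Type}

/-- The canonical map between the tensor products along two rearranged lists. -/
def Rearr.eval (X : ι → C) : {l l' : List ι} → Rearr l l' → (listTensor X l ⟶ listTensor X l')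
  | _, _, .nil => 𝟙 _
  | _, _, .cons a p => X a ◁ p.eval X
  | _, _, .swap a b l => swapHom (X a) (X b) (listTensor X l)
  | _, _, .trans p q => p.eval X ≫ q.eval X

theorem Rearr.eval_refl (X : ι → C) (l : List ι) : (Rearr.refl l).eval X = 𝟙 _ := by
  induction l with
  | nil => rfl
  | cons a l ih => simp only [Rearr.refl, Rearr.eval, ih, whiskerLeft_id]; rfl

theorem Rearr.eval_symm (X : ι → C) {l l' : List ι} (p : Rearr l l') :
    p.eval X ≫ p.symm.eval X = 𝟙 _ ∧ p.symm.eval X ≫ p.eval X = 𝟙 _ := by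
  induction p with
  | nil => exact ⟨Category.comp_id _, Category.comp_id _⟩
  | cons a p ih =>
    dsimp only [Rearr.symm, Rearr.eval, listTensor]
    simp only [← whiskerLeft_comp, ih.1, ih.2, whiskerLeft_id, and_self]
  | swap a b l => exact ⟨swapHom_swapHom _ _ _, swapHom_swapHom _ _ _⟩
  | trans p q ihp ihq =>
    dsimp only [Rearr.symm, Rearr.eval]
    simp only [Category.assoc]
    constructor
    · rw [← Category.assoc (q.eval X), ihq.1, Category.id_comp, ihp.1]
    · rw [← Category.assoc (p.symm.eval X), ihp.2, Category.id_comp, ihq.2]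

/-- `Ins a l m`: the list `m` arises from `l` by inserting `a`. -/
inductive Ins (a : ι) : List ι → List ι → Type
  | here (l : List ι) : Ins a l (a :: l)
  | there (b : ι) {l m : List ι} (i : Ins a l m) : Ins a (b :: l) (b :: m)

theorem Ins.mem {a : ι} {l m : List ι} (i : Ins a l m) : a ∈ m := by
  induction i with
  | here l => exact List.mem_cons_self
  | there b _ ih => exact List.mem_cons_of_mem _ ih

theorem Ins.nonempty_of_mem {a : ι} {m : List ι} (h : a ∈ m) : ∃ l, Nonempty (Ins a l m) := by
  induction m with
  | nil => exact absurd h List.not_mem_nil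
  | cons b m ih =>
    rcases List.mem_cons.1 h with rfl | h
    · exact ⟨m, ⟨.here m⟩⟩
    · obtain ⟨l, ⟨i⟩⟩ := ih h
      exact ⟨b :: l, ⟨.there b i⟩⟩

/-- Moving the inserted factor to the front. -/
def Ins.pull (X : ι → C) {a : ι} : {l m : List ι} → Ins a l m →
    (listTensor X m ⟶ X a ⊗ listTensor X l)
  | _, _, .here _ => 𝟙 _
  | _, _, .there b i => X b ◁ i.pull X ≫ swapHom (X b) (X a) _

theorem swapHom_isIso (A B Z : C) : IsIso (swapHom A B Z) :=
  ⟨_, swapHom_swapHom _ _ _, swapHom_swapHom _ _ _⟩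

theorem Ins.pull_isIso (X : ι → C) {a : ι} {l m : List ι} (i : Ins a l m) :
    IsIso (i.pull X) := by
  induction i with
  | here l => exact inferInstanceAs (IsIso (𝟙 _))
  | @there b l m i ih =>
    have := swapHom_isIso (X b) (X a) (listTensor X l)
    exact inferInstanceAs (IsIso (X b ◁ i.pull X ≫ swapHom (X b) (X a) _))

theorem swapHom_pull (A B D : C) {P Q : C} (f : P ⟶ A ⊗ Q) :
    swapHom B D P ≫ D ◁ (B ◁ f ≫ swapHom B A Q) ≫ swapHom D A (B ⊗ Q) =
      (B ◁ (D ◁ f ≫ swapHom D A Q) ≫ swapHom B A (D ⊗ Q)) ≫ A ◁ swapHom B D Q := by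
  have n := swapHom_naturality (𝟙 B) (𝟙 D) f
  simp only [id_tensorHom] at n
  simp only [whiskerLeft_comp, Category.assoc, ← swapHom_yangBaxter]
  rw [← Category.assoc, ← n, Category.assoc]

theorem Ins.unique {a : ι} {k k' l : List ι} (hl : l.Nodup) (i : Ins a k l) (i' : Ins a k' l) :
    ∃ h : k = k', h ▸ i = i' := by
  induction i generalizing k' with
  | here l =>
    cases i' with
    | here => exact ⟨rfl, rfl⟩
    | there _ j' => exact absurd j'.mem (List.nodup_cons.1 hl).1
  | there b j ih =>
    cases i' with
    | here => exact absurd j.mem (List.nodup_cons.1 hl).1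
    | there _ j' =>
      obtain ⟨h, h'⟩ := ih (List.nodup_cons.1 hl).2 j'
      subst h
      exact ⟨rfl, congrArg (Ins.there b) h'⟩

theorem Rearr.exists_pull (X : ι → C) {l l' : List ι} (p : Rearr l l') (hl : l.Nodup) (a : ι)
    {k k' : List ι} (i : Ins a k l) (i' : Ins a k' l') :
    ∃ q : Rearr k k', p.eval X ≫ i'.pull X = i.pull X ≫ X a ◁ q.eval X := by
  induction p generalizing k k' with
  | nil => cases i
  | cons b p ih =>
    cases i with
    | here =>
      cases i' with
      | here => exact ⟨p, (Category.comp_id _).trans (Category.id_comp _).symm⟩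
      | there _ j' => exact absurd (p.perm.mem_iff.2 j'.mem) (List.nodup_cons.1 hl).1
    | there _ j =>
      cases i' with
      | here => exact absurd j.mem (List.nodup_cons.1 hl).1
      | there _ j' =>
        obtain ⟨q, hq⟩ := ih (List.nodup_cons.1 hl).2 j j'
        refine ⟨.cons b q, ?_⟩
        have := swapHom_naturality (𝟙 (X b)) (𝟙 (X a)) (q.eval X)
        simp only [id_tensorHom] at this
        dsimp only [Rearr.eval, Ins.pull, listTensor]
        simp only [Category.assoc, ← this]
        simp only [← whiskerLeft_comp_assoc, hq]
  | swap x y l =>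
    cases i with
    | here =>
      cases i' with
      | here => simp at hl
      | there _ j' =>
        cases j' with
        | here =>
          refine ⟨Rearr.refl _, ?_⟩
          dsimp only [Rearr.eval, Ins.pull, listTensor]
          rw [Rearr.eval_refl]
          dsimp only [listTensor]
          simp [swapHom_swapHom]
        | there _ j' => simp [j'.mem] at hl
    | there _ j =>
      cases j with
      | here =>
        cases i' with
        | here =>
          refine ⟨Rearr.refl _, ?_⟩
          dsimp only [Rearr.eval, Ins.pull, listTensor]
          rw [Rearr.eval_refl]
          dsimp only [listTensor]
          simp
        | there _ j' =>
          cases j' with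
          | here => simp at hl
          | there _ j' => simp [j'.mem] at hl
      | there _ j =>
        cases i' with
        | here => simp [j.mem] at hl
        | there _ j' =>
          cases j' with
          | here => simp [j.mem] at hl
          | there _ j' =>
            obtain ⟨rfl, rfl⟩ := Ins.unique (List.nodup_cons.1 (List.nodup_cons.1 hl).2).2 j j'
            exact ⟨.swap x y _, swapHom_pull (X a) (X x) (X y) (j.pull X)⟩
  | trans p q ihp ihq =>
    obtain ⟨k'', ⟨i''⟩⟩ := Ins.nonempty_of_mem (p.perm.mem_iff.1 i.mem)
    obtain ⟨r, hr⟩ := ihp hl i i''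
    obtain ⟨s, hs⟩ := ihq (p.perm.nodup_iff.1 hl) i'' i'
    refine ⟨.trans r s, ?_⟩
    dsimp only [Rearr.eval]
    simp only [Category.assoc, hs, whiskerLeft_comp]
    rw [← Category.assoc, hr, Category.assoc]

/-- Coherence: between two repetition-free lists there is only one canonical map. -/
theorem Rearr.eval_eq (X : ι → C) {l l' : List ι} (hl : l.Nodup) (p q : Rearr l l') :
    p.eval X = q.eval X := by
  induction l generalizing l' with
  | nil =>
    obtain rfl : l' = [] := p.perm.nil_eq.symm
    have key : ∀ {k k' : List ι} (r : Rearr k k') (hk : k = []) (hk' : k' = []),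
        r.eval X = eqToHom (by rw [hk, hk']) := by
      intro k k' r
      induction r with
      | nil => intros; rfl
      | cons a p ih => intro h; cases h
      | swap a b l => intro h; cases h
      | trans p q ihp ihq =>
        intro hk hk'
        have hm := List.perm_nil.1 (hk' ▸ q.perm)
        dsimp only [Rearr.eval]
        rw [ihp hk hm, ihq hm hk', eqToHom_trans]
    rw [key p rfl rfl, key q rfl rfl]
  | cons a l ih =>
    obtain ⟨k', ⟨i'⟩⟩ := Ins.nonempty_of_mem (p.perm.mem_iff.1 (List.mem_cons_self (a := a)))
    obtain ⟨r, hr⟩ := p.exists_pull X hl a (.here l) i'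
    obtain ⟨s, hs⟩ := q.exists_pull X hl a (.here l) i'
    have := i'.pull_isIso X
    rw [← cancel_mono (i'.pull X), hr, hs, ih (List.nodup_cons.1 hl).2 r s]

/-- A list in which every element of `ι` occurs exactly once. -/
def IsEnum (l : List ι) : Prop := l.Nodup ∧ ∀ a, a ∈ l

theorem IsEnum.perm {l l' : List ι} (h : IsEnum l) (h' : IsEnum l') : l.Perm l' :=
  (List.perm_ext_iff_of_nodup h.1 h'.1).2 fun a => iff_of_true (h.2 a) (h'.2 a)

theorem IsEnum.map {l : List ι} (h : IsEnum l) {e : ι → κ} (he : Function.Bijective e) :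
    IsEnum (l.map e) :=
  ⟨h.1.map he.1, fun b => by
    obtain ⟨a, rfl⟩ := he.2 b
    exact List.mem_map_of_mem (h.2 a)⟩

theorem exists_isEnum (ι : Type) [Finite ι] : ∃ l : List ι, IsEnum l := by
  have := Fintype.ofFinite ι
  exact ⟨Finset.univ.toList, Finset.nodup_toList _, by simp⟩

/-- A chosen enumeration of a finite set. -/
def enum (ι : Type) [Finite ι] : List ι := (exists_isEnum ι).choose

theorem isEnum_enum (ι : Type) [Finite ι] : IsEnum (enum ι) := (exists_isEnum ι).choose_spec

/-- The unordered tensor product `⨂_{i ∈ ι} X i` of a finite family of objects. -/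
abbrev unTensor [Finite ι] (X : ι → C) : C := listTensor X (enum ι)

/-- The canonical isomorphism from the tensor product along an arbitrary enumeration to the
unordered tensor product. -/
def ins [Finite ι] (X : ι → C) (l : List ι) (hl : IsEnum l) : listTensor X l ⟶ unTensor X :=
  (Rearr.nonempty_of_perm (hl.perm (isEnum_enum ι))).some.eval X

theorem eval_ins [Finite ι] (X : ι → C) {l l' : List ι} (hl : IsEnum l) (hl' : IsEnum l')
    (p : Rearr l l') : p.eval X ≫ ins X l' hl' = ins X l hl :=
  Rearr.eval_eq X hl.1
    (p.trans (Rearr.nonempty_of_perm (hl'.perm (isEnum_enum ι))).some) _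

theorem ins_enum [Finite ι] (X : ι → C) : ins X (enum ι) (isEnum_enum ι) = 𝟙 _ :=
  (Rearr.eval_eq X (isEnum_enum ι).1 _ (Rearr.refl _)).trans (Rearr.eval_refl X _)

theorem Rearr.eval_isIso (X : ι → C) {l l' : List ι} (p : Rearr l l') : IsIso (p.eval X) :=
  ⟨_, (p.eval_symm X).1, (p.eval_symm X).2⟩

theorem ins_isIso [Finite ι] (X : ι → C) (l : List ι) (hl : IsEnum l) : IsIso (ins X l hl) :=
  Rearr.eval_isIso X _

/-- Tensor product of maps, reindexed along a map of index sets. -/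
def listMap {X : ι → C} {Y : κ → C} (e : ι → κ) (g : ∀ i, X i ⟶ Y (e i)) :
    (l : List ι) → (listTensor X l ⟶ listTensor Y (l.map e))
  | [] => 𝟙 _
  | a :: l => g a ⊗ₘ listMap e g l

theorem eval_listMap {X : ι → C} {Y : κ → C} (e : ι → κ) (g : ∀ i, X i ⟶ Y (e i))
    {l l' : List ι} (p : Rearr l l') :
    p.eval X ≫ listMap e g l' = listMap e g l ≫ (p.map e).eval Y := by
  induction p with
  | nil => rfl
  | cons a p ih =>
    dsimp only [Rearr.eval, Rearr.map, listMap, listTensor, List.map]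
    rw [whiskerLeft_comp_tensorHom, tensorHom_comp_whiskerLeft, ih]
  | swap a b l => exact (swapHom_naturality (g a) (g b) (listMap e g l)).symm
  | trans p q ihp ihq =>
    dsimp only [Rearr.eval, Rearr.map]
    rw [Category.assoc, ihq, ← Category.assoc, ihp, Category.assoc]

/-- Functoriality of the unordered tensor product in bijections of index sets and maps of the
factors. -/
def unMap [Finite ι] [Finite κ] {X : ι → C} {Y : κ → C} (e : ι → κ) (he : Function.Bijective e)
    (g : ∀ i, X i ⟶ Y (e i)) : unTensor X ⟶ unTensor Y :=
  listMap e g (enum ι) ≫ ins Y ((enum ι).map e) ((isEnum_enum ι).map he)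

theorem ins_unMap [Finite ι] [Finite κ] {X : ι → C} {Y : κ → C} (e : ι → κ)
    (he : Function.Bijective e) (g : ∀ i, X i ⟶ Y (e i)) (l : List ι) (hl : IsEnum l) :
    ins X l hl ≫ unMap e he g = listMap e g l ≫ ins Y (l.map e) (hl.map he) := by
  rw [unMap, ins, ← Category.assoc, eval_listMap, Category.assoc, eval_ins]

def Rearr.mapId : (l : List ι) → Rearr (l.map id) l
  | [] => .nil
  | a :: l => .cons a (mapId l)

def Rearr.mapMap (e : ι → κ) (e' : κ → μ) : (l : List ι) → Rearr ((l.map e).map e') (l.map (e' ∘ e))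
  | [] => .nil
  | a :: l => .cons (e' (e a)) (mapMap e e' l)

theorem listMap_id (X : ι → C) (l : List ι) :
    listMap id (fun i => 𝟙 (X i)) l ≫ (Rearr.mapId l).eval X = 𝟙 _ := by
  induction l with
  | nil => exact Category.comp_id _
  | cons a l ih =>
    dsimp only [listMap, Rearr.mapId, Rearr.eval, listTensor, List.map, id]
    rw [tensorHom_comp_whiskerLeft, ih, id_tensorHom_id]

theorem listMap_comp {X : ι → C} {Y : κ → C} {Z : μ → C} (e : ι → κ) (e' : κ → μ)
    (g : ∀ i, X i ⟶ Y (e i)) (g' : ∀ i, Y i ⟶ Z (e' i)) (l : List ι) :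
    listMap e g l ≫ listMap e' g' (l.map e) ≫ (Rearr.mapMap e e' l).eval Z =
      listMap (e' ∘ e) (fun i => g i ≫ g' (e i)) l := by
  induction l with
  | nil => exact (Category.id_comp _).trans (Category.id_comp _)
  | cons a l ih =>
    dsimp only [listMap, Rearr.mapMap, Rearr.eval, listTensor, List.map, Function.comp]
    rw [tensorHom_comp_whiskerLeft, tensorHom_comp_tensorHom, ih]

theorem unMap_id [Finite ι] (X : ι → C) :
    unMap id Function.bijective_id (fun i => 𝟙 (X i)) = 𝟙 (unTensor X) := by
  rw [unMap, ← eval_ins X ((isEnum_enum ι).map Function.bijective_id) (isEnum_enum ι)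
    (Rearr.mapId _), ← Category.assoc, listMap_id, ins_enum]
  exact Category.comp_id _

theorem unMap_comp [Finite ι] [Finite κ] [Finite μ] {X : ι → C} {Y : κ → C} {Z : μ → C}
    (e : ι → κ) (he : Function.Bijective e) (e' : κ → μ) (he' : Function.Bijective e')
    (g : ∀ i, X i ⟶ Y (e i)) (g' : ∀ i, Y i ⟶ Z (e' i)) :
    unMap e he g ≫ unMap e' he' g' =
      unMap (Y := Z) (e' ∘ e) (he'.comp he) (fun i => g i ≫ g' (e i)) := by
  rw [unMap, Category.assoc, ins_unMap, unMap, ← listMap_comp, Category.assoc, Category.assoc,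
    eval_ins]

theorem unMap_congr [Finite ι] [Finite κ] {X : ι → C} {Y : κ → C} {e e' : ι → κ}
    (he : Function.Bijective e) (he' : Function.Bijective e') (h : ∀ i, e i = e' i)
    (g : ∀ i, X i ⟶ Y (e i)) (g' : ∀ i, X i ⟶ Y (e' i))
    (hg : ∀ i, g i ≫ eqToHom (congrArg Y (h i)) = g' i) : unMap e he g = unMap e' he' g' := by
  obtain rfl : e = e' := funext h
  congr 1
  funext i
  simpa using hg i

/-- Concatenation of tensor products. -/
def append (X : ι → C) : (l k : List ι) → (listTensor X l ⊗ listTensor X k ⟶ listTensor X (l ++ k))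
  | [], k => (λ_ (listTensor X k)).hom
  | a :: l, k => (α_ (X a) (listTensor X l) (listTensor X k)).hom ≫ X a ◁ append X l k

def Rearr.appendRight (k : List ι) : {l l' : List ι} → Rearr l l' → Rearr (l ++ k) (l' ++ k)
  | _, _, .nil => Rearr.refl k
  | _, _, .cons a p => .cons a (p.appendRight k)
  | _, _, .swap a b l => .swap a b (l ++ k)
  | _, _, .trans p q => .trans (p.appendRight k) (q.appendRight k)

def Rearr.appendLeft {k k' : List ι} (p : Rearr k k') : (l : List ι) → Rearr (l ++ k) (l ++ k')
  | [] => p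
  | a :: l => .cons a (p.appendLeft l)

theorem swapHom_whiskerRight (A B L K W : C) (f : L ⊗ K ⟶ W) :
    swapHom A B L ▷ K ≫ ((α_ B (A ⊗ L) K).hom ≫ B ◁ ((α_ A L K).hom ≫ A ◁ f)) =
      ((α_ A (B ⊗ L) K).hom ≫ A ◁ ((α_ B L K).hom ≫ B ◁ f)) ≫ swapHom A B W := by
  have := swapHom_naturality (𝟙 A) (𝟙 B) f
  simp only [id_tensorHom] at this
  simp only [whiskerLeft_comp, Category.assoc, this]
  simp [swapHom]

theorem append_appendRight (X : ι → C) (k : List ι) {l l' : List ι} (p : Rearr l l') :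
    p.eval X ▷ listTensor X k ≫ append X l' k = append X l k ≫ (p.appendRight k).eval X := by
  induction p with
  | nil =>
    exact (by simp : 𝟙 (𝟙_ C) ▷ _ ≫ (λ_ (listTensor X k)).hom = (λ_ (listTensor X k)).hom ≫ 𝟙 _).trans
      (congrArg ((λ_ (listTensor X k)).hom ≫ ·) (Rearr.eval_refl X k).symm)
  | cons a p ih =>
    dsimp only [Rearr.appendRight, Rearr.eval, append, listTensor, List.cons_append]
    rw [Category.assoc, ← whiskerLeft_comp, ← ih]
    simp
  | swap a b l => exact swapHom_whiskerRight _ _ _ _ _ (append X l k)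
  | trans p q ihp ihq =>
    dsimp only [Rearr.appendRight, Rearr.eval]
    rw [comp_whiskerRight, Category.assoc, ihq, ← Category.assoc, ihp, Category.assoc]

theorem append_appendLeft (X : ι → C) {k k' : List ι} (p : Rearr k k') (l : List ι) :
    listTensor X l ◁ p.eval X ≫ append X l k' = append X l k ≫ (p.appendLeft l).eval X := by
  induction l with
  | nil =>
    dsimp only [Rearr.appendLeft, append, listTensor]
    exact leftUnitor_naturality _
  | cons a l ih =>
    dsimp only [Rearr.appendLeft, Rearr.eval, append, listTensor, List.cons_append]
    rw [Category.assoc, ← whiskerLeft_comp, ← ih]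
    simp

theorem moveFront_aux {A B K Z W V : C} (f : K ⊗ Z ⟶ W) (r : A ⊗ W ⟶ V) (g : K ⊗ (A ⊗ Z) ⟶ V)
    (h : A ◁ f ≫ r = swapHom A K Z ≫ g) :
    A ◁ ((α_ B K Z).hom ≫ B ◁ f) ≫ (swapHom A B W ≫ B ◁ r) =
      swapHom A (B ⊗ K) Z ≫ ((α_ B K (A ⊗ Z)).hom ≫ B ◁ g) := by
  have n := swapHom_naturality (𝟙 A) (𝟙 B) f
  simp only [id_tensorHom] at n
  rw [whiskerLeft_comp, Category.assoc, ← Category.assoc (A ◁ B ◁ _), n, swapHom_tensor_right,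
    Category.assoc, ← whiskerLeft_comp, h]
  simp

theorem moveFront_nil (A Z : C) :
    A ◁ (λ_ Z).hom ≫ 𝟙 (A ⊗ Z) = swapHom A (𝟙_ C) Z ≫ (λ_ (A ⊗ Z)).hom := by
  simp [swapHom]

theorem exists_moveFront (X : ι → C) (x : ι) (k z : List ι) :
    ∃ r : Rearr (x :: (k ++ z)) (k ++ (x :: z)), X x ◁ append X k z ≫ r.eval X =
      swapHom (X x) (listTensor X k) (listTensor X z) ≫ append X k (x :: z) := by
  induction k with
  | nil =>
    exact ⟨Rearr.refl _, (congrArg (X x ◁ (λ_ (listTensor X z)).hom ≫ ·)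
      (Rearr.eval_refl X (x :: z))).trans (moveFront_nil _ _)⟩
  | cons b k ih =>
    obtain ⟨r, hr⟩ := ih
    exact ⟨.trans (.swap x b (k ++ z)) (.cons b r), moveFront_aux _ _ _ hr⟩

theorem blockSwap_aux {A L K Z KZ LKZ LZ KLZ V : C} (f : K ⊗ Z ⟶ KZ) (g : L ⊗ KZ ⟶ LKZ)
    (r : LKZ ⟶ KLZ) (f' : L ⊗ Z ⟶ LZ) (g' : K ⊗ LZ ⟶ KLZ) (q : A ⊗ KLZ ⟶ V)
    (g'' : K ⊗ (A ⊗ LZ) ⟶ V) (hr : (L ◁ f ≫ g) ≫ r = swapHom L K Z ≫ K ◁ f' ≫ g')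
    (hq : A ◁ g' ≫ q = swapHom A K LZ ≫ g'') :
    ((A ⊗ L) ◁ f ≫ ((α_ A L KZ).hom ≫ A ◁ g)) ≫ (A ◁ r ≫ q) =
      swapHom (A ⊗ L) K Z ≫ K ◁ ((α_ A L Z).hom ≫ A ◁ f') ≫ g'' := by
  have n := swapHom_naturality (𝟙 A) (𝟙 K) f'
  simp only [id_tensorHom] at n
  have hr' := congrArg (fun t => (α_ A L (K ⊗ Z)).hom ≫ A ◁ t ≫ q) hr
  simp only [whiskerLeft_comp, Category.assoc, hq] at hr'
  rw [← Category.assoc (A ◁ K ◁ f'), n] at hr'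
  rw [swapHom_tensor_left]
  simp only [Category.assoc, whiskerLeft_comp, whiskerLeft_inv_hom_assoc]
  simp only [Category.assoc] at hr'
  rw [← hr']
  simp

theorem exists_blockSwap (X : ι → C) (l k z : List ι) :
    ∃ r : Rearr (l ++ (k ++ z)) (k ++ (l ++ z)),
      (listTensor X l ◁ append X k z ≫ append X l (k ++ z)) ≫ r.eval X =
        swapHom (listTensor X l) (listTensor X k) (listTensor X z) ≫
          listTensor X k ◁ append X l z ≫ append X k (l ++ z) := by
  induction l with
  | nil =>
    exact ⟨Rearr.refl _, (congrArg ((𝟙_ C ◁ append X k z ≫ (λ_ (listTensor X (k ++ z))).hom) ≫ ·)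
      (Rearr.eval_refl X (k ++ z))).trans (by dsimp only [append, listTensor]; simp [swapHom])⟩
  | cons a l ih =>
    obtain ⟨r, hr⟩ := ih
    obtain ⟨q, hq⟩ := exists_moveFront X a k (l ++ z)
    exact ⟨.trans (.cons a r) q, blockSwap_aux _ _ _ _ _ _ _ hr hq⟩

variable {κ' : ι → Type}

/-- The concatenation of the lists `m i`, `i` in `l`. -/
def blocks (m : ∀ i, List (κ' i)) : List ι → List (Σ i, κ' i)
  | [] => []
  | a :: l => (m a).map (Sigma.mk a) ++ blocks m l

/-- An iterated tensor product is a tensor product over the concatenated list. -/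
def flat (Y : ∀ i, κ' i → C) (m : ∀ i, List (κ' i)) : (l : List ι) →
    (listTensor (fun i => listTensor (Y i) (m i)) l ⟶
      listTensor (fun p : Σ i, κ' i => Y p.1 p.2) (blocks m l))
  | [] => 𝟙 _
  | a :: l => (listMap (Sigma.mk a) (fun b => 𝟙 (Y a b)) (m a) ⊗ₘ flat Y m l) ≫
      append (fun p : Σ i, κ' i => Y p.1 p.2) _ _

theorem isEnum_blocks {m : ∀ i, List (κ' i)} (hm : ∀ i, IsEnum (m i)) {l : List ι}
    (hl : IsEnum l) : IsEnum (blocks m l) := by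
  have mem : ∀ (l : List ι) (p : Σ i, κ' i), p ∈ blocks m l ↔ p.1 ∈ l := by
    intro l p
    induction l with
    | nil => simp [blocks]
    | cons a l ih =>
      simp only [blocks, List.mem_append, List.mem_map, ih, List.mem_cons]
      refine or_congr ⟨?_, ?_⟩ Iff.rfl
      · rintro ⟨b, -, rfl⟩
        rfl
      · obtain ⟨i, b⟩ := p
        rintro rfl
        exact ⟨b, (hm _).2 b, rfl⟩
  refine ⟨?_, fun p => (mem l p).2 (hl.2 p.1)⟩
  have nd := hl.1
  clear hl
  induction l with
  | nil => exact List.nodup_nil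
  | cons a l ih =>
    refine List.Nodup.append ((hm a).1.map sigma_mk_injective) (ih (List.nodup_cons.1 nd).2) ?_
    intro p hp hp'
    obtain ⟨b, -, rfl⟩ := List.mem_map.1 hp
    exact (List.nodup_cons.1 nd).1 ((mem l _).1 hp')

theorem flat_swap_aux {A B Z A' B' Z' W₁ W₂ V₁ V₂ : C} (a : A ⟶ A') (b : B ⟶ B') (z : Z ⟶ Z')
    (f : B' ⊗ Z' ⟶ W₁) (g : A' ⊗ W₁ ⟶ V₁) (f' : A' ⊗ Z' ⟶ W₂) (g' : B' ⊗ W₂ ⟶ V₂) (r : V₁ ⟶ V₂)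
    (hr : (A' ◁ f ≫ g) ≫ r = swapHom A' B' Z' ≫ B' ◁ f' ≫ g') :
    swapHom A B Z ≫ ((b ⊗ₘ ((a ⊗ₘ z) ≫ f')) ≫ g') = ((a ⊗ₘ ((b ⊗ₘ z) ≫ f)) ≫ g) ≫ r := by
  have h₁ : b ⊗ₘ ((a ⊗ₘ z) ≫ f') = (b ⊗ₘ (a ⊗ₘ z)) ≫ B' ◁ f' := by
    rw [tensorHom_comp_whiskerLeft]
  have h₂ : a ⊗ₘ ((b ⊗ₘ z) ≫ f) = (a ⊗ₘ (b ⊗ₘ z)) ≫ A' ◁ f := by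
    rw [tensorHom_comp_whiskerLeft]
  simp only [Category.assoc] at hr
  rw [h₁, h₂]
  simp only [Category.assoc]
  rw [hr, ← Category.assoc, ← swapHom_naturality, Category.assoc]

theorem exists_flat_rearr (Y : ∀ i, κ' i → C) (m : ∀ i, List (κ' i)) {l l' : List ι}
    (p : Rearr l l') : ∃ q : Rearr (blocks m l) (blocks m l'),
      p.eval _ ≫ flat Y m l' = flat Y m l ≫ q.eval _ := by
  induction p with
  | nil => exact ⟨.nil, rfl⟩
  | cons a p ih =>
    obtain ⟨q, hq⟩ := ih
    refine ⟨q.appendLeft _, ?_⟩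
    dsimp only [flat, blocks, Rearr.eval, listTensor]
    rw [Category.assoc, ← append_appendLeft, whiskerLeft_comp_tensorHom_assoc, hq,
      tensorHom_comp_whiskerLeft_assoc]
  | swap a b l =>
    obtain ⟨r, hr⟩ := exists_blockSwap (fun p : Σ i, κ' i => Y p.1 p.2)
      ((m a).map (Sigma.mk a)) ((m b).map (Sigma.mk b)) (blocks m l)
    exact ⟨r, flat_swap_aux _ _ _ _ _ _ _ _ hr⟩
  | trans p q ihp ihq =>
    obtain ⟨r, hr⟩ := ihp
    obtain ⟨s, hs⟩ := ihq
    refine ⟨.trans r s, ?_⟩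
    dsimp only [Rearr.eval]
    rw [Category.assoc, hs, ← Category.assoc, hr, Category.assoc]

/-- Tensor product of maps along a fixed list. -/
def listHom {X X' : ι → C} (g : ∀ i, X i ⟶ X' i) : (l : List ι) → (listTensor X l ⟶ listTensor X' l)
  | [] => 𝟙 _
  | a :: l => g a ⊗ₘ listHom g l

theorem exists_flat_blocks (Y : ∀ i, κ' i → C) {m m' : ∀ i, List (κ' i)}
    (r : ∀ i, Rearr (m i) (m' i)) (l : List ι) : ∃ q : Rearr (blocks m l) (blocks m' l),
      listHom (fun i => (r i).eval (Y i)) l ≫ flat Y m' l = flat Y m l ≫ q.eval _ := by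
  induction l with
  | nil => exact ⟨.nil, rfl⟩
  | cons a l ih =>
    obtain ⟨q, hq⟩ := ih
    refine ⟨.trans (((r a).map (Sigma.mk a)).appendRight _) (q.appendLeft _), ?_⟩
    dsimp only [flat, blocks, Rearr.eval, listTensor, listHom]
    rw [Category.assoc, ← Category.assoc (append _ _ _), ← append_appendRight, Category.assoc,
      ← append_appendLeft, tensorHom_comp_tensorHom_assoc, hq, eval_listMap,
      tensorHom_comp_whiskerRight_assoc, tensorHom_comp_whiskerLeft_assoc]

theorem eval_listHom {X X' : ι → C} (g : ∀ i, X i ⟶ X' i) {l l' : List ι} (p : Rearr l l') :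
    p.eval X ≫ listHom g l' = listHom g l ≫ p.eval X' := by
  induction p with
  | nil => rfl
  | cons a p ih =>
    dsimp only [Rearr.eval, listHom, listTensor]
    rw [whiskerLeft_comp_tensorHom, tensorHom_comp_whiskerLeft, ih]
  | swap a b l => exact (swapHom_naturality (g a) (g b) (listHom g l)).symm
  | trans p q ihp ihq =>
    dsimp only [Rearr.eval]
    rw [Category.assoc, ihq, ← Category.assoc, ihp, Category.assoc]

/-- An iterated unordered tensor product is the unordered tensor product over the disjoint union of
the index sets. -/
def unSigma [Finite ι] [∀ i, Finite (κ' i)] (Y : ∀ i, κ' i → C) :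
    unTensor (fun i => unTensor (Y i)) ⟶ unTensor (fun p : Σ i, κ' i => Y p.1 p.2) :=
  flat Y (fun i => enum (κ' i)) (enum ι) ≫
    ins _ _ (isEnum_blocks (fun i => isEnum_enum (κ' i)) (isEnum_enum ι))

theorem ins_unSigma [Finite ι] [∀ i, Finite (κ' i)] (Y : ∀ i, κ' i → C) (l : List ι)
    (hl : IsEnum l) (m : ∀ i, List (κ' i)) (hm : ∀ i, IsEnum (m i)) :
    listHom (fun i => ins (Y i) (m i) (hm i)) l ≫ ins _ l hl ≫ unSigma Y =
      flat Y m l ≫ ins _ _ (isEnum_blocks hm hl) := by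
  obtain ⟨p, hp⟩ : ∃ p : Rearr l (enum ι), ∀ X : ι → C, ins X l hl = p.eval X := ⟨_, fun _ => rfl⟩
  obtain ⟨r, hr⟩ : ∃ r : ∀ i, Rearr (m i) (enum (κ' i)),
      ∀ i, ins (Y i) (m i) (hm i) = (r i).eval (Y i) := ⟨_, fun _ => rfl⟩
  obtain ⟨q, hq⟩ := exists_flat_rearr Y (fun i => enum (κ' i)) p
  obtain ⟨s, hs⟩ := exists_flat_blocks Y r l
  have he := isEnum_blocks (fun i => isEnum_enum (κ' i)) hl
  simp only [hp, hr]
  rw [unSigma, ← Category.assoc (p.eval _), hq, Category.assoc, eval_ins _ he, ← Category.assoc,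
    hs, Category.assoc, eval_ins]

def Rearr.mapAppend (e : ι → κ) (k : List ι) : (l : List ι) →
    Rearr ((l ++ k).map e) (l.map e ++ k.map e)
  | [] => Rearr.refl _
  | a :: l => .cons (e a) (mapAppend e k l)

theorem append_listMap {X : ι → C} {Y : κ → C} (e : ι → κ) (g : ∀ i, X i ⟶ Y (e i))
    (l k : List ι) :
    append X l k ≫ listMap e g (l ++ k) ≫ (Rearr.mapAppend e k l).eval Y =
      (listMap e g l ⊗ₘ listMap e g k) ≫ append Y (l.map e) (k.map e) := by
  induction l with
  | nil =>
    have h := Rearr.eval_refl Y (k.map e)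
    exact (congrArg (fun t => (λ_ _).hom ≫ listMap e g k ≫ t) h).trans
      (by simp : (λ_ _).hom ≫ listMap e g k ≫ 𝟙 _ = (𝟙 (𝟙_ C) ⊗ₘ listMap e g k) ≫ (λ_ _).hom)
  | cons a l ih =>
    have ih' := congrArg (fun t => (α_ (X a) (listTensor X l) (listTensor X k)).hom ≫ (g a ⊗ₘ t)) ih
    dsimp only [append, listMap, listTensor, List.map, List.cons_append, Rearr.mapAppend,
      Rearr.eval] at ih' ⊢
    rw [tensorHom_comp_whiskerLeft, Category.assoc, whiskerLeft_comp_tensorHom, ih',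
      ← tensorHom_comp_whiskerLeft, associator_naturality_assoc]

theorem flat_cons_aux {A B A' B' A₂ B₂ V P Q W W' W₂ P' Q' W₃ : C} (a : A ⟶ A') (b : B ⟶ B')
    (s : A' ⟶ A₂) (t : B' ⟶ B₂) (app₂ : A₂ ⊗ B₂ ⟶ V) (s₀ : A ⟶ P) (t₀ : B ⟶ Q)
    (app₀ : P ⊗ Q ⟶ W) (M : W ⟶ W') (ma : W' ⟶ W₂) (x : P ⟶ P') (y : Q ⟶ Q')
    (app₁ : P' ⊗ Q' ⟶ W₂) (r : P' ⟶ A₂) (q : Q' ⟶ B₂) (R : W₂ ⟶ W₃) (S : W₃ ⟶ V)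
    (app' : A₂ ⊗ Q' ⟶ W₃) (h : app₀ ≫ M ≫ ma = (x ⊗ₘ y) ≫ app₁)
    (h₁ : r ▷ Q' ≫ app' = app₁ ≫ R) (h₂ : A₂ ◁ q ≫ app₂ = app' ≫ S)
    (hr : s₀ ≫ x ≫ r = a ≫ s) (hq : b ≫ t = t₀ ≫ y ≫ q) :
    (a ⊗ₘ b) ≫ ((s ⊗ₘ t) ≫ app₂) = ((s₀ ⊗ₘ t₀) ≫ app₀) ≫ M ≫ (ma ≫ (R ≫ S)) := by
  have h' := congrArg (fun z => (s₀ ⊗ₘ t₀) ≫ z ≫ R ≫ S) h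
  simp only [Category.assoc] at h' ⊢
  rw [h', ← Category.assoc app₁, ← h₁, Category.assoc, ← h₂, tensorHom_comp_tensorHom_assoc,
    tensorHom_comp_tensorHom_assoc, tensorHom_comp_whiskerRight_assoc,
    tensorHom_comp_whiskerLeft_assoc, Category.assoc, Category.assoc, hr, hq]

theorem exists_map_mk {κ'' : ι → Type} {Y : ∀ i, κ' i → C} {Y' : ∀ i, κ'' i → C}
    (e : ∀ i, κ' i → κ'' i) (g : ∀ i b, Y i b ⟶ Y' i (e i b)) (a : ι) (k : List (κ' a)) :
    ∃ q : Rearr ((k.map (Sigma.mk a)).map (fun p => ⟨p.1, e p.1 p.2⟩)) ((k.map (e a)).map (Sigma.mk a)),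
      listMap (Y := fun p : Σ i, κ' i => Y p.1 p.2) (Sigma.mk a) (fun b => 𝟙 (Y a b)) k ≫
        listMap (Y := fun p : Σ i, κ'' i => Y' p.1 p.2) (fun p => ⟨p.1, e p.1 p.2⟩) (fun p => g p.1 p.2) _ ≫
          q.eval _ =
      listMap (e a) (g a) k ≫
        listMap (Y := fun p : Σ i, κ'' i => Y' p.1 p.2) (Sigma.mk a) (fun b => 𝟙 (Y' a b)) _ := by
  induction k with
  | nil => exact ⟨.nil, Category.id_comp (𝟙 _ ≫ 𝟙 _)⟩
  | cons b k ih =>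
    obtain ⟨q, hq⟩ := ih
    refine ⟨.cons _ q, ?_⟩
    dsimp only [listMap, listTensor, List.map, Rearr.eval] at hq ⊢
    rw [tensorHom_comp_whiskerLeft, tensorHom_comp_tensorHom, tensorHom_comp_tensorHom, hq,
      Category.id_comp, Category.comp_id]

theorem flat_map (Y : ∀ i, κ' i → C) {κ'' : ι → Type} (Y' : ∀ i, κ'' i → C)
    (e : ∀ i, κ' i → κ'' i) (g : ∀ i b, Y i b ⟶ Y' i (e i b)) (m : ∀ i, List (κ' i)) (l : List ι) :
    ∃ q : Rearr ((blocks m l).map (fun p => ⟨p.1, e p.1 p.2⟩)) (blocks (fun i => (m i).map (e i)) l),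
    listHom (fun i => listMap (e i) (g i) (m i)) l ≫ flat Y' (fun i => (m i).map (e i)) l =
      flat Y m l ≫ listMap (Y := fun p : Σ i, κ'' i => Y' p.1 p.2) (fun p => ⟨p.1, e p.1 p.2⟩)
        (fun p => g p.1 p.2) _ ≫ q.eval _ := by
  induction l with
  | nil => exact ⟨.nil, (Category.id_comp (𝟙 _ ≫ 𝟙 _)).symm⟩
  | cons a l ih =>
    obtain ⟨q, hq⟩ := ih
    obtain ⟨r, hr⟩ := exists_map_mk e g a (m a)
    refine ⟨.trans (Rearr.mapAppend _ _ _) (.trans (r.appendRight _) (q.appendLeft _)), ?_⟩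
    exact flat_cons_aux _ _ _ _ _ _ _ _ _ _ _ _ _ _ _ _ _ _ (append_listMap _ _ _ _)
      (append_appendRight _ _ r) (append_appendLeft _ q _) hr hq

theorem exists_map_mk_reindex {κ'' : κ → Type} (Y : ∀ i, κ'' i → C) (e : ι → κ) (a : ι)
    (k : List (κ'' (e a))) :
    ∃ q : Rearr ((k.map (Sigma.mk (β := fun i => κ'' (e i)) a)).map
        (fun p : Σ i, κ'' (e i) => (⟨e p.1, p.2⟩ : Σ j, κ'' j))) (k.map (Sigma.mk (e a))),
      listMap (Y := fun p : Σ i, κ'' (e i) => Y (e p.1) p.2) (Sigma.mk a)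
          (fun b => 𝟙 (Y (e a) b)) k ≫
        listMap (Y := fun p : Σ i, κ'' i => Y p.1 p.2) (fun p : Σ i, κ'' (e i) => (⟨e p.1, p.2⟩ : Σ j, κ'' j))
          (fun _ => 𝟙 _) _ ≫ q.eval _ =
      listMap (Y := fun p : Σ i, κ'' i => Y p.1 p.2) (Sigma.mk (e a))
        (fun b => 𝟙 (Y (e a) b)) k := by
  induction k with
  | nil => exact ⟨.nil, (Category.id_comp _).trans (Category.id_comp _)⟩
  | cons b k ih =>
    obtain ⟨q, hq⟩ := ih
    refine ⟨.cons _ q, ?_⟩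
    dsimp only [listMap, listTensor, List.map, Rearr.eval] at hq ⊢
    rw [tensorHom_comp_whiskerLeft, tensorHom_comp_tensorHom, hq, Category.id_comp]

theorem flat_reindex {κ'' : κ → Type} (Y : ∀ i, κ'' i → C) (e : ι → κ)
    (m : ∀ i, List (κ'' i)) (l : List ι) :
    ∃ q : Rearr ((blocks (fun i => m (e i)) l).map (fun p : Σ i, κ'' (e i) => (⟨e p.1, p.2⟩ : Σ j, κ'' j)))
      (blocks m (l.map e)),
    listMap (Y := fun i => listTensor (Y i) (m i)) e (fun i => 𝟙 (listTensor (Y (e i)) (m (e i)))) l ≫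
        flat Y m (l.map e) =
      flat (fun i => Y (e i)) (fun i => m (e i)) l ≫
        listMap (Y := fun p : Σ i, κ'' i => Y p.1 p.2) (fun p : Σ i, κ'' (e i) => (⟨e p.1, p.2⟩ : Σ j, κ'' j))
          (fun _ => 𝟙 _) _ ≫ q.eval _ := by
  induction l with
  | nil => exact ⟨.nil, (Category.id_comp (𝟙 _ ≫ 𝟙 _)).symm⟩
  | cons a l ih =>
    obtain ⟨q, hq⟩ := ih
    obtain ⟨r, hr⟩ := exists_map_mk_reindex Y e a (m (e a))
    refine ⟨.trans (Rearr.mapAppend _ _ _) (.trans (r.appendRight _) (q.appendLeft _)), ?_⟩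
    exact flat_cons_aux _ _ _ _ _ _ _ _ _ _ _ _ _ _ _ _ _ _ (append_listMap _ _ _ _)
      (append_appendRight _ _ r) (append_appendLeft _ q _) (hr.trans (Category.id_comp _).symm) hq

theorem bijective_sigma {κ'' : κ → Type} {e : ι → κ} (he : Function.Bijective e)
    {f : ∀ i, κ' i → κ'' (e i)} (hf : ∀ i, Function.Bijective (f i)) :
    Function.Bijective (fun p : Σ i, κ' i => (⟨e p.1, f p.1 p.2⟩ : Σ j, κ'' j)) :=
  ⟨he.1.sigma_map fun i => (hf i).1, he.2.sigma_map fun i => (hf i).2⟩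

theorem listMap_listHom {X : ι → C} {X' : ι → C} {Y : κ → C} (e : ι → κ)
    (f : ∀ i, X i ⟶ X' i) (g : ∀ i, X' i ⟶ Y (e i)) (l : List ι) :
    listHom f l ≫ listMap e g l = listMap e (fun i => f i ≫ g i) l := by
  induction l with
  | nil => exact Category.id_comp _
  | cons a l ih =>
    dsimp only [listMap, listTensor, List.map, listHom]
    rw [tensorHom_comp_tensorHom, ih]

theorem listHom_comp {X X' X'' : ι → C} (f : ∀ i, X i ⟶ X' i) (g : ∀ i, X' i ⟶ X'' i)
    (l : List ι) : listHom f l ≫ listHom g l = listHom (fun i => f i ≫ g i) l := by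
  induction l with
  | nil => exact Category.id_comp _
  | cons a l ih =>
    dsimp only [listTensor, listHom]
    rw [tensorHom_comp_tensorHom, ih]

theorem listHom_id (X : ι → C) (l : List ι) : listHom (fun i => 𝟙 (X i)) l = 𝟙 _ := by
  induction l with
  | nil => rfl
  | cons a l ih =>
    dsimp only [listTensor, listHom]
    rw [ih, id_tensorHom_id]

theorem unMap_eq_listHom [Finite ι] {X X' : ι → C} (g : ∀ i, X i ⟶ X' i) :
    unMap id Function.bijective_id g = listHom g (enum ι) := by
  have h := listMap_listHom id g (fun i => 𝟙 (X' i)) (enum ι)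
  simp only [Category.comp_id] at h
  have h' : unMap id Function.bijective_id g =
      listMap id g (enum ι) ≫ (Rearr.mapId (enum ι)).eval X' := by
    rw [unMap, ← eval_ins X' ((isEnum_enum ι).map Function.bijective_id) (isEnum_enum ι)
      (Rearr.mapId _), ins_enum]
    exact congrArg (listMap id g (enum ι) ≫ ·) (Category.comp_id _)
  rw [h', ← h, Category.assoc, listMap_id, Category.comp_id]

theorem unSigma_reindex [Finite ι] [Finite κ] {κ'' : κ → Type} [∀ i, Finite (κ'' i)]
    (Y : ∀ i, κ'' i → C) (e : ι → κ) (he : Function.Bijective e) :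
    unMap (Y := fun i => unTensor (Y i)) e he (fun i => 𝟙 (unTensor (Y (e i)))) ≫ unSigma Y =
      unSigma (fun i => Y (e i)) ≫
        unMap (Y := fun p : Σ i, κ'' i => Y p.1 p.2) (fun p : Σ i, κ'' (e i) => ⟨e p.1, p.2⟩)
          (bijective_sigma he fun _ => Function.bijective_id) (fun p => 𝟙 (Y (e p.1) p.2)) := by
  have hm := fun i => isEnum_enum (κ'' i)
  obtain ⟨q, hq⟩ := flat_reindex Y e (fun i => enum (κ'' i)) (enum ι)
  have h := ins_unSigma Y _ ((isEnum_enum ι).map he) _ hm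
  simp only [ins_enum, listHom_id, Category.id_comp] at h
  rw [unMap, Category.assoc, h, ← Category.assoc, hq, unSigma]
  simp only [Category.assoc]
  rw [ins_unMap, eval_ins]

theorem unSigma_map [Finite ι] {κ'' : ι → Type} [∀ i, Finite (κ' i)] [∀ i, Finite (κ'' i)]
    (Y : ∀ i, κ' i → C) (Y' : ∀ i, κ'' i → C) (f : ∀ i, κ' i → κ'' i)
    (hf : ∀ i, Function.Bijective (f i)) (g : ∀ i b, Y i b ⟶ Y' i (f i b)) :
    unMap (X := fun i => unTensor (Y i)) (Y := fun i => unTensor (Y' i)) id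
        Function.bijective_id (fun i => unMap (f i) (hf i) (g i)) ≫ unSigma Y' =
      unSigma Y ≫ unMap (Y := fun p : Σ i, κ'' i => Y' p.1 p.2)
        (fun p : Σ i, κ' i => ⟨p.1, f p.1 p.2⟩) (bijective_sigma Function.bijective_id hf)
        (fun p => g p.1 p.2) := by
  obtain ⟨q, hq⟩ := flat_map Y Y' f g (fun i => enum (κ' i)) (enum ι)
  have h := ins_unSigma Y' _ (isEnum_enum ι) _ (fun i => (isEnum_enum (κ' i)).map (hf i))
  rw [ins_enum, Category.id_comp] at h
  have h₀ : unMap (X := fun i => unTensor (Y i)) (Y := fun i => unTensor (Y' i)) id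
      Function.bijective_id (fun i => unMap (f i) (hf i) (g i)) =
      listHom (fun i => listMap (f i) (g i) (enum (κ' i)) ≫
        ins (Y' i) _ ((isEnum_enum (κ' i)).map (hf i))) (enum ι) := unMap_eq_listHom _
  rw [h₀, ← listHom_comp, Category.assoc, h, ← Category.assoc, hq, unSigma]
  simp only [Category.assoc]
  have h' := ins_unMap (Y := fun p : Σ i, κ'' i => Y' p.1 p.2)
    (fun p : Σ i, κ' i => ⟨p.1, f p.1 p.2⟩) (bijective_sigma Function.bijective_id hf)
    (fun p => g p.1 p.2) _ (isEnum_blocks (fun i => isEnum_enum (κ' i)) (isEnum_enum ι))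
  rw [eval_ins, ← h']
  exact (isEnum_blocks (fun i => isEnum_enum (κ' i)) (isEnum_enum ι)).map
    (bijective_sigma Function.bijective_id hf)

/-- Naturality of the identification of iterated tensor products. -/
theorem unSigma_naturality [Finite ι] [Finite κ] {κ'' : κ → Type} [∀ i, Finite (κ' i)]
    [∀ i, Finite (κ'' i)] (Y : ∀ i, κ' i → C) (Y' : ∀ i, κ'' i → C) (e : ι → κ)
    (he : Function.Bijective e) (f : ∀ i, κ' i → κ'' (e i)) (hf : ∀ i, Function.Bijective (f i))
    (g : ∀ i b, Y i b ⟶ Y' (e i) (f i b)) :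
    unMap (Y := fun i => unTensor (Y' i)) e he (fun i => unMap (f i) (hf i) (g i)) ≫ unSigma Y' =
      unSigma Y ≫ unMap (Y := fun p : Σ i, κ'' i => Y' p.1 p.2)
        (fun p : Σ i, κ' i => ⟨e p.1, f p.1 p.2⟩) (bijective_sigma he hf)
        (fun p => g p.1 p.2) := by
  have h₁ := unMap_comp (Z := fun i => unTensor (Y' i)) id Function.bijective_id e he
    (fun i => unMap (f i) (hf i) (g i)) (fun i => 𝟙 (unTensor (Y' (e i))))
  simp only [Category.comp_id] at h₁
  refine (congrArg (· ≫ unSigma Y') h₁.symm).trans ?_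
  simp only [Category.assoc]
  rw [unSigma_reindex, ← Category.assoc, unSigma_map Y (fun i => Y' (e i)) f hf g, Category.assoc,
    unMap_comp]
  simp only [Category.comp_id]
  rfl

end UnorderedTensor

section Trees

/-- A finite set as an object of the category `Σ_*` of finite sets and bijections. -/
def Sig.of (α : Type) [Finite α] : Core FintypeCat.{0} := ⟨FintypeCat.of α⟩

/-- A bijection as a morphism of `Σ_*`. -/
def Sig.map {α β : Type} [Finite α] [Finite β] (e : α ≃ β) : Sig.of α ⟶ Sig.of β :=
  ⟨FintypeCat.equivEquivIso (A := FintypeCat.of α) (B := FintypeCat.of β) e⟩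

theorem Sig.map_refl (α : Type) [Finite α] : Sig.map (Equiv.refl α) = 𝟙 _ := rfl

theorem Sig.map_comp {α β δ : Type} [Finite α] [Finite β] [Finite δ] (e : α ≃ β) (e' : β ≃ δ) :
    Sig.map e ≫ Sig.map e' = Sig.map (e.trans e') := rfl

/-- Chains of maps of finite sets `S 0 ← S 1 ← ⋯ ← S n` in which `S 0` has one element; all composite
maps `f : S j → S i`, `i ≤ j`, are part of the data. In other words, contravariant functors from the
poset `{0 < 1 < ⋯ < n}` to finite sets sending `0` to a one-element set. -/
structure LevelTree (n : ℕ) where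
  S : Fin (n + 1) → Type
  finite : ∀ i, Finite (S i)
  f : ∀ {i j : Fin (n + 1)}, i ≤ j → S j → S i
  f_refl : ∀ {i : Fin (n + 1)} (h : i ≤ i) (x : S i), f h x = x
  f_trans : ∀ {i j k : Fin (n + 1)} (h : i ≤ j) (h' : j ≤ k) (x : S k),
    f h (f h' x) = f (h.trans h') x
  root_nonempty : Nonempty (S 0)
  root_subsingleton : Subsingleton (S 0)

namespace LevelTree

variable {n m : ℕ}

instance (X : LevelTree n) (i : Fin (n + 1)) : Finite (X.S i) := X.finite i

/-- Natural isomorphisms of chains. -/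
@[ext]
structure Hom (X Y : LevelTree n) where
  e : ∀ i, X.S i ≃ Y.S i
  comm : ∀ {i j : Fin (n + 1)} (h : i ≤ j) (x : X.S j), e i (X.f h x) = Y.f h (e j x)

/-- The category `Σ_*^{≀ n}` of chains and natural isomorphisms. -/
instance : Category (LevelTree n) where
  Hom := Hom
  id X := ⟨fun i => Equiv.refl _, fun _ _ => rfl⟩
  comp a b := ⟨fun i => (a.e i).trans (b.e i), fun h x => by
    simp only [Equiv.trans_apply, a.comm, b.comm]⟩

/-- Levels with equal indices. -/
def cast (X : LevelTree n) {i j : Fin (n + 1)} (h : i = j) : X.S i ≃ X.S j where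
  toFun := X.f h.ge
  invFun := X.f h.le
  left_inv x := by rw [X.f_trans, X.f_refl]
  right_inv x := by rw [X.f_trans, X.f_refl]

variable (n) in
/-- `γ^n`, forgetting all but the top set of a chain. -/
def gamma : LevelTree n ⥤ Core FintypeCat.{0} where
  obj X := Sig.of (X.S (Fin.last n))
  map a := Sig.map (a.e (Fin.last n))

end LevelTree

/-- Monotone maps `{0 < ⋯ < m} → {0 < ⋯ < n}` that preserve the two end points. -/
structure EndMap (m n : ℕ) where
  toFun : Fin (m + 1) → Fin (n + 1)
  mono : Monotone toFun
  zero : toFun 0 = 0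
  last : toFun (Fin.last m) = Fin.last n

namespace LevelTree

variable {n m : ℕ}

/-- The functor `Σ_*^{≀ n} ⥤ Σ_*^{≀ m}` given by composing chains with `φ`. -/
def pull (φ : EndMap m n) : LevelTree n ⥤ LevelTree m where
  obj X :=
    { S := fun i => X.S (φ.toFun i)
      finite := fun _ => inferInstance
      f := fun h => X.f (φ.mono h)
      f_refl := fun _ x => X.f_refl _ x
      f_trans := fun _ _ x => X.f_trans _ _ x
      root_nonempty := by rw [φ.zero]; exact X.root_nonempty
      root_subsingleton := by rw [φ.zero]; exact X.root_subsingleton }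
  map a := ⟨fun i => a.e (φ.toFun i), fun h x => a.comm (φ.mono h) x⟩

/-- The identification `γ^n = γ^m ∘ φ^*`. -/
def gammaPull (φ : EndMap m n) : gamma n ⟶ pull φ ⋙ gamma m where
  app X := Sig.map (X.cast φ.last.symm)
  naturality X Y a := by
    refine (Sig.map_comp _ _).trans (Eq.trans ?_ (Sig.map_comp _ _).symm)
    congr 1
    ext x
    exact (a.comm _ x).symm

/-- The interior vertices of the level tree of a chain: the elements of `S 0, …, S (n-1)`. -/
abbrev V (X : LevelTree n) : Type := Σ i : Fin n, X.S i.castSucc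

/-- The incoming edges of a vertex `s ∈ S i`: the fibre of `S (i+1) → S i` over `s`. -/
abbrev In (X : LevelTree n) (v : X.V) : Type :=
  {t : X.S v.1.succ // X.f (Fin.castSucc_le_succ v.1) t = v.2}

/-- The map of vertices induced by an isomorphism of chains. -/
abbrev Hom.v {X Y : LevelTree n} (a : X ⟶ Y) (v : X.V) : Y.V := ⟨v.1, a.e _ v.2⟩

theorem Hom.v_bijective {X Y : LevelTree n} (a : X ⟶ Y) : Function.Bijective (Hom.v a) :=
  bijective_sigma (e := fun i : Fin n => i) (f := fun i => a.e i.castSucc)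
    Function.bijective_id fun i => (a.e i.castSucc).bijective

/-- The bijection of incoming edges induced by an isomorphism of chains. -/
def Hom.inEquiv {X Y : LevelTree n} (a : X ⟶ Y) (v : X.V) : X.In v ≃ Y.In (Hom.v a v) :=
  (a.e v.1.succ).subtypeEquiv fun t => by
    have h := a.comm (Fin.castSucc_le_succ v.1) t
    exact (a.e v.1.castSucc).injective.eq_iff.symm.trans (by rw [h])

end LevelTree

end Trees

open LevelTree

section Circ

variable {C : Type u} [Category.{v} C] [MonoidalCategory C] [SymmetricCategory C]

variable (C) in
/-- Symmetric sequences in `C`. -/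
abbrev SymSeq : Type _ := Core FintypeCat.{0} ⥤ C

/-- The product `A₁ ⊚ ⋯ ⊚ Aₙ`, a functor on level trees: the unordered tensor product, over all
vertices, of the value of `A (i+1)` (here indexed by `i : Fin n`) at the set of incoming edges of
the vertex of height `i`. -/
def circ {n : ℕ} (A : Fin n → SymSeq C) : LevelTree n ⥤ C where
  obj X := unTensor fun v : X.V => (A v.1).obj (Sig.of (X.In v))
  map a := unMap (Hom.v a) (Hom.v_bijective a) fun v => (A v.1).map (Sig.map (Hom.inEquiv a v))
  map_id X := by
    refine Eq.trans ?_ (unMap_id _)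
    exact congrArg (unMap id Function.bijective_id) (funext fun v => (A v.1).map_id _)
  map_comp a b := by
    refine Eq.trans ?_ (unMap_comp _ _ _ _ _ _).symm
    exact congrArg (unMap _ _) (funext fun v =>
      (A v.1).map_comp (Sig.map (Hom.inEquiv a v)) (Sig.map (Hom.inEquiv b (Hom.v a v))))

/-- `A^{⊚ n}`. -/
abbrev circPow (A : SymSeq C) (n : ℕ) : LevelTree n ⥤ C := circ fun _ : Fin n => A

variable (C) in
/-- The counit symmetric sequence: the monoidal unit on one-element sets and the final object on all
other finite sets. -/
def counitSeq [HasTerminal C] : SymSeq C where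
  obj T := if Nat.card T.of = 1 then 𝟙_ C else ⊤_ C
  map {T T'} a := eqToHom (by rw [Nat.card_congr (FintypeCat.equivEquivIso.symm a.iso)])

theorem counitSeq_obj_of [HasTerminal C] {α : Type} [Finite α] (h : Nat.card α = 1) :
    (counitSeq C).obj (Sig.of α) = 𝟙_ C :=
  if_pos h

end Circ

section Subtrees

namespace LevelTree

variable {n m g : ℕ}

/-- For an element `s` of the level `a` of a chain `X`, the chain of the sets of elements lying over
`s` in the levels `ψ 0 ≤ ψ 1 ≤ ⋯ ≤ ψ g`, where `ψ 0 = a`. -/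
def sub (X : LevelTree n) (ψ : Fin (g + 1) → Fin (n + 1)) (hψ : Monotone ψ) {a : Fin (n + 1)}
    (h₀ : ψ 0 = a) (s : X.S a) : LevelTree g where
  S l := {t : X.S (ψ l) // X.f (h₀.ge.trans (hψ (Fin.zero_le l))) t = s}
  finite _ := inferInstance
  f h t := ⟨X.f (hψ h) t.1, by rw [X.f_trans]; exact t.2⟩
  f_refl _ _ := Subtype.ext (X.f_refl _ _)
  f_trans _ _ _ := Subtype.ext (X.f_trans _ _ _)
  root_nonempty := ⟨⟨X.f h₀.le s, by rw [X.f_trans, X.f_refl]⟩⟩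
  root_subsingleton := ⟨fun t t' => Subtype.ext ((X.cast h₀).injective (t.2.trans t'.2.symm))⟩

/-- The isomorphism of subtrees induced by an isomorphism of chains. -/
def subHom {X Y : LevelTree n} (b : X ⟶ Y) (ψ : Fin (g + 1) → Fin (n + 1)) (hψ : Monotone ψ)
    {a : Fin (n + 1)} (h₀ : ψ 0 = a) (s : X.S a) :
    X.sub ψ hψ h₀ s ⟶ Y.sub ψ hψ h₀ (b.e a s) where
  e l := (b.e (ψ l)).subtypeEquiv fun t => by
    have h := b.comm (h₀.ge.trans (hψ (Fin.zero_le l))) t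
    exact (b.e a).injective.eq_iff.symm.trans (by rw [h])
  comm h t := Subtype.ext (b.comm (hψ h) t.1)

end LevelTree

namespace EndMap

variable {m n : ℕ} (φ : EndMap m n)

/-- The number of levels of a chain `X` that become one level of `φ^* X`. -/
def gap (i : Fin m) : ℕ := (φ.toFun i.succ : ℕ) - φ.toFun i.castSucc

theorem add_gap (i : Fin m) :
    (φ.toFun i.castSucc : ℕ) + φ.gap i = φ.toFun i.succ := by
  have : (φ.toFun i.castSucc : ℕ) ≤ φ.toFun i.succ := φ.mono (Fin.castSucc_le_succ i)
  unfold gap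
  omega

/-- The levels between `φ i` and `φ (i+1)`. -/
def seg (i : Fin m) (l : Fin (φ.gap i + 1)) : Fin (n + 1) :=
  ⟨φ.toFun i.castSucc + l, by have := φ.add_gap i; omega⟩

theorem seg_mono (i : Fin m) : Monotone (φ.seg i) := fun l l' h => by
  have : (l : ℕ) ≤ l' := h
  simp only [seg, Fin.mk_le_mk]
  omega

theorem seg_zero (i : Fin m) : φ.seg i 0 = φ.toFun i.castSucc := by
  ext; simp [seg]

theorem seg_last (i : Fin m) : φ.seg i (Fin.last _) = φ.toFun i.succ := by
  ext; simp [seg, φ.add_gap i]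

end EndMap

namespace LevelTree

variable {m n : ℕ} (φ : EndMap m n)

/-- The part of the level tree `X` that is contracted to the vertex `v` of `φ^* X`. -/
abbrev part (X : LevelTree n) (v : ((pull φ).obj X).V) : LevelTree (φ.gap v.1) :=
  X.sub (φ.seg v.1) (φ.seg_mono v.1) (φ.seg_zero v.1) v.2

/-- The incoming edges of `v` in `φ^* X` are the leaves of the part of `X` contracted to `v`. -/
def leafEquiv (X : LevelTree n) (v : ((pull φ).obj X).V) :
    ((pull φ).obj X).In v ≃ (X.part φ v).S (Fin.last _) :=
  (X.cast (φ.seg_last v.1).symm).subtypeEquiv fun t => by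
    have h : X.f ((φ.seg_zero v.1).ge.trans (φ.seg_mono v.1 (Fin.zero_le _)))
        (X.cast (φ.seg_last v.1).symm t) = X.f (φ.mono (Fin.castSucc_le_succ v.1)) t :=
      X.f_trans _ _ _
    rw [h]
    rfl

/-- The vertices of `X` are the vertices of the parts that are contracted by `φ`. -/
def glue (X : LevelTree n) (p : Σ v : ((pull φ).obj X).V, (X.part φ v).V) : X.V :=
  ⟨⟨φ.toFun p.1.1.castSucc + p.2.1, by
    have := φ.add_gap p.1.1
    have := (φ.toFun p.1.1.succ).isLt
    have := p.2.1.isLt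
    omega⟩, p.2.2.1⟩

theorem V_ext {X : LevelTree n} {i j : Fin n} (h : i = j) (t : X.S j.castSucc)
    (t' : X.S i.castSucc) (ht : t' = X.f (by rw [h]) t) : (⟨i, t'⟩ : X.V) = ⟨j, t⟩ := by
  subst h
  rw [ht, X.f_refl]

theorem glue_bijective (X : LevelTree n) : Function.Bijective (X.glue φ) := by
  constructor
  · have key : ∀ i i' : Fin m, i < i' → ∀ (l : Fin (φ.gap i)) (l' : ℕ),
        (φ.toFun i.castSucc : ℕ) + l ≠ φ.toFun i'.castSucc + l' := by
      intro i i' h l l'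
      have h₁ : (φ.toFun i.succ : ℕ) ≤ φ.toFun i'.castSucc := φ.mono h
      have h₂ := φ.add_gap i
      have h₃ := l.isLt
      omega
    rintro ⟨⟨i, s⟩, ⟨l, ⟨t, ht⟩⟩⟩ ⟨⟨i', s'⟩, ⟨l', ⟨t', ht'⟩⟩⟩ h
    obtain ⟨h₁, h₂⟩ := Sigma.mk.inj h
    have h₁ := congrArg Fin.val h₁
    dsimp only at h₁
    obtain rfl : i = i' := by
      rcases lt_trichotomy i i' with h | h | h
      · exact absurd h₁ (key i i' h l l')
      · exact h
      · exact absurd h₁.symm (key i' i h l' l)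
    obtain rfl : l = l' := Fin.ext (by omega)
    obtain rfl : t = t' := eq_of_heq h₂
    obtain rfl : s = s' := Eq.trans (Eq.symm ht) ht'
    rfl
  · rintro ⟨k, t⟩
    obtain ⟨i, h₁, h₂⟩ : ∃ i : Fin m, (φ.toFun i.castSucc : ℕ) ≤ k ∧ (k : ℕ) < φ.toFun i.succ := by
      by_contra hne
      push Not at hne
      have : ∀ j : Fin (m + 1), (φ.toFun j : ℕ) ≤ k := by
        intro j
        induction j using Fin.induction with
        | zero => simp [φ.zero]
        | succ i ih => exact hne i ih
      have := this (Fin.last m)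
      rw [φ.last] at this
      simp at this
      omega
    have h₃ := φ.add_gap i
    have hk : (⟨φ.toFun i.castSucc + (k - φ.toFun i.castSucc), by omega⟩ : Fin n) = k :=
      Fin.ext (by simp; omega)
    exact ⟨⟨⟨i, X.f (show φ.toFun i.castSucc ≤ k.castSucc from h₁) t⟩,
      ⟨⟨k - φ.toFun i.castSucc, by show (k : ℕ) - φ.toFun i.castSucc < φ.gap i; omega⟩, ⟨X.f (by
        show (φ.toFun i.castSucc : ℕ) + (k - φ.toFun i.castSucc) ≤ k; omega) t,
        X.f_trans _ _ _⟩⟩⟩, V_ext hk _ _ rfl⟩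

/-- Incoming edges are not affected by decomposing a tree into parts. -/
def glueIn (X : LevelTree n) (p : Σ v : ((pull φ).obj X).V, (X.part φ v).V) :
    (X.part φ p.1).In p.2 ≃ X.In (X.glue φ p) where
  toFun u := ⟨u.1.1, congrArg Subtype.val u.2⟩
  invFun u := ⟨⟨u.1, by
    exact (X.f_trans _ (φ.seg_mono p.1.1 (Fin.castSucc_le_succ p.2.1)) u.1).symm.trans
      ((congrArg _ u.2).trans p.2.2.2)⟩, Subtype.ext u.2⟩
  left_inv _ := rfl
  right_inv _ := rfl

end LevelTree

end Subtrees

section Cooperads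

variable {C : Type u} [Category.{v} C] [MonoidalCategory C] [SymmetricCategory C] [HasTerminal C]

variable (C) in
/-- A counital symmetric sequence `ε : O ⟶ 𝟙` together with a natural transformation
`Δ : O γ² ⟶ O ⊚ O`, no compatibility being required yet. -/
structure PreCooperad where
  O : SymSeq C
  Δ : gamma 2 ⋙ O ⟶ circPow O 2
  ε : O ⟶ counitSeq C

theorem isEnum_nil_V (X : LevelTree 0) : IsEnum ([] : List X.V) :=
  ⟨List.nodup_nil, fun v => v.1.elim0⟩

theorem isEnum_root (X : LevelTree 1) (s : X.S 0) : IsEnum [(⟨0, s⟩ : X.V)] := by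
  refine ⟨List.nodup_singleton _, ?_⟩
  rintro ⟨i, s'⟩
  have := X.root_subsingleton
  obtain rfl : i = 0 := Subsingleton.elim _ _
  exact List.mem_singleton.2 (congrArg (Sigma.mk 0) (Subsingleton.elim (α := X.S 0) _ _))

/-- In a level tree with one level all leaves are incoming edges of the only vertex. -/
def rootIn (X : LevelTree 1) (s : X.S 0) : X.S (Fin.last 1) ≃ X.In ⟨0, s⟩ :=
  (Equiv.subtypeUnivEquiv fun _ => X.root_subsingleton.elim _ _).symm

/-- The canonical isomorphism from the value of `A` at the leaves of a tree with one level to the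
tensor product with only one factor, `A` at the incoming edges of the only vertex `s`. -/
def unitApp (A : SymSeq C) (X : LevelTree 1) (s : X.S 0) :
    A.obj (Sig.of (X.S (Fin.last 1))) ⟶ (circPow A 1).obj X :=
  A.map (Sig.map (rootIn X s)) ≫ (ρ_ _).inv ≫
    ins (fun v : X.V => A.obj (Sig.of (X.In v))) [⟨0, s⟩] (isEnum_root X s)

theorem unit_aux {P Q R S U W : C} (a : P ⟶ Q) (c : Q ⟶ R) (b : P ⟶ S) (d : S ⟶ R)
    (I : S ⊗ 𝟙_ C ⟶ U) (M : U ⟶ W) (J : R ⊗ 𝟙_ C ⟶ W) (h : a ≫ c = b ≫ d)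
    (h' : I ≫ M = (d ⊗ₘ 𝟙 _) ≫ J) :
    a ≫ (c ≫ (ρ_ R).inv ≫ J) = (b ≫ (ρ_ S).inv ≫ I) ≫ M := by
  simp only [Category.assoc, h', tensorHom_id, ← rightUnitor_inv_naturality_assoc]
  rw [← Category.assoc, h, Category.assoc]

theorem square_aux {P Q R S T U : C} (p : P ⟶ Q) (q : Q ⟶ R) (r : P ⟶ S) (s : S ⟶ R)
    (t : R ⟶ T) (u : S ⟶ U) (w : U ⟶ T) (h : p ≫ q = r ≫ s) (h' : s ≫ t = u ≫ w) :
    p ≫ (q ≫ t) = (r ≫ u) ≫ w := by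
  rw [← Category.assoc, h, Category.assoc, h', Category.assoc]

/-- The canonical isomorphism between a symmetric sequence `A` and `A^{⊚ 1}`. -/
def unitHom (A : SymSeq C) : gamma 1 ⋙ A ⟶ circPow A 1 where
  app X := unitApp A X X.root_nonempty.some
  naturality X Y a := by
    have h : unitApp A Y Y.root_nonempty.some = unitApp A Y (a.e 0 X.root_nonempty.some) := by
      rw [Y.root_subsingleton.elim Y.root_nonempty.some (a.e 0 X.root_nonempty.some)]
    have h₁ := ins_unMap (X := fun v : X.V => A.obj (Sig.of (X.In v)))
      (Y := fun v : Y.V => A.obj (Sig.of (Y.In v))) (Hom.v a) (Hom.v_bijective a)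
      (fun v => A.map (Sig.map (Hom.inEquiv a v))) [⟨0, X.root_nonempty.some⟩] (isEnum_root X _)
    have h₂ : A.map (Sig.map (a.e (Fin.last 1))) ≫
        A.map (Sig.map (rootIn Y (a.e 0 X.root_nonempty.some))) =
        A.map (Sig.map (rootIn X X.root_nonempty.some)) ≫
          A.map (Sig.map (Hom.inEquiv a ⟨0, X.root_nonempty.some⟩)) := by
      rw [← A.map_comp, ← A.map_comp]
      rfl
    exact (congrArg (A.map (Sig.map (a.e (Fin.last 1))) ≫ ·) h).trans
      (unit_aux _ _ _ _ _ _ _ h₂ h₁)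

namespace PreCooperad

variable (P : PreCooperad C)

/-- The counit as a map from the value of `O` on one-element sets to the monoidal unit
`O^{⊚ 0}`. -/
def counitHom : gamma 0 ⋙ P.O ⟶ circPow P.O 0 where
  app X := P.ε.app (Sig.of (X.S (Fin.last 0))) ≫
    eqToHom (counitSeq_obj_of (Nat.card_eq_one_iff_unique.2
      ⟨X.root_subsingleton, X.root_nonempty⟩)) ≫
    ins (fun v : X.V => P.O.obj (Sig.of (X.In v))) [] (isEnum_nil_V X)
  naturality X Y a := by
    have h₁ := ins_unMap (X := fun v : X.V => P.O.obj (Sig.of (X.In v)))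
      (Y := fun v : Y.V => P.O.obj (Sig.of (Y.In v))) (Hom.v a) (Hom.v_bijective a)
      (fun v => P.O.map (Sig.map (Hom.inEquiv a v))) [] (isEnum_nil_V X)
    have h₂ := P.ε.naturality (Sig.map (a.e (Fin.last 0)))
    have h₃ : ((counitSeq C).map (Sig.map (a.e (Fin.last 0))) :
        (counitSeq C).obj (Sig.of _) ⟶ (counitSeq C).obj (Sig.of _)) ≫
        eqToHom (counitSeq_obj_of (Nat.card_eq_one_iff_unique.2
          ⟨Y.root_subsingleton, Y.root_nonempty⟩)) =
        eqToHom (counitSeq_obj_of (Nat.card_eq_one_iff_unique.2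
          ⟨X.root_subsingleton, X.root_nonempty⟩)) :=
      eqToHom_trans ((counitSeq_obj_of (Nat.card_eq_one_iff_unique.2
          ⟨X.root_subsingleton, X.root_nonempty⟩)).trans
        (counitSeq_obj_of (Nat.card_eq_one_iff_unique.2
          ⟨Y.root_subsingleton, Y.root_nonempty⟩)).symm) _
    exact square_aux _ _ _ _ _ _ _ h₂ (square_aux _ _ _ _ _ _ _
      (h₃.trans (Category.comp_id _).symm) h₁.symm)

/-- The operation `O(leaves) → O^{⊚ g}` for trees with at most two levels: the counit for `g = 0`,
the identity for `g = 1` and the cocomposition for `g = 2`. -/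
def localOp : (g : ℕ) → g ≤ 2 → (gamma g ⋙ P.O ⟶ circPow P.O g)
  | 0, _ => P.counitHom
  | 1, _ => unitHom P.O
  | 2, _ => P.Δ
  | _ + 3, h => absurd h (by omega)

/-- For `φ` as below, the natural transformation `O^{⊚ m} φ^* ⟶ O^{⊚ n}` which applies, at each
vertex of `φ^* X`, the counit, the identity or the cocomposition according to whether the vertex
arises by contracting no, one or two levels of `X`. -/
def opAlong {m n : ℕ} (φ : EndMap m n) (hφ : ∀ i, φ.gap i ≤ 2) :
    pull φ ⋙ circPow P.O m ⟶ circPow P.O n where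
  app X :=
    unMap (Y := fun v : ((pull φ).obj X).V => (circPow P.O (φ.gap v.1)).obj (X.part φ v)) id
        Function.bijective_id
        (fun v : ((pull φ).obj X).V => P.O.map (Sig.map (X.leafEquiv φ v)) ≫
          (P.localOp (φ.gap v.1) (hφ v.1)).app (X.part φ v)) ≫
      unSigma (fun (v : ((pull φ).obj X).V) (w : (X.part φ v).V) =>
        P.O.obj (Sig.of ((X.part φ v).In w))) ≫
      unMap (X.glue φ) (X.glue_bijective φ) (fun p => P.O.map (Sig.map (X.glueIn φ p)))
  naturality X Y a := by
    have hD : ∀ v : ((pull φ).obj X).V,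
        P.O.map (Sig.map (Hom.inEquiv ((pull φ).map a) v)) ≫
          (P.O.map (Sig.map (Y.leafEquiv φ (Hom.v ((pull φ).map a) v))) ≫
            (P.localOp (φ.gap v.1) (hφ v.1)).app (Y.part φ (Hom.v ((pull φ).map a) v))) =
        (P.O.map (Sig.map (X.leafEquiv φ v)) ≫
          (P.localOp (φ.gap v.1) (hφ v.1)).app (X.part φ v)) ≫
          (circPow P.O (φ.gap v.1)).map
            (subHom a (φ.seg v.1) (φ.seg_mono v.1) (φ.seg_zero v.1) v.2) := by
      intro v
      have h := (P.localOp (φ.gap v.1) (hφ v.1)).naturality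
        (subHom a (φ.seg v.1) (φ.seg_mono v.1) (φ.seg_zero v.1) v.2)
      refine square_aux _ _ _ _ _ _ _ ?_ h
      refine (P.O.map_comp _ _).symm.trans (Eq.trans ?_ (P.O.map_comp _ _))
      refine congrArg P.O.map ((Sig.map_comp _ _).trans (Eq.trans ?_ (Sig.map_comp (X.leafEquiv φ v)
        ((subHom a (φ.seg v.1) (φ.seg_mono v.1) (φ.seg_zero v.1) v.2).e (Fin.last _))).symm))
      exact congrArg Sig.map (Equiv.ext fun t => Subtype.ext (a.comm _ _).symm)
    have h₁ := unMap_comp (X := fun v : ((pull φ).obj X).V => P.O.obj (Sig.of (((pull φ).obj X).In v)))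
      (Y := fun v : ((pull φ).obj Y).V => P.O.obj (Sig.of (((pull φ).obj Y).In v)))
      (Z := fun v : ((pull φ).obj Y).V => (circPow P.O (φ.gap v.1)).obj (Y.part φ v))
      (Hom.v ((pull φ).map a)) (Hom.v_bijective _) id Function.bijective_id
      (fun v => P.O.map (Sig.map (Hom.inEquiv ((pull φ).map a) v)))
      (fun v => P.O.map (Sig.map (Y.leafEquiv φ v)) ≫
          (P.localOp (φ.gap v.1) (hφ v.1)).app (Y.part φ v))
    have h₂ := unMap_comp (X := fun v : ((pull φ).obj X).V => P.O.obj (Sig.of (((pull φ).obj X).In v)))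
      (Y := fun v : ((pull φ).obj X).V => (circPow P.O (φ.gap v.1)).obj (X.part φ v))
      (Z := fun v : ((pull φ).obj Y).V => (circPow P.O (φ.gap v.1)).obj (Y.part φ v))
      id Function.bijective_id (Hom.v ((pull φ).map a)) (Hom.v_bijective _)
      (fun v => P.O.map (Sig.map (X.leafEquiv φ v)) ≫
          (P.localOp (φ.gap v.1) (hφ v.1)).app (X.part φ v))
      (fun v => (circPow P.O (φ.gap v.1)).map
            (subHom a (φ.seg v.1) (φ.seg_mono v.1) (φ.seg_zero v.1) v.2))
    have h₃ := unSigma_naturality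
      (fun (v : ((pull φ).obj X).V) (w : (X.part φ v).V) => P.O.obj (Sig.of ((X.part φ v).In w)))
      (fun (v : ((pull φ).obj Y).V) (w : (Y.part φ v).V) => P.O.obj (Sig.of ((Y.part φ v).In w)))
      (Hom.v ((pull φ).map a)) (Hom.v_bijective _)
      (fun v => Hom.v (subHom a (φ.seg v.1) (φ.seg_mono v.1) (φ.seg_zero v.1) v.2))
      (fun v => Hom.v_bijective _)
      (fun v w => P.O.map (Sig.map (Hom.inEquiv
        (subHom a (φ.seg v.1) (φ.seg_mono v.1) (φ.seg_zero v.1) v.2) w)))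
    have h₄ := h₁.trans ((congrArg (unMap _ _) (funext hD)).trans h₂.symm)
    refine square_aux _ _ _ _ _ _ _ h₄ (square_aux _ _ _ _ _ _ _ h₃ ?_)
    refine (unMap_comp _ _ _ _ _ _).trans
      (Eq.trans ?_ (unMap_comp _ _ _ (Hom.v_bijective a) _ _).symm)
    refine congrArg (unMap _ _) (funext fun p => ?_)
    exact (P.O.map_comp _ _).symm.trans 
      (P.O.map_comp (Sig.map (X.glueIn φ p)) (Sig.map (Hom.inEquiv a (X.glue φ p))))

end PreCooperad

end Cooperads

namespace EndMap

variable {n : ℕ}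

theorem gap_le {m n : ℕ} (φ : EndMap m n) (k : ℕ)
    (h : ∀ i : Fin m, (φ.toFun i.succ : ℕ) ≤ φ.toFun i.castSucc + k) (i : Fin m) : φ.gap i ≤ k := by
  have := h i
  unfold gap
  omega

/-- The map `{0 < ⋯ < n} → {0 < ⋯ < n + 1}` that leaves out the inner element `k + 1`. Composing with
it is the face functor `∂^{n+1}_{k+1} : Σ_*^{≀ (n+1)} ⥤ Σ_*^{≀ n}`. -/
def face (k : Fin n) : EndMap n (n + 1) where
  toFun := k.succ.castSucc.succAbove
  mono := (Fin.strictMono_succAbove _).monotone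
  zero := Fin.succAbove_ne_zero_zero (by simp [Fin.ext_iff])
  last := Fin.succAbove_ne_last_last (by simp [Fin.ext_iff]; omega)

theorem face_gap (k : Fin n) : ∀ i, (face k).gap i ≤ 2 := by
  refine gap_le _ _ fun i => ?_
  simp only [face, Fin.succAbove, Fin.lt_def]
  split_ifs <;> simp

/-- The map `{0 < ⋯ < n + 1} → {0 < ⋯ < n}` that takes the value `i` twice. Composing with it is the
degeneracy functor `s^n_i : Σ_*^{≀ n} ⥤ Σ_*^{≀ (n+1)}`. -/
def degen (i : Fin (n + 1)) : EndMap (n + 1) n where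
  toFun := i.predAbove
  mono := Fin.predAbove_right_monotone i
  zero := by ext; simp [Fin.predAbove]
  last := by
    have h : i.castSucc < Fin.last (n + 1) := Fin.castSucc_lt_last i
    rw [Fin.predAbove_of_castSucc_lt _ _ h]
    rfl

theorem degen_gap (k : Fin (n + 1)) : ∀ i, (degen k).gap i ≤ 2 := by
  refine gap_le _ _ fun i => ?_
  simp only [degen, Fin.predAbove, Fin.lt_def]
  split_ifs <;> simp <;> omega

end EndMap

section Cooperads

variable {C : Type u} [Category.{v} C] [MonoidalCategory C] [SymmetricCategory C] [HasTerminal C]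

/-- The transformation `Δ̃^{n+1}_{k+1} : O^{⊚ n} ∂^{n+1}_{k+1} ⟶ O^{⊚ (n+1)}` applying the
cocomposition at the vertices of height `k`. -/
def PreCooperad.treeCoface (P : PreCooperad C) {n : ℕ} (k : Fin n) :
    pull (EndMap.face k) ⋙ circPow P.O n ⟶ circPow P.O (n + 1) :=
  P.opAlong (EndMap.face k) (EndMap.face_gap k)

/-- The transformation `ε̃^n_i : O^{⊚ (n+1)} s^n_i ⟶ O^{⊚ n}` applying the counit at the vertices of
height `i`. -/
def PreCooperad.treeCodegen (P : PreCooperad C) {n : ℕ} (i : Fin (n + 1)) :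
    pull (EndMap.degen i) ⋙ circPow P.O (n + 1) ⟶ circPow P.O n :=
  P.opAlong (EndMap.degen i) (EndMap.degen_gap i)

/-- The composite `B γ^n = B γ^m φ^* ⟶ F φ^*` for a transformation `t : B γ^m ⟶ F`. -/
def restrict {m n : ℕ} (φ : EndMap m n) {B : SymSeq C} {F : LevelTree m ⥤ C}
    (t : gamma m ⋙ B ⟶ F) : gamma n ⋙ B ⟶ pull φ ⋙ F :=
  Functor.whiskerRight (gammaPull φ) B ≫ Functor.whiskerLeft (pull φ) t

variable (C) in
/-- Counital cooperads: the cocomposition is coassociative, that is, the composites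
`O γ³ = O γ² ∂³_i ⟶ (O ⊚ O) ∂³_i ⟶ O ⊚ O ⊚ O` agree for `i = 1, 2`, and it respects the counit, that
is, the composites `O = O γ² s¹_i ⟶ (O ⊚ O) s¹_i ⟶ O` are the identity for `i = 0, 1`. -/
structure Cooperad extends PreCooperad C where
  coassoc : restrict (EndMap.face 0) Δ ≫ toPreCooperad.treeCoface (0 : Fin 2) =
    restrict (EndMap.face 1) Δ ≫ toPreCooperad.treeCoface (1 : Fin 2)
  counit_left : restrict (EndMap.degen 0) Δ ≫ toPreCooperad.treeCodegen (0 : Fin 2) = unitHom O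
  counit_right : restrict (EndMap.degen 1) Δ ≫ toPreCooperad.treeCodegen (1 : Fin 2) = unitHom O

end Cooperads

section Kan

/-- Every chain is isomorphic to one whose sets are of the form `{0, …, k - 1}`. -/
theorem essentiallySmall_levelTree (n : ℕ) : EssentiallySmall.{0} (LevelTree n) := by
  refine (essentiallySmall_iff _).2 ⟨?_, inferInstance⟩
  let T : Type := {p : Σ k : Fin (n + 1) → ℕ,
    ∀ i j : Fin (n + 1), i ≤ j → Fin (k j) → Fin (k i) //
      (∀ i h x, p.2 i i h x = x) ∧
      (∀ i j k (h : i ≤ j) (h' : j ≤ k) x, p.2 i j h (p.2 j k h' x) = p.2 i k (h.trans h') x) ∧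
      Nonempty (Fin (p.1 0)) ∧ Subsingleton (Fin (p.1 0))}
  let F : T → LevelTree n := fun p =>
    { S := fun i => Fin (p.1.1 i)
      finite := fun _ => inferInstance
      f := fun {i j} h => p.1.2 i j h
      f_refl := fun h x => p.2.1 _ h x
      f_trans := fun h h' x => p.2.2.1 _ _ _ h h' x
      root_nonempty := p.2.2.2.1
      root_subsingleton := p.2.2.2.2 }
  refine small_of_surjective (f := fun p : T => toSkeleton (F p)) fun x => ?_
  induction x using Quotient.inductionOn with
  | _ X =>
  let e : ∀ i, X.S i ≃ Fin (Nat.card (X.S i)) := fun i => Finite.equivFin _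
  let p : T := ⟨⟨fun i => Nat.card (X.S i), fun i j h x => e i (X.f h ((e j).symm x))⟩,
    fun i h x => by simp [X.f_refl], fun i j k h h' x => by simp [X.f_trans],
    X.root_nonempty.map (e 0), by
      have := X.root_subsingleton
      exact (e 0).symm.subsingleton⟩
  refine ⟨p, Quotient.sound ⟨⟨⟨fun i => (e i).symm, fun h x => ?_⟩, ⟨e, fun h x => ?_⟩, ?_, ?_⟩⟩⟩
  · exact (e _).symm_apply_apply _
  · exact congrArg (fun y => e _ (X.f h y)) ((e _).symm_apply_apply x).symm
  · exact LevelTree.Hom.ext (funext fun i => (e i).symm_trans_self)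
  · exact LevelTree.Hom.ext (funext fun i => (e i).self_trans_symm)

variable {C : Type u} [Category.{v} C] [HasLimitsOfSize.{0, 0} C]

instance {n : ℕ} (F : LevelTree n ⥤ C) : (gamma n).HasRightKanExtension F := by
  have := essentiallySmall_levelTree n
  have (T : Core FintypeCat.{0}) : HasLimitsOfShape (StructuredArrow T (gamma n)) C :=
    hasLimitsOfShape_of_essentiallySmall.{0} _ _
  have : (gamma n).HasPointwiseRightKanExtension F := fun T => inferInstance
  infer_instance

/-- The right Kan extension `R_{γ^n} F` of `F` along `γ^n`. -/
abbrev ran {n : ℕ} (F : LevelTree n ⥤ C) : Core FintypeCat.{0} ⥤ C := (gamma n).rightKanExtension F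

/-- The universal transformation `(R_{γ^n} F) γ^n ⟶ F`. -/
abbrev ranι {n : ℕ} (F : LevelTree n ⥤ C) : gamma n ⋙ ran F ⟶ F :=
  (gamma n).rightKanExtensionCounit F

/-- The map `B ⟶ R_{γ^n} F` corresponding to a transformation `B γ^n ⟶ F`. -/
abbrev ranLift {n : ℕ} {F : LevelTree n ⥤ C} {B : Core FintypeCat.{0} ⥤ C} (t : gamma n ⋙ B ⟶ F) :
    B ⟶ ran F :=
  (ran F).liftOfIsRightKanExtension (ranι F) B t

/-- Functoriality of right Kan extension: `R_{γ^n} t`. -/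
def ranMap {n : ℕ} {F G : LevelTree n ⥤ C} (t : F ⟶ G) : ran F ⟶ ran G :=
  ranLift (ranι F ≫ t)

variable [MonoidalCategory C] [SymmetricCategory C]

/-- The canonical comparison map `R_{γ^m} F ⟶ R_{γ^n} (F φ^*)`, induced by
`(R_{γ^m} F) γ^n = (R_{γ^m} F) γ^m φ^* ⟶ F φ^*`. -/
def ranCompare {m n : ℕ} (φ : EndMap m n) (F : LevelTree m ⥤ C) : ran F ⟶ ran (pull φ ⋙ F) :=
  ranLift (restrict φ (ranι F))

/-- The composition power `O^{∘̂ n} = O ∘̂ ⋯ ∘̂ O`, the right Kan extension of `O^{⊚ n}` along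
`γ^n`. -/
abbrev compPow (A : SymSeq C) (n : ℕ) : SymSeq C := ran (circPow A n)

namespace PreCooperad

variable (P : PreCooperad C)

/-- The coface map `Δ^{n+1}_{k+1} : O^{∘̂ n} ⟶ O^{∘̂ (n+1)}`, where `k + 1 = 1, …, n`. -/
def coface {n : ℕ} (k : Fin n) : compPow P.O n ⟶ compPow P.O (n + 1) :=
  ranCompare (EndMap.face k) (circPow P.O n) ≫ ranMap (P.treeCoface k)

/-- The codegeneracy map `ε^n_i : O^{∘̂ (n+1)} ⟶ O^{∘̂ n}`, where `i = 0, …, n`. -/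
def codegen {n : ℕ} (i : Fin (n + 1)) : compPow P.O (n + 1) ⟶ compPow P.O n :=
  ranCompare (EndMap.degen i) (circPow P.O (n + 1)) ≫ ranMap (P.treeCodegen i)

end PreCooperad

end Kan

/-- Coaugmented cosimplicial objects with two extra codegeneracies, given by cofaces `d` and
codegeneracies `s`. In the usual numbering `X 0` has cosimplicial degree `-1`, so that
`d : X 0 ⟶ X 1` is the coaugmentation, `X (k + 1)` has degree `k`, and among the `k + 3`
codegeneracies `X (k + 2) ⟶ X (k + 1)` the first and the last one are extra. -/
structure IsCoaugmentedCosimplicialWithTwoExtra {D : Type*} [Category D] (X : ℕ → D)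
    (d : ∀ k, Fin (k + 1) → (X k ⟶ X (k + 1))) (s : ∀ k, Fin (k + 2) → (X (k + 1) ⟶ X k)) :
    Prop where
  /-- `d_j d_i = d_i d_{j-1}` for `i < j`. -/
  d_comp_d : ∀ k (i j : Fin (k + 1)), i ≤ j →
    d k i ≫ d (k + 1) j.succ = d k j ≫ d (k + 1) i.castSucc
  /-- `s_i s_j = s_{j-1} s_i` for `i < j`. -/
  s_comp_s : ∀ k (i j : Fin (k + 2)), i ≤ j →
    s (k + 1) j.succ ≫ s k i = s (k + 1) i.castSucc ≫ s k j
  /-- `s_i d_i = 1`. -/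
  d_comp_s_castSucc : ∀ k (i : Fin (k + 1)), d k i ≫ s k i.castSucc = 𝟙 (X k)
  /-- `s_{i+1} d_i = 1`. -/
  d_comp_s_succ : ∀ k (i : Fin (k + 1)), d k i ≫ s k i.succ = 𝟙 (X k)
  /-- `s_j d_i = d_{i-1} s_j` for `j < i`. -/
  d_comp_s_of_lt : ∀ k (i : Fin (k + 1)) (j : Fin (k + 2)), j ≤ i.castSucc →
    d (k + 1) i.succ ≫ s (k + 1) j.castSucc = s k j ≫ d k i
  /-- `s_j d_i = d_i s_{j-1}` for `i + 1 < j`. -/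
  d_comp_s_of_gt : ∀ k (i : Fin (k + 1)) (j : Fin (k + 2)), i.castSucc < j →
    d (k + 1) i.castSucc ≫ s (k + 1) j.succ = s k j ≫ d k i

end WreathCooperad

end

/-!
Cofaces and codegeneracies are instances of one construction: an end point preserving map `φ` with
gaps at most two acts on trees by applying `1`, `Δ` or `ε` to the part of the tree between each two
levels that `φ` keeps. The composite of the operations of `ψ` and `φ` decomposes along the parts
that `ψ.comp φ` contracts, and on such a part it first applies one of `ε`, `1`, `Δ` to the whole
part and then operates on the result. Counitality and coassociativity say precisely that this
two-step operation depends only on the part, so the composite depends only on `ψ.comp φ`, and the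
cosimplicial identities become identities between monotone maps. They pass to the right Kan
extensions by uniqueness, and `O ⟶ O^{∘̂ 1}` is invertible because `γ^1` is an equivalence.
-/

noncomputable section

namespace WreathCooperad

section Concatenation

variable {C : Type u} [Category.{v} C] [MonoidalCategory C]
variable {ι κ : Type} {X : ι → C} {P P' Q Q' R : C} {a : ι} {l k : List ι}

/-- The tensor product of two maps into tensor products along lists, as a map into the tensor
product along the concatenated list. -/
def tensorAppend (f : P ⟶ listTensor X l) (g : Q ⟶ listTensor X k) :
    P ⊗ Q ⟶ listTensor X (l ++ k) :=
  (f ⊗ₘ g) ≫ append X l k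

theorem tensorHom_comp_tensorAppend (u : P' ⟶ P) (w : Q' ⟶ Q) (f : P ⟶ listTensor X l)
    (g : Q ⟶ listTensor X k) :
    (u ⊗ₘ w) ≫ tensorAppend f g = tensorAppend (u ≫ f) (w ≫ g) :=
  tensorHom_comp_tensorHom_assoc _ _ _ _ _

theorem whiskerRight_comp_tensorAppend (u : P' ⟶ P) (f : P ⟶ listTensor X l)
    (g : Q ⟶ listTensor X k) : u ▷ Q ≫ tensorAppend f g = tensorAppend (u ≫ f) g := by
  rw [← tensorHom_id, tensorHom_comp_tensorAppend, Category.id_comp]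

theorem whiskerLeft_comp_tensorAppend (w : Q' ⟶ Q) (f : P ⟶ listTensor X l)
    (g : Q ⟶ listTensor X k) : P ◁ w ≫ tensorAppend f g = tensorAppend f (w ≫ g) := by
  rw [← id_tensorHom, tensorHom_comp_tensorAppend, Category.id_comp]

theorem tensorAppend_nil (g : Q ⟶ listTensor X k) :
    tensorAppend (𝟙 (listTensor X [])) g = (λ_ Q).hom ≫ g := by
  rw [← leftUnitor_naturality, ← id_tensorHom]
  rfl

theorem tensorAppend_cons (u : P ⟶ X a) (f : Q ⟶ listTensor X l) (g : R ⟶ listTensor X k) :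
    tensorAppend (l := a :: l) (u ⊗ₘ f) g = (α_ P Q R).hom ≫ (u ⊗ₘ tensorAppend f g) :=
  (associator_naturality_assoc _ _ _ _).trans
    (congrArg ((α_ P Q R).hom ≫ ·) (tensorHom_comp_whiskerLeft _ _ _))

/-- The canonical map from a factor to the tensor product along the list that it forms. -/
def listTensorSingleton (X : ι → C) (a : ι) : X a ⟶ listTensor X [a] :=
  (ρ_ (X a)).inv

theorem listTensorSingleton_listMap {Y : κ → C} (e : ι → κ) (g : ∀ i, X i ⟶ Y (e i)) (a : ι) :
    listTensorSingleton X a ≫ listMap e g [a] = g a ≫ listTensorSingleton Y (e a) :=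
  (congrArg ((ρ_ (X a)).inv ≫ ·) (tensorHom_id (g a) (𝟙_ C))).trans
    (rightUnitor_inv_naturality _).symm

theorem tensorAppend_singleton (u : P ⟶ X a) (g : Q ⟶ listTensor X k) :
    tensorAppend (u ≫ listTensorSingleton X a) g = u ⊗ₘ g := by
  have unit : u ≫ listTensorSingleton X a = (ρ_ P).inv ≫ (u ⊗ₘ 𝟙 (𝟙_ C)) :=
    (rightUnitor_inv_naturality u).trans (congrArg ((ρ_ P).inv ≫ ·) (tensorHom_id _ _).symm)
  have expand : tensorAppend (l := [a]) (u ⊗ₘ 𝟙 (𝟙_ C)) g =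
      (α_ P (𝟙_ C) Q).hom ≫ P ◁ (λ_ Q).hom ≫ (u ⊗ₘ g) := by
    refine (tensorAppend_cons (l := []) u (𝟙 (𝟙_ C)) g).trans ?_
    rw [whiskerLeft_comp_tensorHom]
    exact congrArg (fun t => (α_ _ _ _).hom ≫ (u ⊗ₘ t)) (tensorAppend_nil g)
  rw [← Category.assoc, triangle] at expand
  refine (congrArg (tensorAppend (l := [a]) · g) unit).trans ?_
  refine (whiskerRight_comp_tensorAppend (l := [a]) _ _ _).symm.trans ?_
  exact (congrArg ((ρ_ P).inv ▷ Q ≫ ·) expand).trans (inv_hom_whiskerRight_assoc (ρ_ P) Q _)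

theorem rightUnitor_inv_comp_tensorAppend_cons (u : P ⟶ X a) (f : Q ⟶ listTensor X l)
    (g : 𝟙_ C ⟶ listTensor X k) :
    (ρ_ (P ⊗ Q)).inv ≫ tensorAppend (l := a :: l) (u ⊗ₘ f) g =
      u ⊗ₘ ((ρ_ Q).inv ≫ tensorAppend f g) := by
  rw [← whiskerLeft_comp_tensorHom, whiskerLeft_rightUnitor_inv, Category.assoc]
  exact congrArg ((ρ_ (P ⊗ Q)).inv ≫ ·) (tensorAppend_cons u f g)

end Concatenation

section EqualityUpToRearrangement

variable {C : Type u} [Category.{v} C] [MonoidalCategory C] [SymmetricCategory C]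
variable {ι κ : Type} {κ' : ι → Type} {X : ι → C} {P Q R S : C} {a : ι} {l l' l'' k k' z : List ι}

/-- Equality, up to a canonical rearrangement of the factors, of two maps into tensor products along
lists. Once both maps are followed by `ins` it becomes an equality, see `RearrEq.comp_ins`, so that
coherence statements can be proved by induction on lists without naming the rearrangements. -/
def RearrEq (f : P ⟶ listTensor X l) (g : P ⟶ listTensor X l') : Prop :=
  ∃ q : Rearr l l', f ≫ q.eval X = g

namespace RearrEq

theorem of_eq {f g : P ⟶ listTensor X l} (h : f = g) : RearrEq f g :=
  ⟨Rearr.refl l, by rw [Rearr.eval_refl, Category.comp_id, h]⟩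

theorem refl (f : P ⟶ listTensor X l) : RearrEq f f := of_eq rfl

theorem symm {f : P ⟶ listTensor X l} {g : P ⟶ listTensor X l'} : RearrEq f g → RearrEq g f := by
  rintro ⟨q, rfl⟩
  exact ⟨q.symm, by rw [Category.assoc, (q.eval_symm X).1, Category.comp_id]⟩

theorem trans {f : P ⟶ listTensor X l} {g : P ⟶ listTensor X l'} {h : P ⟶ listTensor X l''} :
    RearrEq f g → RearrEq g h → RearrEq f h := by
  rintro ⟨q, rfl⟩ ⟨r, rfl⟩
  exact ⟨.trans q r, (Category.assoc _ _ _).symm⟩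

theorem precomp (u : Q ⟶ P) {f : P ⟶ listTensor X l} {g : P ⟶ listTensor X l'} :
    RearrEq f g → RearrEq (u ≫ f) (u ≫ g) := by
  rintro ⟨q, rfl⟩
  exact ⟨q, Category.assoc _ _ _⟩

theorem tensorHom (u : P ⟶ X a) {f : Q ⟶ listTensor X l} {g : Q ⟶ listTensor X l'} :
    RearrEq f g → RearrEq (l := a :: l) (l' := a :: l') (u ⊗ₘ f) (u ⊗ₘ g) := by
  rintro ⟨q, rfl⟩
  exact ⟨.cons a q, tensorHom_comp_whiskerLeft _ _ _⟩

theorem tensorAppend {f : P ⟶ listTensor X l} {f' : P ⟶ listTensor X l'}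
    {g : Q ⟶ listTensor X k} {g' : Q ⟶ listTensor X k'} :
    RearrEq f f' → RearrEq g g' → RearrEq (tensorAppend f g) (tensorAppend f' g') := by
  rintro ⟨q, rfl⟩ ⟨r, rfl⟩
  refine ⟨.trans (q.appendRight k) (r.appendLeft l'), ?_⟩
  dsimp only [WreathCooperad.tensorAppend, Rearr.eval]
  rw [Category.assoc, ← Category.assoc (append _ _ _), ← append_appendRight, Category.assoc,
    ← append_appendLeft, tensorHom_comp_whiskerRight_assoc, tensorHom_comp_whiskerLeft_assoc]

theorem comp_ins [Finite ι] {f : P ⟶ listTensor X l} {g : P ⟶ listTensor X l'} (hl : IsEnum l)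
    (hl' : IsEnum l') : RearrEq f g → f ≫ ins X l hl = g ≫ ins X l' hl' := by
  rintro ⟨q, rfl⟩
  rw [Category.assoc, eval_ins X hl hl']

end RearrEq

theorem tensorAppend_assoc_cons (u : P ⟶ X a) {f : Q ⟶ listTensor X l} {g : R ⟶ listTensor X k}
    {h : S ⟶ listTensor X z} (ih : RearrEq (tensorAppend (tensorAppend f g) h)
      ((α_ Q R S).hom ≫ tensorAppend f (tensorAppend g h))) :
    RearrEq (tensorAppend (tensorAppend (l := a :: l) (u ⊗ₘ f) g) h)
      ((α_ (P ⊗ Q) R S).hom ≫ tensorAppend (l := a :: l) (u ⊗ₘ f) (tensorAppend g h)) := by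
  have expand : tensorAppend (tensorAppend (l := a :: l) (u ⊗ₘ f) g) h =
      ((α_ P Q R).hom ▷ S ≫ (α_ P (Q ⊗ R) S).hom) ≫ (u ⊗ₘ tensorAppend (tensorAppend f g) h) := calc
    _ = tensorAppend (l := a :: (l ++ k)) ((α_ P Q R).hom ≫ (u ⊗ₘ tensorAppend f g)) h :=
      congrArg (tensorAppend (l := a :: (l ++ k)) · h) (tensorAppend_cons u f g)
    _ = (α_ P Q R).hom ▷ S ≫ tensorAppend (l := a :: (l ++ k)) (u ⊗ₘ tensorAppend f g) h :=
      (whiskerRight_comp_tensorAppend _ _ _).symm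
    _ = _ := (congrArg (_ ≫ ·) (tensorAppend_cons _ _ _)).trans (Category.assoc _ _ _).symm
  have collapse : ((α_ P Q R).hom ▷ S ≫ (α_ P (Q ⊗ R) S).hom) ≫
        (u ⊗ₘ ((α_ Q R S).hom ≫ tensorAppend f (tensorAppend g h))) =
      (α_ (P ⊗ Q) R S).hom ≫ tensorAppend (l := a :: l) (u ⊗ₘ f) (tensorAppend g h) := by
    refine Eq.trans ?_ (congrArg ((α_ (P ⊗ Q) R S).hom ≫ ·) (tensorAppend_cons _ _ _)).symm
    rw [← whiskerLeft_comp_tensorHom, Category.assoc, pentagon_assoc]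
    rfl
  exact .trans (.of_eq expand) (((ih.tensorHom u).precomp _).trans (.of_eq collapse))

theorem tensorAppend_assoc (f : P ⟶ listTensor X l) (g : Q ⟶ listTensor X k)
    (h : R ⟶ listTensor X z) :
    RearrEq (tensorAppend (tensorAppend f g) h)
      ((α_ P Q R).hom ≫ tensorAppend f (tensorAppend g h)) := by
  suffices id_case : RearrEq (tensorAppend (tensorAppend (𝟙 (listTensor X l)) g) h)
      ((α_ _ Q R).hom ≫ tensorAppend (𝟙 (listTensor X l)) (tensorAppend g h)) by
    simpa only [associator_naturality_left_assoc, whiskerRight_comp_tensorAppend, Category.comp_id]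
      using id_case.precomp (f ▷ Q ▷ R)
  clear f
  induction l with
  | nil =>
    exact .of_eq <| calc
      _ = tensorAppend ((λ_ Q).hom ≫ g) h := congrArg (tensorAppend · h) (tensorAppend_nil g)
      _ = (λ_ Q).hom ▷ R ≫ tensorAppend g h := (whiskerRight_comp_tensorAppend _ _ _).symm
      _ = (α_ (𝟙_ C) Q R).hom ≫ (λ_ (Q ⊗ R)).hom ≫ tensorAppend g h := by simp
      _ = _ := congrArg ((α_ (𝟙_ C) Q R).hom ≫ ·) (tensorAppend_nil _).symm
  | cons a l ih =>
    have id_cons : 𝟙 (X a) ⊗ₘ 𝟙 (listTensor X l) = 𝟙 (listTensor X (a :: l)) := id_tensorHom_id _ _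
    exact id_cons ▸ tensorAppend_assoc_cons (𝟙 (X a)) ih

theorem tensorAppend_listMap {Y : κ → C} (e : ι → κ) (φ : ∀ i, X i ⟶ Y (e i))
    (f : P ⟶ listTensor X l) (g : Q ⟶ listTensor X k) :
    RearrEq (tensorAppend f g ≫ listMap e φ (l ++ k))
      (tensorAppend (f ≫ listMap e φ l) (g ≫ listMap e φ k)) := by
  rw [← tensorHom_comp_tensorAppend, tensorAppend, Category.assoc]
  refine .precomp _ ⟨Rearr.mapAppend e k l, ?_⟩
  rw [Category.assoc, append_listMap]
  rfl

theorem append_flat (Y : ∀ i, κ' i → C) (m : ∀ i, List (κ' i)) (l k : List ι) :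
    RearrEq (X := fun p : Σ i, κ' i => Y p.1 p.2) (append _ l k ≫ flat Y m (l ++ k))
      (tensorAppend (flat Y m l) (flat Y m k)) := by
  induction l with
  | nil => exact .of_eq (tensorAppend_nil _).symm
  | cons a l ih =>
    let s := listMap (Y := fun p : Σ i, κ' i => Y p.1 p.2) (Sigma.mk a) (fun b => 𝟙 (Y a b)) (m a)
    have split : append (fun i => listTensor (Y i) (m i)) (a :: l) k ≫ flat Y m (a :: l ++ k) =
        (α_ _ _ _).hom ≫ tensorAppend s (append _ l k ≫ flat Y m (l ++ k)) :=
      (Category.assoc _ _ _).trans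
        (congrArg ((α_ _ _ _).hom ≫ ·) (whiskerLeft_comp_tensorAppend _ _ _))
    exact .trans (.of_eq split) <| .trans ((RearrEq.refl s).tensorAppend ih |>.precomp _)
      (tensorAppend_assoc _ _ _).symm

theorem listMap_comp_listMap {μ : Type} {Y : κ → C} {Z : μ → C} (e : ι → κ) (e' : κ → μ)
    (g : ∀ i, X i ⟶ Y (e i)) (g' : ∀ i, Y i ⟶ Z (e' i)) (l : List ι) :
    RearrEq (listMap e g l ≫ listMap e' g' (l.map e))
      (listMap (e' ∘ e) (fun i => g i ≫ g' (e i)) l) :=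
  ⟨Rearr.mapMap e e' l, by rw [Category.assoc, listMap_comp]⟩

theorem listMap_flat {κ'' : κ → Type} (Y : ∀ i, κ'' i → C) (e : ι → κ) (m : ∀ i, List (κ'' i))
    (l : List ι) :
    RearrEq
      (flat (fun i => Y (e i)) (fun i => m (e i)) l ≫
        listMap (Y := fun p : Σ i, κ'' i => Y p.1 p.2)
          (fun p : Σ i, κ'' (e i) => (⟨e p.1, p.2⟩ : Σ j, κ'' j)) (fun _ => 𝟙 _) _)
      (listMap (Y := fun i => listTensor (Y i) (m i)) e
        (fun i => 𝟙 (listTensor (Y (e i)) (m (e i)))) l ≫ flat Y m (l.map e)) :=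
  (flat_reindex Y e m l).imp fun _ hq => (Category.assoc _ _ _).trans hq.symm

theorem tensorAppend_nil_right (f : P ⟶ listTensor X l) :
    RearrEq ((ρ_ P).inv ≫ tensorAppend f (𝟙 (listTensor X []))) f := by
  suffices id_case : RearrEq ((ρ_ _).inv ≫ tensorAppend (𝟙 (listTensor X l)) (𝟙 (listTensor X [])))
      (𝟙 (listTensor X l)) by
    have precomposed := id_case.precomp f
    rw [← Category.assoc, rightUnitor_inv_naturality, Category.assoc] at precomposed
    exact .trans (.of_eq (congrArg ((ρ_ P).inv ≫ ·)
      ((whiskerRight_comp_tensorAppend f _ _).trans (by rw [Category.comp_id])).symm))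
      (Category.comp_id f ▸ precomposed)
  clear f
  induction l with
  | nil =>
    refine .of_eq ((congrArg ((ρ_ (𝟙_ C)).inv ≫ ·) (tensorAppend_nil _)).trans ?_)
    exact (by simp [unitors_equal] : (ρ_ (𝟙_ C)).inv ≫ (λ_ (𝟙_ C)).hom ≫ 𝟙 _ = 𝟙 _)
  | cons a l ih =>
    have id_cons : 𝟙 (X a) ⊗ₘ 𝟙 (listTensor X l) = 𝟙 (listTensor X (a :: l)) := id_tensorHom_id _ _
    exact id_cons ▸ .trans (.of_eq (rightUnitor_inv_comp_tensorAppend_cons _ _ _))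
      (ih.tensorHom (𝟙 (X a)))

theorem flat_singletons (Y : ∀ i, κ' i → C) (s : ∀ i, κ' i) (l : List ι) :
    RearrEq (X := fun p : Σ i, κ' i => Y p.1 p.2)
      (listHom (fun i => listTensorSingleton (Y i) (s i)) l ≫ flat Y (fun i => [s i]) l)
      (listMap (Y := fun p : Σ i, κ' i => Y p.1 p.2) (fun i => ⟨i, s i⟩)
        (fun i => 𝟙 (Y i (s i))) l) := by
  induction l with
  | nil => exact .of_eq (Category.id_comp (𝟙 (𝟙_ C)))
  | cons a l ih =>
    refine .trans (.of_eq ?_) (ih.tensorHom (a := ⟨a, s a⟩) (𝟙 (Y a (s a))))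
    let Z := fun p : Σ i, κ' i => Y p.1 p.2
    refine (tensorHom_comp_tensorAppend _ _ _ _).trans ?_
    refine (congrArg (tensorAppend (X := Z) (l := [⟨a, s a⟩]) · _)
      (listTensorSingleton_listMap (Y := Z) (Sigma.mk a) (fun b => 𝟙 (Y a b)) (s a))).trans ?_
    exact tensorAppend_singleton (X := Z) (a := ⟨a, s a⟩) _ _

/-- Reassociation of an iterated disjoint union. -/
abbrev sigmaReassoc {μ : ∀ i, κ' i → Type} (p : Σ i, Σ j, μ i j) : Σ q : Σ i, κ' i, μ q.1 q.2 :=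
  ⟨⟨p.1, p.2.1⟩, p.2.2⟩

theorem sigmaReassoc_bijective {μ : ∀ i, κ' i → Type} :
    Function.Bijective (sigmaReassoc (μ := μ)) :=
  (Equiv.sigmaAssoc μ).symm.bijective

theorem flat_flat {μ : ∀ i, κ' i → Type} (Y : ∀ i j, μ i j → C) (n : ∀ i j, List (μ i j))
    (m : ∀ i, List (κ' i)) (l : List ι) :
    RearrEq
      (listHom (fun i => flat (Y i) (n i) (m i)) l ≫
        flat (fun i (p : Σ j, μ i j) => Y i p.1 p.2) (fun i => blocks (n i) (m i)) l ≫
        listMap (Y := fun p : Σ q : Σ i, κ' i, μ q.1 q.2 => Y p.1.1 p.1.2 p.2) sigmaReassoc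
          (fun p => 𝟙 (Y p.1 p.2.1 p.2.2)) _)
      (flat (fun i j => listTensor (Y i j) (n i j)) m l ≫
        flat (fun (p : Σ i, κ' i) k => Y p.1 p.2 k) (fun p => n p.1 p.2) (blocks m l)) := by
  induction l with
  | nil => exact .of_eq (congrArg (𝟙 (𝟙_ C) ≫ ·) (Category.id_comp (𝟙 (𝟙_ C))))
  | cons a l ih =>
    let s := listMap (Y := fun p : Σ i, Σ j, μ i j => Y p.1 p.2.1 p.2.2) (Sigma.mk a)
      (fun p : Σ j, μ a j => 𝟙 (Y a p.1 p.2)) (blocks (n a) (m a))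
    let u := listMap (Y := fun p : Σ i, κ' i => listTensor (Y p.1 p.2) (n p.1 p.2)) (Sigma.mk a)
      (fun j => 𝟙 (listTensor (Y a j) (n a j))) (m a)
    let r := fun l' => listMap (Y := fun p : Σ q : Σ i, κ' i, μ q.1 q.2 => Y p.1.1 p.1.2 p.2)
      sigmaReassoc (fun p : Σ i, Σ j, μ i j => 𝟙 (Y p.1 p.2.1 p.2.2)) l'
    let F := flat (fun (p : Σ i, κ' i) k => Y p.1 p.2 k) (fun p => n p.1 p.2)
    have head : RearrEq ((flat (Y a) (n a) (m a) ≫ s) ≫ r _) (u ≫ F _) := by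
      have hs : RearrEq (s ≫ r _) _ := listMap_comp_listMap _ _ _ _ _
      simp only [Category.comp_id] at hs
      rw [Category.assoc]
      exact (hs.precomp _).trans <|
        listMap_flat (fun (p : Σ i, κ' i) k => Y p.1 p.2 k) (Sigma.mk a) (fun p => n p.1 p.2) (m a)
    have left := tensorAppend_listMap sigmaReassoc
      (Y := fun p : Σ q : Σ i, κ' i, μ q.1 q.2 => Y p.1.1 p.1.2 p.2)
      (fun p : Σ i, Σ j, μ i j => 𝟙 (Y p.1 p.2.1 p.2.2)) (flat (Y a) (n a) (m a) ≫ s)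
      (listHom (fun i => flat (Y i) (n i) (m i)) l ≫
        flat (fun i (p : Σ j, μ i j) => Y i p.1 p.2) (fun i => blocks (n i) (m i)) l)
    have right := (append_flat (fun (p : Σ i, κ' i) k => Y p.1 p.2 k) (fun p => n p.1 p.2)
      ((m a).map (Sigma.mk a)) (blocks m l)).precomp
        (u ⊗ₘ flat (fun i j => listTensor (Y i j) (n i j)) m l)
    rw [tensorHom_comp_tensorAppend, ← Category.assoc] at right
    rw [← tensorHom_comp_tensorAppend, Category.assoc] at left
    rw [← Category.assoc] at ih
    exact left.trans ((head.tensorAppend ih).trans right.symm)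

end EqualityUpToRearrangement

section UnorderedTensor

variable {C : Type u} [Category.{v} C] [MonoidalCategory C] [SymmetricCategory C]
variable {ι : Type} {κ' : ι → Type}

theorem unSigma_assoc [Finite ι] {μ : ∀ i, κ' i → Type} [∀ i, Finite (κ' i)]
    [∀ i j, Finite (μ i j)] (Y : ∀ i j, μ i j → C) :
    unMap (Y := fun i => unTensor fun p : Σ j, μ i j => Y i p.1 p.2) id Function.bijective_id
        (fun i => unSigma (Y i)) ≫
      unSigma (fun i (p : Σ j, μ i j) => Y i p.1 p.2) ≫
      unMap (Y := fun p : Σ q : Σ i, κ' i, μ q.1 q.2 => Y p.1.1 p.1.2 p.2) sigmaReassoc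
        sigmaReassoc_bijective (fun p => 𝟙 (Y p.1 p.2.1 p.2.2)) =
    unSigma (fun i j => unTensor (Y i j)) ≫ unSigma (fun (p : Σ i, κ' i) k => Y p.1 p.2 k) := by
  have hm := fun i => isEnum_enum (κ' i)
  have hn := fun i j => isEnum_enum (μ i j)
  have outer := ins_unSigma (fun i (p : Σ j, μ i j) => Y i p.1 p.2) _ (isEnum_enum ι) _
    (fun i => isEnum_blocks (hn i) (hm i))
  have inner := ins_unSigma (fun (p : Σ i, κ' i) k => Y p.1 p.2 k) _
    (isEnum_blocks hm (isEnum_enum ι)) _ (fun p => hn p.1 p.2)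
  simp only [ins_enum, listHom_id, Category.id_comp] at outer inner
  have blockwise : unMap (Y := fun i => unTensor fun p : Σ j, μ i j => Y i p.1 p.2) id
      Function.bijective_id (fun i => unSigma (Y i)) = listHom _ (enum ι) ≫ listHom _ (enum ι) :=
    (unMap_eq_listHom _).trans (listHom_comp
      (fun i => flat (Y i) (fun j => enum (μ i j)) (enum (κ' i)))
      (fun i => ins _ _ (isEnum_blocks (hn i) (hm i))) (enum ι)).symm
  rw [blockwise, unSigma.eq_1 (fun i j => unTensor (Y i j)), Category.assoc, Category.assoc, inner,
    reassoc_of% outer, ins_unMap]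
  simpa only [Category.assoc] using
    (flat_flat Y (fun i j => enum (μ i j)) (fun i => enum (κ' i)) (enum ι)).comp_ins
      ((isEnum_blocks (fun i => isEnum_blocks (hn i) (hm i)) (isEnum_enum ι)).map
        sigmaReassoc_bijective)
      (isEnum_blocks (fun p => hn p.1 p.2) (isEnum_blocks hm (isEnum_enum ι)))

end UnorderedTensor

section Singleton

variable {C : Type u} [Category.{v} C] [MonoidalCategory C] [SymmetricCategory C]
variable {ι κ : Type} {κ' : ι → Type}

/-- The canonical map from the only factor of a one-element unordered tensor product. -/
def insSingleton [Finite ι] (X : ι → C) {s : ι} (hs : IsEnum [s]) : X s ⟶ unTensor X :=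
  listTensorSingleton X s ≫ ins X [s] hs

theorem insSingleton_unMap [Finite ι] [Finite κ] {X : ι → C} {Y : κ → C} (e : ι → κ)
    (he : Function.Bijective e) (g : ∀ i, X i ⟶ Y (e i)) {s : ι} (hs : IsEnum [s]) :
    insSingleton X hs ≫ unMap e he g = g s ≫ insSingleton Y (hs.map he) := by
  rw [insSingleton, Category.assoc, ins_unMap, reassoc_of% listTensorSingleton_listMap]
  rfl

theorem sigma_mk_bijective {s : ι} (hs : IsEnum [s]) :
    Function.Bijective (fun w : κ' s => (⟨s, w⟩ : Σ i, κ' i)) := by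
  refine ⟨sigma_mk_injective, ?_⟩
  rintro ⟨i, w⟩
  obtain rfl := List.mem_singleton.1 (hs.2 i)
  exact ⟨w, rfl⟩

theorem section_bijective {s : ∀ i, κ' i} (hs : ∀ i, IsEnum [s i]) :
    Function.Bijective (fun i => (⟨i, s i⟩ : Σ i, κ' i)) := by
  refine ⟨fun i j h => congrArg Sigma.fst h, ?_⟩
  rintro ⟨i, w⟩
  obtain rfl := List.mem_singleton.1 ((hs i).2 w)
  exact ⟨i, rfl⟩

variable [Finite ι] [∀ i, Finite (κ' i)]

theorem insSingleton_unSigma (Y : ∀ i, κ' i → C) {s : ι} (hs : IsEnum [s]) :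
    insSingleton (fun i => unTensor (Y i)) hs ≫ unSigma Y =
      unMap (Y := fun p : Σ i, κ' i => Y p.1 p.2) (fun w => ⟨s, w⟩) (sigma_mk_bijective hs)
        (fun w => 𝟙 (Y s w)) := by
  have hm := fun i => isEnum_enum (κ' i)
  have outer := ins_unSigma Y [s] hs _ hm
  simp only [ins_enum, listHom_id, Category.id_comp] at outer
  rw [insSingleton, Category.assoc, outer, ← Category.assoc]
  exact (tensorAppend_nil_right (listMap (Y := fun p : Σ i, κ' i => Y p.1 p.2) (Sigma.mk s)
    (fun w => 𝟙 (Y s w)) (enum (κ' s)))).comp_ins (isEnum_blocks hm hs) _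

theorem unMap_insSingleton_unSigma (Y : ∀ i, κ' i → C) {s : ∀ i, κ' i} (hs : ∀ i, IsEnum [s i]) :
    unMap (Y := fun i => unTensor (Y i)) id Function.bijective_id
        (fun i => insSingleton (Y i) (hs i)) ≫ unSigma Y =
      unMap (Y := fun p : Σ i, κ' i => Y p.1 p.2) (fun i => ⟨i, s i⟩) (section_bijective hs)
        (fun i => 𝟙 (Y i (s i))) := by
  have outer := ins_unSigma Y _ (isEnum_enum ι) _ hs
  simp only [ins_enum, Category.id_comp] at outer
  have blockwise : unMap (Y := fun i => unTensor (Y i)) id Function.bijective_id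
      (fun i => insSingleton (Y i) (hs i)) = listHom _ (enum ι) ≫ listHom _ (enum ι) :=
    (unMap_eq_listHom _).trans (listHom_comp (fun i => listTensorSingleton (Y i) (s i))
      (fun i => ins (Y i) [s i] (hs i)) (enum ι)).symm
  rw [blockwise, Category.assoc, outer, ← Category.assoc]
  exact (flat_singletons Y s (enum ι)).comp_ins (isEnum_blocks hs (isEnum_enum ι)) _

end Singleton

section BlockMap

variable {C : Type u} [Category.{v} C] [MonoidalCategory C] [SymmetricCategory C]
variable {ι κ θ : Type} {κ' : ι → Type}

/-- The map of unordered tensor products obtained by mapping each factor `A i` to a tensor product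
`⨂_j Y i j`, and identifying all the factors `Y i j` with those of a second tensor product. -/
def blockMap [Finite ι] [∀ i, Finite (κ' i)] [Finite κ] {A : ι → C} {Y : ∀ i, κ' i → C} {B : κ → C}
    (f : ∀ i, A i ⟶ unTensor (Y i)) (e : (Σ i, κ' i) → κ) (he : Function.Bijective e)
    (h : ∀ p : Σ i, κ' i, Y p.1 p.2 ⟶ B (e p)) : unTensor A ⟶ unTensor B :=
  unMap (Y := fun i => unTensor (Y i)) id Function.bijective_id f ≫ unSigma Y ≫ unMap e he h

theorem unMap_id_comp [Finite ι] [Finite κ] {X Y : ι → C} {Z : κ → C} (e : ι → κ)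
    (he : Function.Bijective e) (f : ∀ i, X i ⟶ Y i) (g : ∀ i, Y i ⟶ Z (e i)) :
    unMap id Function.bijective_id f ≫ unMap e he g = unMap e he (fun i => f i ≫ g i) :=
  unMap_comp _ _ _ _ _ _

theorem unMap_comp_id [Finite ι] [Finite κ] {X : ι → C} {Y Z : κ → C} (e : ι → κ)
    (he : Function.Bijective e) (f : ∀ i, X i ⟶ Y (e i)) (g : ∀ i, Y i ⟶ Z i) :
    unMap e he f ≫ unMap id Function.bijective_id g = unMap e he (fun i => f i ≫ g (e i)) :=
  unMap_comp _ _ _ _ _ _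

variable [Finite ι] [∀ i, Finite (κ' i)] [Finite κ] [Finite θ]

theorem unMap_blockMap {ι₀ : Type} [Finite ι₀] {A₀ : ι₀ → C} {A : ι → C} {Y : ∀ i, κ' i → C}
    {B : κ → C} (c : ι₀ → ι) (hc : Function.Bijective c) (γ : ∀ i, A₀ i ⟶ A (c i))
    (f : ∀ i, A i ⟶ unTensor (Y i)) (e : (Σ i, κ' i) → κ) (he : Function.Bijective e)
    (h : ∀ p : Σ i, κ' i, Y p.1 p.2 ⟶ B (e p)) :
    unMap c hc γ ≫ blockMap f e he h =
      blockMap (Y := fun i => Y (c i)) (B := B) (fun i => γ i ≫ f (c i))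
        (fun p => e ⟨c p.1, p.2⟩)
        (he.comp (bijective_sigma (κ'' := κ') hc fun _ => Function.bijective_id))
        (fun p => h ⟨c p.1, p.2⟩) := by
  have reindex := unSigma_reindex Y c hc
  have split := unMap_id_comp (Y := fun i => unTensor (Y (c i))) (Z := fun i => unTensor (Y i)) c hc
    (fun i => γ i ≫ f (c i)) (fun i => 𝟙 _)
  have merge := unMap_comp (Z := B) (fun p : Σ i, κ' (c i) => (⟨c p.1, p.2⟩ : Σ i, κ' i))
    (bijective_sigma hc fun _ => Function.bijective_id) e he (fun p => 𝟙 (Y (c p.1) p.2)) h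
  simp only [Category.comp_id, Category.id_comp] at split merge
  rw [blockMap, reassoc_of% unMap_comp_id, ← split, Category.assoc, reassoc_of% reindex, merge]
  rfl

theorem blockMap_unMap {κ'' : ι → Type} [∀ i, Finite (κ'' i)] {A : ι → C} {Y : ∀ i, κ' i → C}
    {Y' : ∀ i, κ'' i → C} {B : κ → C} (f : ∀ i, A i ⟶ unTensor (Y i)) (d : ∀ i, κ' i → κ'' i)
    (hd : ∀ i, Function.Bijective (d i)) (k : ∀ i j, Y i j ⟶ Y' i (d i j))
    (e : (Σ i, κ'' i) → κ) (he : Function.Bijective e)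
    (h : ∀ p : Σ i, κ'' i, Y' p.1 p.2 ⟶ B (e p)) :
    blockMap (fun i => f i ≫ unMap (d i) (hd i) (k i)) e he h =
      blockMap (Y := Y) (B := B) f (fun p => e ⟨p.1, d p.1 p.2⟩)
        (he.comp (bijective_sigma (κ'' := κ'') Function.bijective_id hd))
        (fun p => k p.1 p.2 ≫ h ⟨p.1, d p.1 p.2⟩) := by
  have natural := unSigma_map Y Y' d hd k
  have split := unMap_id_comp id Function.bijective_id (Z := fun i => unTensor (Y' i)) f
    (fun i => unMap (d i) (hd i) (k i))
  have merge := unMap_comp (Z := B) (fun p : Σ i, κ' i => (⟨p.1, d p.1 p.2⟩ : Σ i, κ'' i))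
    (bijective_sigma Function.bijective_id hd) e he (fun p => k p.1 p.2) h
  rw [blockMap, ← split, Category.assoc, reassoc_of% natural, merge]
  rfl

theorem blockMap_congr {A : ι → C} {Y : ∀ i, κ' i → C} {B : κ → C}
    {f f' : ∀ i, A i ⟶ unTensor (Y i)} {e e' : (Σ i, κ' i) → κ} (he : Function.Bijective e)
    (he' : Function.Bijective e') {h : ∀ p : Σ i, κ' i, Y p.1 p.2 ⟶ B (e p)}
    {h' : ∀ p : Σ i, κ' i, Y p.1 p.2 ⟶ B (e' p)} (hf : ∀ i, f i = f' i) (hee : ∀ p, e p = e' p)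
    (hh : ∀ p, h p ≫ eqToHom (congrArg B (hee p)) = h' p) :
    blockMap f e he h = blockMap f' e' he' h' := by
  obtain rfl : f = f' := funext hf
  rw [blockMap, blockMap, unMap_congr he he' hee h h' hh]

theorem unSigma_blockMap {μ : ∀ i, κ' i → Type} [∀ i j, Finite (μ i j)] {X : ∀ i, κ' i → C}
    {Y : ∀ i j, μ i j → C} {B : κ → C} (g : ∀ i j, X i j ⟶ unTensor (Y i j))
    (e : (Σ p : Σ i, κ' i, μ p.1 p.2) → κ) (he : Function.Bijective e)
    (h : ∀ p : Σ p : Σ i, κ' i, μ p.1 p.2, Y p.1.1 p.1.2 p.2 ⟶ B (e p)) :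
    unSigma X ≫ blockMap (Y := fun p : Σ i, κ' i => Y p.1 p.2) (fun p => g p.1 p.2) e he h =
      blockMap (Y := fun i (p : Σ j, μ i j) => Y i p.1 p.2)
        (fun i => unMap (Y := fun j => unTensor (Y i j)) id Function.bijective_id (g i) ≫
          unSigma (Y i))
        (fun p => e (sigmaReassoc p)) (he.comp sigmaReassoc_bijective)
        (fun p => h (sigmaReassoc p)) := by
  have natural := unSigma_map X (fun i j => unTensor (Y i j)) (fun _ => id)
    (fun _ => Function.bijective_id) g
  have merge := unMap_comp (Z := B) sigmaReassoc sigmaReassoc_bijective e he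
    (fun p : Σ i, Σ j, μ i j => 𝟙 (Y p.1 p.2.1 p.2.2)) h
  have split := unMap_id_comp id Function.bijective_id
    (Z := fun i => unTensor fun p : Σ j, μ i j => Y i p.1 p.2)
    (fun i => unMap (Y := fun j => unTensor (Y i j)) id Function.bijective_id (g i))
    (fun i => unSigma (Y i))
  simp only [Category.id_comp] at merge
  rw [blockMap, blockMap, ← split, Category.assoc]
  refine (reassoc_of% natural.symm) _ |>.trans ?_
  rw [← reassoc_of% unSigma_assoc Y, merge]
  rfl

theorem blockMap_comp {A : ι → C} {Y : ∀ i, κ' i → C} {B : κ → C}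
    (f : ∀ i, A i ⟶ unTensor (Y i)) (e : (Σ i, κ' i) → κ) (he : Function.Bijective e)
    (h : ∀ p : Σ i, κ' i, Y p.1 p.2 ⟶ B (e p))
    {κ'' : κ → Type} [∀ k, Finite (κ'' k)] {Y' : ∀ k, κ'' k → C} {D : θ → C}
    (f' : ∀ k, B k ⟶ unTensor (Y' k)) (e' : (Σ k, κ'' k) → θ) (he' : Function.Bijective e')
    (h' : ∀ p : Σ k, κ'' k, Y' p.1 p.2 ⟶ D (e' p))
    {ρ : ι → Type} [∀ i, Finite (ρ i)] {Q : ∀ i, ρ i → C}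
    (E : ∀ i, (Σ j : κ' i, κ'' (e ⟨i, j⟩)) → ρ i) (hE : ∀ i, Function.Bijective (E i))
    (H : ∀ i, ∀ p : Σ j : κ' i, κ'' (e ⟨i, j⟩), Y' (e ⟨i, p.1⟩) p.2 ⟶ Q i (E i p))
    (F : (Σ i, ρ i) → θ) (hF : Function.Bijective F) (K : ∀ p : Σ i, ρ i, Q p.1 p.2 ⟶ D (F p))
    (hFE : ∀ i j w, F ⟨i, E i ⟨j, w⟩⟩ = e' ⟨e ⟨i, j⟩, w⟩)
    (hKH : ∀ i j w, H i ⟨j, w⟩ ≫ K ⟨i, E i ⟨j, w⟩⟩ ≫ eqToHom (congrArg D (hFE i j w)) =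
      h' ⟨e ⟨i, j⟩, w⟩) :
    blockMap f e he h ≫ blockMap f' e' he' h' =
      blockMap (fun i => f i ≫ blockMap (A := Y i) (Y := fun j => Y' (e ⟨i, j⟩))
        (fun j => h ⟨i, j⟩ ≫ f' (e ⟨i, j⟩)) (E i) (hE i) (H i)) F hF K := by
  have bijective : Function.Bijective fun p : Σ i, Σ j : κ' i, κ'' (e ⟨i, j⟩) =>
      e' ⟨e ⟨p.1, p.2.1⟩, p.2.2⟩ :=
    (he'.comp (bijective_sigma (κ'' := κ'') he fun _ => Function.bijective_id)).comp
      (sigmaReassoc_bijective (μ := fun i j => κ'' (e ⟨i, j⟩)))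
  have flatten : blockMap f e he h ≫ blockMap f' e' he' h' =
      blockMap (Y := fun i (p : Σ j : κ' i, κ'' (e ⟨i, j⟩)) => Y' (e ⟨i, p.1⟩) p.2)
        (fun i => f i ≫ unMap (Y := fun j => unTensor (Y' (e ⟨i, j⟩))) id Function.bijective_id
          (fun j => h ⟨i, j⟩ ≫ f' (e ⟨i, j⟩)) ≫ unSigma fun j => Y' (e ⟨i, j⟩))
        (fun p => e' ⟨e ⟨p.1, p.2.1⟩, p.2.2⟩) bijective (fun p => h' ⟨e ⟨p.1, p.2.1⟩, p.2.2⟩) := by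
    rw [blockMap, Category.assoc, Category.assoc, unMap_blockMap]
    rw [unSigma_blockMap (Y := fun i (j : κ' i) => Y' (e ⟨i, j⟩))
      (fun i j => h ⟨i, j⟩ ≫ f' (e ⟨i, j⟩)) (fun p => e' ⟨e p.1, p.2⟩)
      (he'.comp (bijective_sigma he fun _ => Function.bijective_id)) (fun p => h' ⟨e p.1, p.2⟩)]
    exact unMap_blockMap (A := fun i => unTensor (Y i)) id _ f _ _ _ _
  have nest := blockMap_unMap (B := D)
    (fun i => f i ≫ unMap (Y := fun j => unTensor (Y' (e ⟨i, j⟩)))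
      id Function.bijective_id (fun j => h ⟨i, j⟩ ≫ f' (e ⟨i, j⟩)) ≫ unSigma _) E hE
    (fun i p => H i p) F hF K
  simp only [Category.assoc] at nest
  refine flatten.trans (.trans (blockMap_congr _ _ (fun i => rfl) (fun p => ?_) fun p => ?_)
    nest.symm)
  · exact (hFE p.1 p.2.1 p.2.2).symm
  · exact ((congrArg (· ≫ _) (hKH p.1 p.2.1 p.2.2).symm).trans (by simp))

theorem insSingleton_blockMap {A : ι → C} {Y : ∀ i, κ' i → C} {B : κ → C}
    (f : ∀ i, A i ⟶ unTensor (Y i)) (e : (Σ i, κ' i) → κ) (he : Function.Bijective e)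
    (h : ∀ p : Σ i, κ' i, Y p.1 p.2 ⟶ B (e p)) {s : ι} (hs : IsEnum [s]) :
    insSingleton A hs ≫ blockMap f e he h =
      f s ≫ unMap (Y := B) (fun w => e ⟨s, w⟩) (he.comp (sigma_mk_bijective hs))
        (fun w => h ⟨s, w⟩) := by
  have merge := unMap_comp (Z := B) (fun w => (⟨s, w⟩ : Σ i, κ' i)) (sigma_mk_bijective hs) e he
    (fun w => 𝟙 (Y s w)) h
  simp only [Category.id_comp] at merge
  rw [blockMap, reassoc_of% insSingleton_unMap (Y := fun i => unTensor (Y i)) id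
    Function.bijective_id f hs]
  exact congrArg (f s ≫ ·) ((reassoc_of% insSingleton_unSigma Y hs) _ |>.trans merge)

theorem blockMap_insSingleton {A : ι → C} {Y : ∀ i, κ' i → C} {B : κ → C} {s : ∀ i, κ' i}
    (hs : ∀ i, IsEnum [s i]) (a : ∀ i, A i ⟶ Y i (s i)) (e : (Σ i, κ' i) → κ)
    (he : Function.Bijective e) (h : ∀ p : Σ i, κ' i, Y p.1 p.2 ⟶ B (e p)) :
    blockMap (fun i => a i ≫ insSingleton (Y i) (hs i)) e he h =
      unMap (Y := B) (fun i => e ⟨i, s i⟩) (he.comp (section_bijective hs))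
        (fun i => a i ≫ h ⟨i, s i⟩) := by
  have split := unMap_id_comp id Function.bijective_id (Z := fun i => unTensor (Y i)) a
    (fun i => insSingleton (Y i) (hs i))
  have merge := unMap_comp (Z := B) (fun i => (⟨i, s i⟩ : Σ i, κ' i)) (section_bijective hs) e he
    (fun i => 𝟙 (Y i (s i))) h
  simp only [Category.id_comp] at merge
  rw [blockMap, ← split, Category.assoc, reassoc_of% unMap_insSingleton_unSigma, merge]
  exact unMap_id_comp _ _ _ _

end BlockMap

open LevelTree

namespace EndMap

variable {l m n : ℕ}

theorem ext {φ ψ : EndMap m n} (h : ∀ i, φ.toFun i = ψ.toFun i) : φ = ψ := by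
  cases φ; cases ψ
  congr
  exact funext h

/-- The identity map of `{0 < ⋯ < n}`. -/
def id (n : ℕ) : EndMap n n := ⟨fun i => i, monotone_id, rfl, rfl⟩

/-- Composition of endpoint-preserving maps, in diagrammatic order. -/
def comp (ψ : EndMap l m) (φ : EndMap m n) : EndMap l n where
  toFun i := φ.toFun (ψ.toFun i)
  mono := φ.mono.comp ψ.mono
  zero := by rw [ψ.zero, φ.zero]
  last := by rw [ψ.last, φ.last]

/-- The identity map between ordinals of propositionally equal lengths, used to compare level trees
whose numbers of levels are equal but not definitionally so. -/
def cast (h : m = n) : EndMap m n where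
  toFun i := Fin.cast (congrArg (· + 1) h) i
  mono _ _ h := h
  zero := rfl
  last := Fin.ext h

/-- The restriction of `φ` to the levels between `ψ i` and `ψ (i + 1)`. -/
def loc (ψ : EndMap l m) (φ : EndMap m n) (i : Fin l) :
    EndMap (ψ.gap i) ((ψ.comp φ).gap i) where
  toFun j := ⟨φ.toFun (ψ.seg i j) - φ.toFun (ψ.toFun i.castSucc), by
    have h : (φ.toFun (ψ.seg i j) : ℕ) ≤ φ.toFun (ψ.toFun i.succ) := by
      rw [← ψ.seg_last]
      exact φ.mono (ψ.seg_mono i (Fin.le_last j))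
    simp only [gap, comp]
    omega⟩
  mono j j' h := by
    have h : (φ.toFun (ψ.seg i j) : ℕ) ≤ φ.toFun (ψ.seg i j') := φ.mono (ψ.seg_mono i h)
    simp only [Fin.mk_le_mk]
    omega
  zero := by simp [ψ.seg_zero]
  last := Fin.ext (by simp only [ψ.seg_last i]; rfl)

variable (ψ : EndMap l m) (φ : EndMap m n) (i : Fin l)

theorem add_loc (j : Fin (ψ.gap i + 1)) :
    (φ.toFun (ψ.toFun i.castSucc) : ℕ) + (ψ.loc φ i).toFun j = φ.toFun (ψ.seg i j) := by
  have h : (φ.toFun (ψ.toFun i.castSucc) : ℕ) ≤ φ.toFun (ψ.seg i j) := by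
    rw [← ψ.seg_zero]
    exact φ.mono (ψ.seg_mono i (Fin.zero_le j))
  simp only [loc]
  omega

theorem seg_loc (j : Fin (ψ.gap i + 1)) :
    φ.toFun (ψ.seg i j) = (ψ.comp φ).seg i ((ψ.loc φ i).toFun j) :=
  Fin.ext (ψ.add_loc φ i j).symm

/-- The `j`-th of the gaps of `φ` that make up the `i`-th gap of `ψ.comp φ`. -/
abbrev pos (j : Fin (ψ.gap i)) : Fin m :=
  ⟨ψ.toFun i.castSucc + j, by have := ψ.add_gap i; omega⟩

theorem gap_loc (j : Fin (ψ.gap i)) : φ.gap (ψ.pos i j) = (ψ.loc φ i).gap j := by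
  have lower : (φ.toFun (ψ.pos i j).castSucc : ℕ) = _ := (ψ.add_loc φ i j.castSucc).symm
  have upper : (φ.toFun (ψ.pos i j).succ : ℕ) = _ := (ψ.add_loc φ i j.succ).symm
  simp only [gap] at lower upper ⊢
  rw [lower, upper]
  omega

theorem gap_loc_le {k : ℕ} {φ : EndMap m n} (hφ : ∀ i, φ.gap i ≤ k) (j : Fin (ψ.gap i)) :
    (ψ.loc φ i).gap j ≤ k :=
  (ψ.gap_loc φ i j).symm.trans_le (hφ _)

theorem seg_pos (j : Fin (ψ.gap i)) (x : Fin (φ.gap (ψ.pos i j) + 1)) :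
    φ.seg (ψ.pos i j) x = (ψ.comp φ).seg i
      ((ψ.loc φ i).seg j ((cast (ψ.gap_loc φ i j)).toFun x)) := by
  have lower : (φ.toFun (ψ.pos i j).castSucc : ℕ) = _ := (ψ.add_loc φ i j.castSucc).symm
  ext
  simp only [seg, cast, Fin.val_cast] at lower ⊢
  rw [lower, add_assoc]
  rfl

theorem gap_one {g : ℕ} (τ : EndMap 1 g) : τ.gap 0 = g := by
  have lower : τ.toFun 0 = 0 := τ.zero
  have upper : τ.toFun 1 = Fin.last g := τ.last
  simp [gap, lower, upper]

theorem gap_id (i : Fin n) : (EndMap.id n).gap i = 1 := by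
  simp [gap, EndMap.id]

end EndMap

namespace LevelTree

variable {l m n g g' : ℕ}

/-- Fibres of the structure maps of a chain at equal pairs of levels. -/
def fiberCast (X : LevelTree n) {a b c d : Fin (n + 1)} (hab : a = b) (hcd : c = d) (hca : c ≤ a)
    (hdb : d ≤ b) {s : X.S c} {s' : X.S d} (hs : X.cast hcd s = s') :
    {t : X.S a // X.f hca t = s} ≃ {t : X.S b // X.f hdb t = s'} :=
  (X.cast hab).subtypeEquiv fun t => by
    subst hab hcd hs
    simp only [cast, Equiv.coe_fn_mk, X.f_refl]

/-- The elements over `w` are the elements over the image `s` of `w` that lie over `w`. -/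
def fiberFiberEquiv (X : LevelTree n) {a b c : Fin (n + 1)} (hab : a ≤ b) (hbc : b ≤ c)
    {w : X.S b} {s : X.S a} (hw : X.f hab w = s)
    (hs : ∀ t : {t : X.S c // X.f (hab.trans hbc) t = s}, X.f hab (X.f hbc t.1) = s) :
    {t : X.S c // X.f hbc t = w} ≃ {t : {t : X.S c // X.f (hab.trans hbc) t = s} //
      (⟨X.f hbc t.1, hs t⟩ : {y : X.S b // X.f hab y = s}) = ⟨w, hw⟩} where
  toFun t := ⟨⟨t.1, by rw [← X.f_trans hab hbc, t.2, hw]⟩, Subtype.ext t.2⟩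
  invFun t := ⟨t.1.1, congrArg Subtype.val t.2⟩

/-- The bijection between the incoming edges of two equal vertices. -/
def inCast (X : LevelTree n) {v v' : X.V} (h : v = v') : X.In v ≃ X.In v' :=
  Equiv.cast (congrArg X.In h)

theorem inCast_val (X : LevelTree n) {v v' : X.V} (h : v = v') (t : X.In v) :
    (X.inCast h t).1 = X.f (by rw [h]) t.1 := by
  subst h
  exact (X.f_refl _ _).symm

theorem map_inCast {C : Type u} [Category.{v} C] (A : SymSeq C) (X : LevelTree n) {v v' : X.V}
    (h : v = v') {α : Type} [Finite α] (e : α ≃ X.In v) :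
    A.map (Sig.map e) ≫ eqToHom (congrArg (fun v => A.obj (Sig.of (X.In v))) h) =
      A.map (Sig.map (e.trans (X.inCast h))) := by
  subst h
  exact Category.comp_id _

variable (ψ : EndMap l m) (φ : EndMap m n) (X : LevelTree n)

/-- A part of `φ^* X` contracted by `ψ` is a contraction of the corresponding part of `X`. -/
def partHom (v : ((pull ψ).obj ((pull φ).obj X)).V) :
    ((pull φ).obj X).part ψ v ⟶ (pull (ψ.loc φ v.1)).obj (X.part (ψ.comp φ) v) where
  e j := X.fiberCast (ψ.seg_loc φ v.1 j) rfl _ _ (X.f_refl _ v.2)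
  comm _ _ := Subtype.ext ((X.f_trans _ _ _).trans (X.f_trans _ _ _).symm)

/-- A part of `X` contracted by `φ` is a part of a part contracted by `ψ.comp φ`. -/
def partPartHom (v : ((pull ψ).obj ((pull φ).obj X)).V) (w : (((pull φ).obj X).part ψ v).V) :
    X.part φ (((pull φ).obj X).glue ψ ⟨v, w⟩) ⟶
      (pull (EndMap.cast (ψ.gap_loc φ v.1 w.1))).obj
        ((X.part (ψ.comp φ) v).part (ψ.loc φ v.1) (Hom.v (partHom ψ φ X v) w)) where
  e x := (X.fiberCast (ψ.seg_pos φ v.1 w.1 x) (ψ.seg_loc φ v.1 w.1.castSucc)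
    ((φ.seg_zero (ψ.pos v.1 w.1)).ge.trans (φ.seg_mono _ (Fin.zero_le x))) _ rfl).trans
      (X.fiberFiberEquiv _ _ _ _)
  comm _ _ := Subtype.ext (Subtype.ext ((X.f_trans _ _ _).trans (X.f_trans _ _ _).symm))

/-- A tree is its only part when all its levels are contracted. -/
def partOneHom (τ : EndMap 1 g) (X : LevelTree g) (s : ((pull τ).obj X).S 0) :
    X.part τ ⟨0, s⟩ ⟶ (pull (EndMap.cast τ.gap_one)).obj X where
  e x := (Equiv.subtypeUnivEquiv fun _ => ((pull τ).obj X).root_subsingleton.elim _ _).trans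
    (X.cast (Fin.ext (by simp [EndMap.seg, EndMap.cast, τ.zero])))
  comm _ _ := (X.f_trans _ _ _).trans (X.f_trans _ _ _).symm

section Cast

variable (h : g = g') {X : LevelTree g} {Y : LevelTree g'} (c : X ⟶ (pull (EndMap.cast h)).obj Y)

/-- The map of vertices induced by an isomorphism of chains of propositionally equal lengths. -/
abbrev castV (v : X.V) : Y.V := ⟨Fin.cast h v.1, c.e v.1.castSucc v.2⟩

theorem castV_bijective : Function.Bijective (castV h c) := by
  subst h
  exact Hom.v_bijective (Y := Y) c

/-- The bijection of incoming edges induced by an isomorphism of chains of propositionally equal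
lengths. -/
def castIn (v : X.V) : X.In v ≃ Y.In (castV h c v) :=
  Hom.inEquiv c v

/-- The bijection of leaves induced by an isomorphism of chains of propositionally equal lengths. -/
def castLeaf : X.S (Fin.last g) ≃ Y.S (Fin.last g') :=
  (c.e (Fin.last g)).trans (Y.cast (EndMap.cast h).last)

end Cast

/-- The vertices of the parts contracted by `φ`, as vertices of the parts contracted by
`ψ.comp φ`. -/
def glueParts (v : ((pull ψ).obj ((pull φ).obj X)).V)
    (p : Σ w : (((pull φ).obj X).part ψ v).V, (X.part φ (((pull φ).obj X).glue ψ ⟨v, w⟩)).V) :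
    (X.part (ψ.comp φ) v).V :=
  (X.part (ψ.comp φ) v).glue (ψ.loc φ v.1)
    ⟨Hom.v (partHom ψ φ X v) p.1, castV (ψ.gap_loc φ v.1 p.1.1) (partPartHom ψ φ X v p.1) p.2⟩

theorem glueParts_bijective (v : ((pull ψ).obj ((pull φ).obj X)).V) :
    Function.Bijective (glueParts ψ φ X v) :=
  ((X.part (ψ.comp φ) v).glue_bijective (ψ.loc φ v.1)).comp
    (bijective_sigma (κ'' := fun w => ((X.part (ψ.comp φ) v).part (ψ.loc φ v.1) w).V)
      (f := fun w => castV (ψ.gap_loc φ v.1 w.1) (partPartHom ψ φ X v w))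
      (Hom.v_bijective (partHom ψ φ X v))
      fun w => castV_bijective (ψ.gap_loc φ v.1 w.1) (partPartHom ψ φ X v w))

theorem glue_glueParts (v : ((pull ψ).obj ((pull φ).obj X)).V)
    (w : (((pull φ).obj X).part ψ v).V) (x : (X.part φ (((pull φ).obj X).glue ψ ⟨v, w⟩)).V) :
    X.glue (ψ.comp φ) ⟨v, glueParts ψ φ X v ⟨w, x⟩⟩ =
      X.glue φ ⟨((pull φ).obj X).glue ψ ⟨v, w⟩, x⟩ := by
  refine V_ext (Fin.ext ?_) _ _ rfl
  have lower := ψ.add_loc φ v.1 w.1.castSucc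
  change (φ.toFun (ψ.toFun v.1.castSucc) : ℕ) + ((ψ.loc φ v.1).toFun w.1.castSucc + x.1) =
    φ.toFun (ψ.seg v.1 w.1.castSucc) + x.1
  omega

/-- The bijections of incoming edges accompanying `glueParts`. -/
def glueInParts (v : ((pull ψ).obj ((pull φ).obj X)).V)
    (p : Σ w : (((pull φ).obj X).part ψ v).V, (X.part φ (((pull φ).obj X).glue ψ ⟨v, w⟩)).V) :
    (X.part φ (((pull φ).obj X).glue ψ ⟨v, p.1⟩)).In p.2 ≃
      (X.part (ψ.comp φ) v).In (glueParts ψ φ X v p) :=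
  (castIn (ψ.gap_loc φ v.1 p.1.1) (partPartHom ψ φ X v p.1) p.2).trans
    ((X.part (ψ.comp φ) v).glueIn (ψ.loc φ v.1) ⟨Hom.v (partHom ψ φ X v) p.1,
      castV (ψ.gap_loc φ v.1 p.1.1) (partPartHom ψ φ X v p.1) p.2⟩)

end LevelTree

section GlueMap

variable {C : Type u} [Category.{v} C]

theorem map_comp_map_eq {α β γ δ : Type} [Finite α] [Finite β] [Finite γ] [Finite δ] (A : SymSeq C)
    {a : α ≃ β} {b : β ≃ δ} {c : α ≃ γ} {d : γ ≃ δ} (h : ∀ x, b (a x) = d (c x)) :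
    A.map (Sig.map a) ≫ A.map (Sig.map b) = A.map (Sig.map c) ≫ A.map (Sig.map d) := by
  rw [← A.map_comp, ← A.map_comp, Sig.map_comp, Sig.map_comp]
  exact congrArg (fun t => A.map (Sig.map t)) (Equiv.ext h)

variable [MonoidalCategory C] [SymmetricCategory C] {l m n : ℕ} (A : SymSeq C)

/-- The map `A^{⊚ m}(φ^* X) ⟶ A^{⊚ n}(X)` obtained from maps `t v`, one for each of the parts of `X`
that `φ` contracts to a vertex `v`. -/
def glueMap (φ : EndMap m n) (X : LevelTree n)
    (t : ∀ v : ((pull φ).obj X).V, A.obj (Sig.of ((X.part φ v).S (Fin.last _))) ⟶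
      (circPow A (φ.gap v.1)).obj (X.part φ v)) :
    (circPow A m).obj ((pull φ).obj X) ⟶ (circPow A n).obj X :=
  blockMap (B := fun v : X.V => A.obj (Sig.of (X.In v)))
    (Y := fun (v : ((pull φ).obj X).V) (w : (X.part φ v).V) => A.obj (Sig.of ((X.part φ v).In w)))
    (fun v => A.map (Sig.map (X.leafEquiv φ v)) ≫ t v)
    (X.glue φ) (X.glue_bijective φ) (fun p => A.map (Sig.map (X.glueIn φ p)))

/-- The map on the part of `X` contracted by `ψ.comp φ` to `v` which is obtained from maps `t w`,
one for each of the smaller parts that `φ` contracts. -/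
def gluePartMap (ψ : EndMap l m) (φ : EndMap m n) (X : LevelTree n)
    (t : ∀ w : ((pull φ).obj X).V, A.obj (Sig.of ((X.part φ w).S (Fin.last _))) ⟶
      (circPow A (φ.gap w.1)).obj (X.part φ w)) (v : ((pull ψ).obj ((pull φ).obj X)).V) :
    (circPow A (ψ.gap v.1)).obj (((pull φ).obj X).part ψ v) ⟶
      (circPow A ((ψ.comp φ).gap v.1)).obj (X.part (ψ.comp φ) v) :=
  blockMap (A := fun w => A.obj (Sig.of ((((pull φ).obj X).part ψ v).In w)))
    (B := fun w : (X.part (ψ.comp φ) v).V => A.obj (Sig.of ((X.part (ψ.comp φ) v).In w)))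
    (Y := fun w (x : (X.part φ (((pull φ).obj X).glue ψ ⟨v, w⟩)).V) =>
      A.obj (Sig.of ((X.part φ (((pull φ).obj X).glue ψ ⟨v, w⟩)).In x)))
    (fun w => A.map (Sig.map (((pull φ).obj X).glueIn ψ ⟨v, w⟩)) ≫
      A.map (Sig.map (X.leafEquiv φ (((pull φ).obj X).glue ψ ⟨v, w⟩))) ≫ t _)
    (glueParts ψ φ X v) (glueParts_bijective ψ φ X v)
    (fun p => A.map (Sig.map (glueInParts ψ φ X v p)))

theorem glueMap_comp_glueMap (ψ : EndMap l m) (φ : EndMap m n) (X : LevelTree n)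
    (t : ∀ v : ((pull ψ).obj ((pull φ).obj X)).V,
      A.obj (Sig.of ((((pull φ).obj X).part ψ v).S (Fin.last _))) ⟶
        (circPow A (ψ.gap v.1)).obj (((pull φ).obj X).part ψ v))
    (t' : ∀ w : ((pull φ).obj X).V, A.obj (Sig.of ((X.part φ w).S (Fin.last _))) ⟶
      (circPow A (φ.gap w.1)).obj (X.part φ w))
    (u : ∀ v : ((pull (ψ.comp φ)).obj X).V,
      A.obj (Sig.of ((X.part (ψ.comp φ) v).S (Fin.last _))) ⟶
        (circPow A ((ψ.comp φ).gap v.1)).obj (X.part (ψ.comp φ) v))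
    (hu : ∀ v, (A.map (Sig.map (((pull φ).obj X).leafEquiv ψ v)) ≫ t v) ≫
      gluePartMap A ψ φ X t' v = A.map (Sig.map (X.leafEquiv (ψ.comp φ) v)) ≫ u v) :
    glueMap A ψ ((pull φ).obj X) t ≫ glueMap A φ X t' = glueMap A (ψ.comp φ) X u := by
  refine (blockMap_comp (D := fun v : X.V => A.obj (Sig.of (X.In v)))
    (B := fun w : ((pull φ).obj X).V => A.obj (Sig.of (In _ w)))
    (Y := fun v (w : (((pull φ).obj X).part ψ v).V) => A.obj (Sig.of (In _ w)))
    (Y' := fun w (x : (X.part φ w).V) => A.obj (Sig.of (In _ x)))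
    (Q := fun v (w : (X.part (ψ.comp φ) v).V) => A.obj (Sig.of (In _ w)))
    (fun v => A.map (Sig.map (((pull φ).obj X).leafEquiv ψ v)) ≫ t v) (((pull φ).obj X).glue ψ)
    (((pull φ).obj X).glue_bijective ψ) (fun p => A.map (Sig.map (((pull φ).obj X).glueIn ψ p)))
    (fun w => A.map (Sig.map (X.leafEquiv φ w)) ≫ t' w) (X.glue φ) (X.glue_bijective φ)
    (fun p => A.map (Sig.map (X.glueIn φ p)))
    (glueParts ψ φ X) (glueParts_bijective ψ φ X)
    (fun v p => A.map (Sig.map (glueInParts ψ φ X v p))) (X.glue (ψ.comp φ))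
    (X.glue_bijective (ψ.comp φ)) (fun p => A.map (Sig.map (X.glueIn (ψ.comp φ) p)))
    (glue_glueParts ψ φ X) ?_).trans
    (blockMap_congr _ _ hu (fun _ => rfl) fun _ => Category.comp_id _)
  intro v w x
  refine (congrArg (A.map (Sig.map (glueInParts ψ φ X v ⟨w, x⟩)) ≫ ·)
    (map_inCast A X (glue_glueParts ψ φ X v w x) (X.glueIn (ψ.comp φ)
      ⟨v, glueParts ψ φ X v ⟨w, x⟩⟩))).trans ?_
  refine (A.map_comp _ _).symm.trans (congrArg A.map ((Sig.map_comp _ _).trans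
    (congrArg Sig.map (Equiv.ext fun t => Subtype.ext ?_))))
  exact (X.inCast_val (glue_glueParts ψ φ X v w x) _).trans ((X.f_trans _ _ _).trans (X.f_refl _ _))

end GlueMap

namespace PreCooperad

variable {C : Type u} [Category.{v} C] [MonoidalCategory C] [SymmetricCategory C] [HasTerminal C]
variable (P : PreCooperad C) {l m n : ℕ}

theorem localOp_cast {g g' : ℕ} (h : g = g') (hg : g ≤ 2) (hg' : g' ≤ 2) {X : LevelTree g}
    {Y : LevelTree g'} (c : X ⟶ (pull (EndMap.cast h)).obj Y) :
    P.O.map (Sig.map (castLeaf h c)) ≫ (P.localOp g' hg').app Y =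
      (P.localOp g hg).app X ≫ unMap (Y := fun v : Y.V => P.O.obj (Sig.of (Y.In v)))
        (castV h c) (castV_bijective h c) (fun v => P.O.map (Sig.map (castIn h c v))) := by
  subst h
  have leaves : castLeaf rfl c = c.e (Fin.last g) := Equiv.ext fun t => Y.f_refl _ _
  rw [leaves]
  exact (P.localOp g hg).naturality (Y := Y) c

/-- The operation `O(leaves) ⟶ O^{⊚ n}` on trees with `n` levels which first decomposes along the
levels in the image of `φ` and then along the levels skipped by `φ`. -/
def twoStepOp (φ : EndMap m n) (hm : m ≤ 2) (hφ : ∀ i, φ.gap i ≤ 2) :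
    gamma n ⋙ P.O ⟶ circPow P.O n :=
  restrict φ (P.localOp m hm) ≫ P.opAlong φ hφ

variable (ψ : EndMap l m) (φ : EndMap m n) (hψ : ∀ i, ψ.gap i ≤ 2) (hφ : ∀ i, φ.gap i ≤ 2)
variable (X : LevelTree n) (v : ((pull ψ).obj ((pull φ).obj X)).V)

theorem localOp_partPart (w : (((pull φ).obj X).part ψ v).V) :
    P.O.map (Sig.map (Hom.inEquiv (partHom ψ φ X v) w)) ≫
      P.O.map (Sig.map ((X.part (ψ.comp φ) v).leafEquiv (ψ.loc φ v.1)
        (Hom.v (partHom ψ φ X v) w))) ≫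
      (P.localOp _ (ψ.gap_loc_le v.1 hφ w.1)).app ((X.part (ψ.comp φ) v).part (ψ.loc φ v.1)
        (Hom.v (partHom ψ φ X v) w)) =
    (P.O.map (Sig.map (((pull φ).obj X).glueIn ψ ⟨v, w⟩)) ≫
      P.O.map (Sig.map (X.leafEquiv φ (((pull φ).obj X).glue ψ ⟨v, w⟩))) ≫
      (P.localOp _ (hφ _)).app (X.part φ (((pull φ).obj X).glue ψ ⟨v, w⟩))) ≫
      unMap (Y := fun y : ((X.part (ψ.comp φ) v).part (ψ.loc φ v.1)
        (Hom.v (partHom ψ φ X v) w)).V => P.O.obj (Sig.of (In _ y)))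
        (castV (ψ.gap_loc φ v.1 w.1) (partPartHom ψ φ X v w)) (castV_bijective _ _)
        (fun x => P.O.map (Sig.map (castIn (ψ.gap_loc φ v.1 w.1) (partPartHom ψ φ X v w) x))) := by
  have natural := P.localOp_cast (ψ.gap_loc φ v.1 w.1) (hφ _) (ψ.gap_loc_le v.1 hφ w.1)
    (partPartHom ψ φ X v w)
  have edges := map_comp_map_eq P.O (a := Hom.inEquiv (partHom ψ φ X v) w)
    (b := (X.part (ψ.comp φ) v).leafEquiv (ψ.loc φ v.1) (Hom.v (partHom ψ φ X v) w))
    (c := (((pull φ).obj X).glueIn ψ ⟨v, w⟩).trans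
      (X.leafEquiv φ (((pull φ).obj X).glue ψ ⟨v, w⟩)))
    (d := castLeaf (ψ.gap_loc φ v.1 w.1) (partPartHom ψ φ X v w))
    (fun t => Subtype.ext (Subtype.ext ((X.f_trans _ _ _).trans
      ((X.f_trans _ _ _).trans (X.f_trans _ _ _)).symm)))
  have split := P.O.map_comp (Sig.map (((pull φ).obj X).glueIn ψ ⟨v, w⟩))
    (Sig.map (X.leafEquiv φ (((pull φ).obj X).glue ψ ⟨v, w⟩)))
  refine (square_aux _ _ _ _ _ _ _ edges natural).trans ?_
  exact congrArg (· ≫ _) ((congrArg (· ≫ _) split).trans (Category.assoc _ _ _))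

theorem opAlong_partHom :
    (circPow P.O (ψ.gap v.1)).map (partHom ψ φ X v) ≫
        (P.opAlong (ψ.loc φ v.1) (ψ.gap_loc_le v.1 hφ)).app (X.part (ψ.comp φ) v) =
      gluePartMap P.O ψ φ X (fun w => (P.localOp _ (hφ w.1)).app (X.part φ w)) v := by
  have pulled := unMap_blockMap
    (B := fun w : (X.part (ψ.comp φ) v).V => P.O.obj (Sig.of (In _ w)))
    (Y := fun w (x : ((X.part (ψ.comp φ) v).part (ψ.loc φ v.1) w).V) =>
      P.O.obj (Sig.of (In _ x)))
    (Hom.v (partHom ψ φ X v)) (Hom.v_bijective _)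
    (fun w => P.O.map (Sig.map (Hom.inEquiv (partHom ψ φ X v) w)))
    (fun w => P.O.map (Sig.map ((X.part (ψ.comp φ) v).leafEquiv (ψ.loc φ v.1) w)) ≫
      (P.localOp _ (ψ.gap_loc_le v.1 hφ w.1)).app ((X.part (ψ.comp φ) v).part (ψ.loc φ v.1) w))
    ((X.part (ψ.comp φ) v).glue (ψ.loc φ v.1)) ((X.part (ψ.comp φ) v).glue_bijective _)
    (fun p => P.O.map (Sig.map ((X.part (ψ.comp φ) v).glueIn (ψ.loc φ v.1) p)))
  have bijective := ((X.part (ψ.comp φ) v).glue_bijective (ψ.loc φ v.1)).comp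
    (bijective_sigma (κ'' := fun w => ((X.part (ψ.comp φ) v).part (ψ.loc φ v.1) w).V)
      (Hom.v_bijective (partHom ψ φ X v)) fun _ => Function.bijective_id)
  refine pulled.trans ((blockMap_congr _ bijective (P.localOp_partPart ψ φ hφ X v) (fun _ => rfl)
    (fun _ => Category.comp_id _)).trans ((blockMap_unMap _ _ _ _ _ bijective _).trans ?_))
  refine blockMap_congr _ _ (fun _ => rfl) (fun _ => rfl) fun p => ?_
  exact (Category.comp_id _).trans (P.O.map_comp _ _).symm

theorem opAlong_comp_app :
    (P.opAlong ψ hψ).app ((pull φ).obj X) ≫ (P.opAlong φ hφ).app X =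
      glueMap P.O (ψ.comp φ) X fun v => (P.twoStepOp (ψ.loc φ v.1) (hψ v.1)
        (ψ.gap_loc_le v.1 hφ)).app (X.part (ψ.comp φ) v) := by
  refine glueMap_comp_glueMap P.O ψ φ X _ _ _ fun v => ?_
  have natural := (P.localOp _ (hψ v.1)).naturality (partHom ψ φ X v)
  have leaves := map_comp_map_eq P.O (a := ((pull φ).obj X).leafEquiv ψ v)
    (b := (partHom ψ φ X v).e (Fin.last _))
    (c := X.leafEquiv (ψ.comp φ) v) (d := (X.part (ψ.comp φ) v).cast (ψ.loc φ v.1).last.symm)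
    (fun t => Subtype.ext ((X.f_trans _ _ _).trans (X.f_trans _ _ _).symm))
  have split := square_aux _ _ _ _ _ _ _ leaves.symm natural
  refine (congrArg (_ ≫ ·) (P.opAlong_partHom ψ φ hφ X v).symm).trans
    ((Category.assoc _ _ _).symm.trans ((congrArg (· ≫ _) split.symm).trans ?_))
  exact Category.assoc _ _ _

end PreCooperad

namespace EndMap

variable {m n : ℕ}

/-- The only endpoint-preserving map from `{0 < 1}`. -/
def ends (g : ℕ) : EndMap 1 g where
  toFun := ![0, Fin.last g]
  mono := Fin.monotone_iff_le_succ.2 fun i => (Fin.le_last _).trans_eq (by simp)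
  zero := rfl
  last := rfl

theorem ext_two {g : ℕ} {φ ψ : EndMap 2 g} (h : φ.toFun 1 = ψ.toFun 1) : φ = ψ :=
  ext fun i => by
    fin_cases i
    exacts [φ.zero.trans ψ.zero.symm, h, φ.last.trans ψ.last.symm]

theorem le_of_gap_le {k : ℕ} {φ : EndMap m n} (hm : m ≤ 1) (hφ : ∀ i, φ.gap i ≤ k) : n ≤ k := by
  match m, hm with
  | 0, _ =>
    obtain rfl : n = 0 := congrArg Fin.val (φ.last.symm.trans φ.zero)
    exact Nat.zero_le k
  | 1, _ => exact φ.gap_one ▸ hφ 0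

theorem middle_bounds {k : ℕ} {φ : EndMap 2 n} (hφ : ∀ i, φ.gap i ≤ k) :
    (φ.toFun 1 : ℕ) ≤ k ∧ n ≤ φ.toFun 1 + k := by
  have left : φ.toFun 0 = 0 := φ.zero
  have right : φ.toFun 2 = Fin.last n := φ.last
  have gaps := Fin.forall_fin_two.1 hφ
  simpa [gap, left, right, Nat.sub_le_iff_le_add, add_comm] using gaps

end EndMap

section Restrict

variable {C : Type u} [Category.{v} C] {l m n : ℕ}

theorem restrict_id_app {B : SymSeq C} {F : LevelTree n ⥤ C} (t : gamma n ⋙ B ⟶ F)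
    (X : LevelTree n) : (restrict (EndMap.id n) t).app X = t.app X := by
  have leaves : X.cast (EndMap.id n).last.symm = Equiv.refl _ := Equiv.ext fun x => X.f_refl _ _
  have cast_id : B.map (Sig.map (X.cast (EndMap.id n).last.symm)) = 𝟙 _ :=
    (congrArg (fun e => B.map (Sig.map e)) leaves).trans (B.map_id _)
  exact (congrArg (· ≫ t.app X) cast_id).trans (Category.id_comp _)

theorem restrict_comp_app (ψ : EndMap l m) (φ : EndMap m n) {B : SymSeq C} {F : LevelTree l ⥤ C}
    {G : LevelTree m ⥤ C} {H : LevelTree n ⥤ C} (t : gamma l ⋙ B ⟶ F) (θ : pull ψ ⋙ F ⟶ G)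
    (η : pull φ ⋙ G ⟶ H) (X : LevelTree n) :
    (restrict φ (restrict ψ t ≫ θ) ≫ η).app X =
      (restrict (ψ.comp φ) t).app X ≫ θ.app ((pull φ).obj X) ≫ η.app X := by
  have leaves : X.cast (ψ.comp φ).last.symm =
      (X.cast φ.last.symm).trans (((pull φ).obj X).cast ψ.last.symm) :=
    Equiv.ext fun x => (X.f_trans _ _ _).symm
  have cast_comp : B.map (Sig.map (X.cast (ψ.comp φ).last.symm)) =
      B.map (Sig.map (X.cast φ.last.symm)) ≫
        B.map (Sig.map (((pull φ).obj X).cast ψ.last.symm)) :=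
    (congrArg (fun e => B.map (Sig.map e)) leaves).trans
      (B.map_comp (Sig.map (X.cast φ.last.symm)) (Sig.map (((pull φ).obj X).cast ψ.last.symm)))
  refine Eq.trans ?_ (congrArg (fun a => (a ≫ t.app _) ≫ θ.app _ ≫ η.app X) cast_comp.symm)
  refine Eq.trans (congrArg (· ≫ η.app X) ?_) (Category.assoc _ _ _)
  exact (congrArg (_ ≫ ·) (Category.assoc _ _ _)).trans
    ((Category.assoc _ _ _).symm.trans (Category.assoc _ _ _).symm)

end Restrict

section SmallTrees

variable {C : Type u} [Category.{v} C] [MonoidalCategory C] [SymmetricCategory C] {n : ℕ}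

theorem unMap_edges_congr (A : SymSeq C) (X : LevelTree n) {κ : Type} [Finite κ] {α : κ → Type}
    [∀ k, Finite (α k)] {e e' : κ → X.V} (he : Function.Bijective e) (he' : Function.Bijective e')
    (h : ∀ k, e k = e' k) (g : ∀ k, α k ≃ X.In (e k)) (g' : ∀ k, α k ≃ X.In (e' k))
    (hg : ∀ k x, X.f (by rw [h]) (g k x).1 = (g' k x).1) :
    unMap (Y := fun v : X.V => A.obj (Sig.of (X.In v))) e he (fun k => A.map (Sig.map (g k))) =
      unMap e' he' (fun k => A.map (Sig.map (g' k))) :=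
  unMap_congr he he' h _ _ fun k => (map_inCast A X (h k) (g k)).trans
    (congrArg (fun t => A.map (Sig.map t)) (Equiv.ext fun x => Subtype.ext
      ((X.inCast_val (h k) _).trans (hg k x))))

variable [HasTerminal C]

theorem unitHom_app (A : SymSeq C) (X : LevelTree 1) (s : X.S 0) :
    (unitHom A).app X = A.map (Sig.map (rootIn X s)) ≫
      insSingleton (fun v : X.V => A.obj (Sig.of (X.In v))) (isEnum_root X s) := by
  obtain rfl : X.root_nonempty.some = s := X.root_subsingleton.elim _ _
  rfl

namespace PreCooperad

variable (P : PreCooperad C)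

theorem insSingleton_opAlong {g : ℕ} (τ : EndMap 1 g) (hτ : ∀ i, τ.gap i ≤ 2) (hg : g ≤ 2)
    (X : LevelTree g) (s : ((pull τ).obj X).S 0) :
    insSingleton (fun v : ((pull τ).obj X).V => P.O.obj (Sig.of (In _ v)))
        (isEnum_root ((pull τ).obj X) s) ≫ (P.opAlong τ hτ).app X =
      P.O.map (Sig.map ((X.leafEquiv τ ⟨0, s⟩).trans
        (castLeaf τ.gap_one (partOneHom τ X s)))) ≫ (P.localOp g hg).app X := by
  have root := insSingleton_blockMap (B := fun v : X.V => P.O.obj (Sig.of (X.In v)))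
    (Y := fun (v : ((pull τ).obj X).V) (w : (X.part τ v).V) => P.O.obj (Sig.of (In _ w)))
    (fun v => P.O.map (Sig.map (X.leafEquiv τ v)) ≫
      (P.localOp (τ.gap v.1) (hτ v.1)).app (X.part τ v))
    (X.glue τ) (X.glue_bijective τ) (fun p => P.O.map (Sig.map (X.glueIn τ p)))
    (isEnum_root ((pull τ).obj X) s)
  have vertices := unMap_edges_congr P.O X
    ((X.glue_bijective τ).comp (sigma_mk_bijective (κ' := fun v => (X.part τ v).V)
      (isEnum_root ((pull τ).obj X) s)))
    (castV_bijective τ.gap_one (partOneHom τ X s))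
    (fun w => Eq.symm (V_ext (Fin.ext (by simp [τ.zero])) _ _ rfl))
    (fun w => X.glueIn τ ⟨⟨0, s⟩, w⟩) (castIn τ.gap_one (partOneHom τ X s)) (fun _ _ => rfl)
  have natural := P.localOp_cast τ.gap_one (hτ 0) hg (partOneHom τ X s)
  refine root.trans ((congrArg (_ ≫ ·) vertices).trans ((Category.assoc _ _ _).trans
    ((congrArg (_ ≫ ·) natural.symm).trans ?_)))
  exact (Category.assoc _ _ _).symm.trans (congrArg (· ≫ _) (P.O.map_comp _ _).symm)

theorem restrict_unitHom_opAlong {g : ℕ} (τ : EndMap 1 g) (hτ : ∀ i, τ.gap i ≤ 2) (hg : g ≤ 2) :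
    restrict τ (unitHom P.O) ≫ P.opAlong τ hτ = P.localOp g hg := by
  ext X
  let s := ((pull τ).obj X).root_nonempty.some
  let leaves := (X.leafEquiv τ ⟨0, s⟩).trans (castLeaf τ.gap_one (partOneHom τ X s))
  have round_trip : ((X.cast τ.last.symm).trans (rootIn ((pull τ).obj X) s)).trans leaves =
      Equiv.refl _ := Equiv.ext fun x => by
    refine Eq.trans ?_ (X.f_refl le_rfl x)
    exact (X.f_trans _ _ _).trans ((X.f_trans _ _ _).trans (X.f_trans _ _ _))
  have map_round_trip : P.O.map (Sig.map (X.cast τ.last.symm)) ≫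
      P.O.map (Sig.map (rootIn ((pull τ).obj X) s)) ≫ P.O.map (Sig.map leaves) = 𝟙 _ := by
    refine Eq.trans ?_
      ((congrArg (fun e => P.O.map (Sig.map e)) round_trip).trans (P.O.map_id _))
    rw [← P.O.map_comp, ← P.O.map_comp]
    rfl
  have contract := P.insSingleton_opAlong τ hτ hg X s
  change (P.O.map (Sig.map (X.cast τ.last.symm)) ≫
    P.O.map (Sig.map (rootIn ((pull τ).obj X) s)) ≫
      insSingleton (fun v : ((pull τ).obj X).V => P.O.obj (Sig.of (In _ v)))
        (isEnum_root ((pull τ).obj X) s)) ≫ _ = _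
  refine (Category.assoc _ _ _).trans ((congrArg (_ ≫ ·) (Category.assoc _ _ _)).trans ?_)
  refine (congrArg (fun t => _ ≫ _ ≫ t) contract).trans
    (((congrArg (_ ≫ ·) (Category.assoc _ _ _).symm).trans (Category.assoc _ _ _).symm).trans ?_)
  exact (congrArg (· ≫ _) map_round_trip).trans (Category.id_comp _)

theorem localOp_of_eq_one {g : ℕ} (h : g = 1) (hg : g ≤ 2) (T : LevelTree g) (w : T.V) :
    ∃ (hw : IsEnum [w]) (hle : w.1.succ ≤ Fin.last g) (r : T.S (Fin.last g) ≃ T.In w),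
      (∀ x, (r x).1 = T.f hle x) ∧ (P.localOp g hg).app T = P.O.map (Sig.map r) ≫
        insSingleton (fun v : T.V => P.O.obj (Sig.of (T.In v))) hw := by
  subst h
  obtain ⟨i, s⟩ := w
  obtain rfl : i = 0 := Subsingleton.elim _ _
  exact ⟨isEnum_root T s, Fin.le_last _, rootIn T s, fun x => (T.f_refl _ _).symm,
    unitHom_app P.O T s⟩

theorem opAlong_id_app (h : ∀ i, (EndMap.id n).gap i ≤ 2) (X : LevelTree n) :
    (P.opAlong (EndMap.id n) h).app X = 𝟙 ((circPow P.O n).obj X) := by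
  let root : ∀ v : ((pull (EndMap.id n)).obj X).V, (X.part (EndMap.id n) v).V := fun v =>
    ⟨⟨0, by simp [EndMap.gap_id]⟩, ⟨X.f ((EndMap.id n).seg_zero v.1).le v.2,
      (X.f_trans _ _ _).trans (X.f_refl _ _)⟩⟩
  choose hroot hle r hr hop using fun v =>
    P.localOp_of_eq_one (EndMap.gap_id v.1) (h v.1) (X.part (EndMap.id n) v) (root v)
  let edges : ∀ v : ((pull (EndMap.id n)).obj X).V, In _ v ≃ X.In (X.glue _ ⟨v, root v⟩) :=
    fun v => ((X.leafEquiv (EndMap.id n) v).trans (r v)).trans (X.glueIn _ ⟨v, root v⟩)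
  have collapse := blockMap_insSingleton (B := fun v : X.V => P.O.obj (Sig.of (X.In v)))
    (Y := fun (v : ((pull (EndMap.id n)).obj X).V) (w : (X.part (EndMap.id n) v).V) =>
      P.O.obj (Sig.of (In _ w))) hroot
    (fun v => P.O.map (Sig.map (X.leafEquiv (EndMap.id n) v)) ≫ P.O.map (Sig.map (r v)))
    (X.glue (EndMap.id n)) (X.glue_bijective _)
    (fun p => P.O.map (Sig.map (X.glueIn (EndMap.id n) p)))
  have trivial := unMap_edges_congr P.O X ((X.glue_bijective (EndMap.id n)).comp
      (section_bijective hroot)) Function.bijective_id (fun v => V_ext (Fin.ext rfl) _ _ rfl)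
    edges (fun v => Equiv.refl (X.In v)) fun v x =>
      (congrArg (X.f _) (congrArg Subtype.val (hr v _))).trans
        ((X.f_trans _ _ _).trans ((X.f_trans _ _ _).trans (X.f_refl _ _)))
  refine (blockMap_congr _ (X.glue_bijective _) (fun v => (congrArg (_ ≫ ·) (hop v)).trans
    (Category.assoc _ _ _).symm) (fun _ => rfl) (fun _ => Category.comp_id _)).trans
    (collapse.trans (Eq.trans ?_ (trivial.trans ?_)))
  · refine unMap_congr _ _ (fun _ => rfl) _ _ fun v => (Category.comp_id _).trans ?_
    exact (congrArg (· ≫ _) (P.O.map_comp _ _).symm).trans (P.O.map_comp _ _).symm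
  · exact (unMap_congr _ _ (fun _ => rfl) _ _ fun v =>
      (Category.comp_id _).trans (P.O.map_id _)).trans (unMap_id _)

end PreCooperad

end SmallTrees

section TwoStep

variable {C : Type u} [Category.{v} C] [MonoidalCategory C] [SymmetricCategory C] [HasTerminal C]
variable {l m n : ℕ}

namespace PreCooperad

variable (P : PreCooperad C)

theorem twoStepOp_id (hn : n ≤ 2) (h : ∀ i, (EndMap.id n).gap i ≤ 2) :
    P.twoStepOp (EndMap.id n) hn h = P.localOp n hn := by
  ext X
  exact (congrArg₂ (· ≫ ·) (restrict_id_app (P.localOp n hn) X) (P.opAlong_id_app h X)).trans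
    (Category.comp_id _)

theorem twoStepOp_of_le_one (φ : EndMap m n) (hm : m ≤ 1) (hn : n ≤ 2) (hφ : ∀ i, φ.gap i ≤ 2) :
    P.twoStepOp φ (hm.trans one_le_two) hφ = P.localOp n hn := by
  match m, hm with
  | 0, _ =>
    obtain rfl : n = 0 := congrArg Fin.val (φ.last.symm.trans φ.zero)
    obtain rfl : φ = EndMap.id 0 := EndMap.ext fun i => Subsingleton.elim (α := Fin 1) _ _
    exact P.twoStepOp_id hn hφ
  | 1, _ => exact P.restrict_unitHom_opAlong φ hφ hn

theorem opAlong_comp_app_of_gap_le_one (ψ : EndMap l m) (φ : EndMap m n)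
    (hψ : ∀ i, ψ.gap i ≤ 1) (hφ : ∀ i, φ.gap i ≤ 2) (h : ∀ i, (ψ.comp φ).gap i ≤ 2)
    (X : LevelTree n) :
    (P.opAlong ψ fun i => (hψ i).trans one_le_two).app ((pull φ).obj X) ≫ (P.opAlong φ hφ).app X =
      (P.opAlong (ψ.comp φ) h).app X := by
  refine (P.opAlong_comp_app ψ φ _ hφ X).trans (congrArg (glueMap P.O (ψ.comp φ) X) ?_)
  funext v
  rw [P.twoStepOp_of_le_one _ (hψ v.1) (h v.1)]

theorem restrict_twoStepOp_opAlong (ψ : EndMap l m) (φ : EndMap m n) (hl : l ≤ 2)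
    (hψ : ∀ i, ψ.gap i ≤ 1) (hφ : ∀ i, φ.gap i ≤ 2) (h : ∀ i, (ψ.comp φ).gap i ≤ 2) :
    restrict φ (P.twoStepOp ψ hl fun i => (hψ i).trans one_le_two) ≫ P.opAlong φ hφ =
      P.twoStepOp (ψ.comp φ) hl h := by
  ext X
  exact (restrict_comp_app ψ φ _ _ _ X).trans
    (congrArg (_ ≫ ·) (P.opAlong_comp_app_of_gap_le_one ψ φ hψ hφ h X))

theorem twoStepOp_degen_comp (hn : n ≤ 2) (i : Fin 2)
    (hi : restrict (EndMap.degen i) P.Δ ≫ P.treeCodegen i = unitHom P.O)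
    (h : ∀ j, ((EndMap.degen i).comp (EndMap.ends n)).gap j ≤ 2) :
    P.twoStepOp ((EndMap.degen i).comp (EndMap.ends n)) le_rfl h = P.localOp n hn := by
  have gap_ends : ∀ j, (EndMap.ends n).gap j ≤ 2 := fun j => by
    obtain rfl : j = 0 := Subsingleton.elim _ _
    rwa [EndMap.gap_one]
  have gap_degen : ∀ j, (EndMap.degen i).gap j ≤ 1 := by
    clear hi h
    decide +revert
  rw [← P.restrict_twoStepOp_opAlong (EndMap.degen i) (EndMap.ends n) le_rfl gap_degen gap_ends,
    ← P.restrict_unitHom_opAlong (EndMap.ends n) gap_ends hn, ← hi]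
  rfl

end PreCooperad

namespace Cooperad

variable (P : Cooperad C)

theorem twoStepOp_eq_localOp (φ : EndMap m n) (hm : m ≤ 2) (hn : n ≤ 2) (hφ : ∀ i, φ.gap i ≤ 2) :
    P.twoStepOp φ hm hφ = P.localOp n hn := by
  by_cases hm' : m ≤ 1
  · exact P.twoStepOp_of_le_one φ hm' hn hφ
  obtain rfl : m = 2 := by omega
  by_cases collapses : φ.toFun 1 = 0
  · obtain rfl : φ = (EndMap.degen 0).comp (EndMap.ends n) := EndMap.ext_two collapses
    exact P.twoStepOp_degen_comp hn 0 P.counit_left hφ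
  by_cases collapses' : φ.toFun 1 = Fin.last n
  · obtain rfl : φ = (EndMap.degen 1).comp (EndMap.ends n) := EndMap.ext_two collapses'
    exact P.twoStepOp_degen_comp hn 1 P.counit_right hφ
  rw [Fin.ext_iff, Fin.val_zero] at collapses
  rw [Fin.ext_iff, Fin.val_last] at collapses'
  obtain rfl : n = 2 := by omega
  obtain rfl : φ = EndMap.id 2 := EndMap.ext_two (Fin.ext (show (φ.toFun 1 : ℕ) = 1 by omega))
  exact P.twoStepOp_id hn hφ

theorem twoStepOp_eq {m' : ℕ} (φ : EndMap m n) (φ' : EndMap m' n) (hm : m ≤ 2) (hm' : m' ≤ 2)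
    (hφ : ∀ i, φ.gap i ≤ 2) (hφ' : ∀ i, φ'.gap i ≤ 2) :
    P.twoStepOp φ hm hφ = P.twoStepOp φ' hm' hφ' := by
  by_cases hn : n ≤ 2
  · rw [P.twoStepOp_eq_localOp φ hm hn hφ, P.twoStepOp_eq_localOp φ' hm' hn hφ']
  obtain rfl : m = 2 := hm.antisymm (not_le.1 fun h => hn (EndMap.le_of_gap_le h hφ))
  obtain rfl : m' = 2 := hm'.antisymm (not_le.1 fun h => hn (EndMap.le_of_gap_le h hφ'))
  by_cases same : φ.toFun 1 = φ'.toFun 1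
  · cases EndMap.ext_two same
    rfl
  wlog lt : (φ.toFun 1 : ℕ) < φ'.toFun 1 generalizing φ φ'
  · exact (this φ' hφ' φ hφ (Ne.symm same) (by omega)).symm
  have bounds := EndMap.middle_bounds hφ
  have bounds' := EndMap.middle_bounds hφ'
  obtain rfl : n = 3 := by omega
  obtain rfl : φ = EndMap.face (1 : Fin 2) := EndMap.ext_two (Fin.ext (show _ = 1 by omega))
  obtain rfl : φ' = EndMap.face (0 : Fin 2) := EndMap.ext_two (Fin.ext (show _ = 2 by omega))
  exact P.coassoc.symm

end Cooperad

end TwoStep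

namespace EndMap

variable {n : ℕ}

theorem face_val (k : Fin n) (x : Fin (n + 1)) :
    ((face k).toFun x : ℕ) = if (x : ℕ) < k + 1 then (x : ℕ) else x + 1 := by
  simp only [face, Fin.succAbove, Fin.lt_def]
  split_ifs <;> simp_all

theorem degen_val (k : Fin (n + 1)) (x : Fin (n + 2)) :
    ((degen k).toFun x : ℕ) = if (k : ℕ) < x then (x : ℕ) - 1 else x := by
  rcases lt_or_ge (k : ℕ) x with h | h
  · rw [if_pos h]
    simp only [degen, Fin.predAbove_of_castSucc_lt k x (Fin.lt_def.2 h), Fin.val_pred]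
  · rw [if_neg (not_lt.2 h)]
    simp only [degen, Fin.predAbove_of_le_castSucc k x (Fin.le_def.2 h), Fin.coe_castPred]

theorem face_comp_face (i j : Fin n) (h : i ≤ j) :
    (face i).comp (face j.succ) = (face j).comp (face i.castSucc) := by
  rw [Fin.le_def] at h
  refine ext fun x => Fin.ext ?_
  simp only [comp, face_val, Fin.val_succ, Fin.val_castSucc]
  split_ifs <;> omega

theorem degen_comp_degen (i j : Fin (n + 1)) (h : i ≤ j) :
    (degen j.succ).comp (degen i) = (degen i.castSucc).comp (degen j) := by
  rw [Fin.le_def] at h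
  refine ext fun x => Fin.ext ?_
  simp only [comp, degen_val, Fin.val_succ, Fin.val_castSucc]
  split_ifs <;> omega

theorem face_comp_degen_castSucc (i : Fin n) : (face i).comp (degen i.castSucc) = EndMap.id n := by
  refine ext fun x => Fin.ext ?_
  simp only [comp, degen_val, face_val, Fin.val_castSucc, EndMap.id]
  split_ifs <;> omega

theorem face_comp_degen_succ (i : Fin n) : (face i).comp (degen i.succ) = EndMap.id n := by
  refine ext fun x => Fin.ext ?_
  simp only [comp, degen_val, face_val, Fin.val_succ, EndMap.id]
  split_ifs <;> omega

theorem face_comp_degen_of_le (i : Fin n) (j : Fin (n + 1)) (h : j ≤ i.castSucc) :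
    (face i.succ).comp (degen j.castSucc) = (degen j).comp (face i) := by
  rw [Fin.le_def, Fin.val_castSucc] at h
  refine ext fun x => Fin.ext ?_
  simp only [comp, degen_val, face_val, Fin.val_succ, Fin.val_castSucc]
  split_ifs <;> omega

theorem face_comp_degen_of_lt (i : Fin n) (j : Fin (n + 1)) (h : i.castSucc < j) :
    (face i.castSucc).comp (degen j.succ) = (degen j).comp (face i) := by
  rw [Fin.lt_def, Fin.val_castSucc] at h
  refine ext fun x => Fin.ext ?_
  simp only [comp, degen_val, face_val, Fin.val_succ, Fin.val_castSucc]
  split_ifs <;> omega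

end EndMap

section GammaOne

theorem Sig.map_injective {α β : Type} [Finite α] [Finite β] :
    Function.Injective (Sig.map : (α ≃ β) → _) := fun _ _ h =>
  FintypeCat.equivEquivIso.injective (congrArg CoreHom.iso h)

/-- The isomorphism of trees with one level induced by a bijection of leaves. -/
def homOfLeaves {X Y : LevelTree 1} (e : X.S 1 ≃ Y.S 1) : X ⟶ Y where
  e i := match i with
    | 0 =>
      have := X.root_subsingleton
      have := Y.root_subsingleton
      ⟨fun _ => Y.root_nonempty.some, fun _ => X.root_nonempty.some,
        fun _ => Subsingleton.elim _ _, fun _ => Subsingleton.elim _ _⟩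
    | 1 => e
  comm {i j} h x := match i, j, h with
    | 0, _, _ => Y.root_subsingleton.elim _ _
    | 1, 1, _ => (congrArg e (X.f_refl _ x)).trans (Y.f_refl _ _).symm
    | 1, 0, h => absurd h (by decide)

/-- The tree with one level and a given set of leaves. -/
def corolla (T : Type) [Finite T] : LevelTree 1 where
  S i := match i with
    | 0 => Unit
    | 1 => T
  finite i := match i with
    | 0 => inferInstanceAs (Finite Unit)
    | 1 => inferInstanceAs (Finite T)
  f {i j} h := match i, j, h with
    | 0, _, _ => fun _ => ()
    | 1, 1, _ => fun x => x
    | 1, 0, h => absurd h (by decide)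
  f_refl {i} h x := match i with
    | 0 => rfl
    | 1 => rfl
  f_trans {i j k} h h' x := match i, j, k, h, h' with
    | 0, _, _, _, _ => rfl
    | 1, 1, 1, _, _ => rfl
    | 1, 0, _, h, _ => absurd h (by decide)
    | 1, 1, 0, _, h' => absurd h' (by decide)
  root_nonempty := ⟨()⟩
  root_subsingleton := inferInstanceAs (Subsingleton Unit)

instance : (gamma 1).Faithful where
  map_injective {X Y} a b h := by
    refine LevelTree.Hom.ext (funext fun i => ?_)
    match i with
    | 0 => exact Equiv.ext fun _ => Y.root_subsingleton.elim _ _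
    | 1 => exact Sig.map_injective h

instance : (gamma 1).Full where
  map_surjective f :=
    ⟨homOfLeaves (FintypeCat.equivEquivIso.symm f.iso),
      CoreHom.ext (FintypeCat.equivEquivIso.apply_symm_apply f.iso)⟩

instance : (gamma 1).EssSurj where
  mem_essImage T := ⟨corolla T.of, ⟨eqToIso rfl⟩⟩

instance : (gamma 1).IsEquivalence where

end GammaOne

section CompositesAlong

variable {C : Type u} [Category.{v} C] [MonoidalCategory C] [SymmetricCategory C] [HasTerminal C]
variable {l m m' n : ℕ}

theorem PreCooperad.restrict_opAlong_comp_app (P : PreCooperad C) {ψ : EndMap l m}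
    {φ : EndMap m n} {χ : EndMap l n} (hχ : ψ.comp φ = χ) (hψ : ∀ i, ψ.gap i ≤ 2)
    (hφ : ∀ i, φ.gap i ≤ 2) {B : SymSeq C} (t : gamma l ⋙ B ⟶ circPow P.O l) (X : LevelTree n)
    (onPart : ∀ v : ((pull χ).obj X).V, (gamma (χ.gap v.1) ⋙ P.O).obj (X.part χ v) ⟶
      (circPow P.O (χ.gap v.1)).obj (X.part χ v))
    (onPart_eq : ∀ v k (θ : EndMap k (χ.gap v.1)) (hk : k ≤ 2) (hθ : ∀ i, θ.gap i ≤ 2),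
      (P.twoStepOp θ hk hθ).app (X.part χ v) = onPart v) :
    (restrict φ (restrict ψ t ≫ P.opAlong ψ hψ) ≫ P.opAlong φ hφ).app X =
      (restrict χ t).app X ≫ glueMap P.O χ X onPart := by
  subst hχ
  refine (restrict_comp_app ψ φ t _ _ X).trans (congrArg (_ ≫ ·) ?_)
  exact (P.opAlong_comp_app ψ φ hψ hφ X).trans
    (congrArg (glueMap P.O (ψ.comp φ) X) (funext fun v => onPart_eq v _ _ _ _))

theorem Cooperad.restrict_opAlong_comp_eq (P : Cooperad C) {ψ : EndMap l m} {φ : EndMap m n}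
    {ψ' : EndMap l m'} {φ' : EndMap m' n} (same : ψ.comp φ = ψ'.comp φ')
    (hψ : ∀ i, ψ.gap i ≤ 2) (hφ : ∀ i, φ.gap i ≤ 2) (hψ' : ∀ i, ψ'.gap i ≤ 2)
    (hφ' : ∀ i, φ'.gap i ≤ 2) {B : SymSeq C} (t : gamma l ⋙ B ⟶ circPow P.O l) :
    restrict φ (restrict ψ t ≫ P.opAlong ψ hψ) ≫ P.opAlong φ hφ =
      restrict φ' (restrict ψ' t ≫ P.opAlong ψ' hψ') ≫ P.opAlong φ' hφ' := by
  ext X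
  refine (P.restrict_opAlong_comp_app same hψ hφ t X
    (fun v => (P.twoStepOp (ψ'.loc φ' v.1) (hψ' v.1) (ψ'.gap_loc_le v.1 hφ')).app (X.part _ v))
    fun v k θ hk hθ => ?_).trans
    (P.restrict_opAlong_comp_app rfl hψ' hφ' t X _ fun v k θ hk hθ => ?_).symm
  all_goals exact NatTrans.congr_app (P.twoStepOp_eq θ _ hk _ hθ _) _

end CompositesAlong

section Kan

variable {C : Type u} [Category.{v} C]

theorem whiskerLeft_restrict {m n : ℕ} (φ : EndMap m n) {A B : SymSeq C} {F : LevelTree m ⥤ C}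
    (s : A ⟶ B) (t : gamma m ⋙ B ⟶ F) : Functor.whiskerLeft (gamma n) s ≫ restrict φ t =
      restrict φ (Functor.whiskerLeft (gamma m) s ≫ t) := by
  ext X
  exact (s.naturality_assoc (Sig.map (X.cast φ.last.symm)) (t.app ((pull φ).obj X))).symm

theorem isIso_unitHom [MonoidalCategory C] [SymmetricCategory C] [HasTerminal C] (A : SymSeq C) :
    IsIso (unitHom A) := by
  have : ∀ X, IsIso ((unitHom A).app X) := fun X => by
    have insRoot := ins_isIso (fun v : X.V => A.obj (Sig.of (X.In v)))
      [⟨0, X.root_nonempty.some⟩] (isEnum_root X _)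
    have mapRoot : IsIso (A.map (Sig.map (rootIn X X.root_nonempty.some))) :=
      have : IsIso (Sig.map (rootIn X X.root_nonempty.some)) := inferInstance
      inferInstance
    exact IsIso.comp_isIso' mapRoot (IsIso.comp_isIso' inferInstance insRoot)
  exact NatIso.isIso_of_isIso_app _

variable [HasLimitsOfSize.{0, 0} C]

theorem whiskerLeft_ranLift_comp_ranι {n : ℕ} {F : LevelTree n ⥤ C} {B : SymSeq C}
    (t : gamma n ⋙ B ⟶ F) : Functor.whiskerLeft (gamma n) (ranLift t) ≫ ranι F = t :=
  Functor.liftOfIsRightKanExtension_fac _ _ _ _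

variable [MonoidalCategory C] [SymmetricCategory C]

theorem isIso_ranLift_unitHom (A : SymSeq C) : IsIso (ranLift (unitHom A)) := by
  have := isIso_unitHom A
  exact (Functor.isRightKanExtension_iff_isIso _ _ (unitHom A)
    (whiskerLeft_ranLift_comp_ranι (unitHom A))).1 inferInstance

namespace PreCooperad

variable (P : PreCooperad C) {m n : ℕ}

/-- The map `O^{∘̂ m} ⟶ O^{∘̂ n}` induced by an end point preserving map `φ` with gaps at most two:
the common form of the cofaces and the codegeneracies. -/
def mapAlong (φ : EndMap m n) (hφ : ∀ i, φ.gap i ≤ 2) : compPow P.O m ⟶ compPow P.O n :=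
  ranCompare φ (circPow P.O m) ≫ ranMap (P.opAlong φ hφ)

theorem whiskerLeft_mapAlong_comp_ranι (φ : EndMap m n) (hφ : ∀ i, φ.gap i ≤ 2) :
    Functor.whiskerLeft (gamma n) (P.mapAlong φ hφ) ≫ ranι (circPow P.O n) =
      restrict φ (ranι (circPow P.O m)) ≫ P.opAlong φ hφ := by
  rw [mapAlong, ranMap, ranCompare, Functor.whiskerLeft_comp, Category.assoc,
    whiskerLeft_ranLift_comp_ranι, ← Category.assoc, whiskerLeft_ranLift_comp_ranι]

theorem eq_mapAlong_iff (φ : EndMap m n) (hφ : ∀ i, φ.gap i ≤ 2)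
    (t : compPow P.O m ⟶ compPow P.O n) :
    t = P.mapAlong φ hφ ↔ Functor.whiskerLeft (gamma n) t ≫ ranι (circPow P.O n) =
      restrict φ (ranι (circPow P.O m)) ≫ P.opAlong φ hφ := by
  rw [← whiskerLeft_mapAlong_comp_ranι]
  exact ⟨congrArg (Functor.whiskerLeft (gamma n) · ≫ _),
    Functor.hom_ext_of_isRightKanExtension _ (ranι (circPow P.O n)) _ _⟩

theorem mapAlong_id (h : ∀ i, (EndMap.id n).gap i ≤ 2) : P.mapAlong (EndMap.id n) h = 𝟙 _ := by
  refine ((P.eq_mapAlong_iff _ h _).2 ?_).symm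
  ext X
  exact (Category.id_comp _).trans ((congrArg₂ (· ≫ ·) (restrict_id_app (ranι _) X)
    (P.opAlong_id_app h X)).trans (Category.comp_id _)).symm

theorem whiskerLeft_comp_mapAlong_comp_ranι (φ : EndMap m n) (hφ : ∀ i, φ.gap i ≤ 2) {B : SymSeq C}
    (s : B ⟶ compPow P.O m) :
    Functor.whiskerLeft (gamma n) (s ≫ P.mapAlong φ hφ) ≫ ranι (circPow P.O n) =
      restrict φ (Functor.whiskerLeft (gamma m) s ≫ ranι (circPow P.O m)) ≫ P.opAlong φ hφ := by
  rw [Functor.whiskerLeft_comp, Category.assoc, whiskerLeft_mapAlong_comp_ranι, ← Category.assoc,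
    whiskerLeft_restrict]

theorem ranLift_unitHom_comp_mapAlong (τ : EndMap 1 n) (hτ : ∀ i, τ.gap i ≤ 2) (hn : n ≤ 2) :
    ranLift (unitHom P.O) ≫ P.mapAlong τ hτ = ranLift (P.localOp n hn) := by
  refine Functor.hom_ext_of_isRightKanExtension _ (ranι (circPow P.O n)) _ _ ?_
  rw [whiskerLeft_comp_mapAlong_comp_ranι, whiskerLeft_ranLift_comp_ranι,
    whiskerLeft_ranLift_comp_ranι, restrict_unitHom_opAlong]

end PreCooperad

namespace Cooperad

variable (P : Cooperad C) {l m m' n : ℕ}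

theorem mapAlong_comp_mapAlong_eq {ψ : EndMap l m} {φ : EndMap m n} {ψ' : EndMap l m'}
    {φ' : EndMap m' n} {hψ : ∀ i, ψ.gap i ≤ 2} {hφ : ∀ i, φ.gap i ≤ 2} {hψ' : ∀ i, ψ'.gap i ≤ 2}
    {hφ' : ∀ i, φ'.gap i ≤ 2} (same : ψ.comp φ = ψ'.comp φ') :
    P.mapAlong ψ hψ ≫ P.mapAlong φ hφ = P.mapAlong ψ' hψ' ≫ P.mapAlong φ' hφ' := by
  refine Functor.hom_ext_of_isRightKanExtension _ (ranι (circPow P.O n)) _ _ ?_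
  simp only [P.whiskerLeft_comp_mapAlong_comp_ranι, P.whiskerLeft_mapAlong_comp_ranι]
  exact P.restrict_opAlong_comp_eq same hψ hφ hψ' hφ' _

theorem mapAlong_comp_mapAlong_eq_id {ψ : EndMap n m} {φ : EndMap m n} {hψ : ∀ i, ψ.gap i ≤ 2}
    {hφ : ∀ i, φ.gap i ≤ 2} (id : ψ.comp φ = EndMap.id n) :
    P.mapAlong ψ hψ ≫ P.mapAlong φ hφ = 𝟙 _ := by
  have gap_id : ∀ i, (EndMap.id n).gap i ≤ 2 := fun i => (EndMap.gap_id i).trans_le one_le_two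
  rw [P.mapAlong_comp_mapAlong_eq (hψ' := gap_id) (hφ' := gap_id)
    (id.trans (EndMap.ext fun _ => rfl)), P.mapAlong_id, Category.comp_id]

theorem isCoaugmentedCosimplicialWithTwoExtra :
    IsCoaugmentedCosimplicialWithTwoExtra (fun k => compPow P.O (k + 1))
      (fun k (i : Fin (k + 1)) => P.coface i) (fun k (j : Fin (k + 2)) => P.codegen j) where
  d_comp_d _ i j h := P.mapAlong_comp_mapAlong_eq (EndMap.face_comp_face i j h)
  s_comp_s _ i j h := P.mapAlong_comp_mapAlong_eq (EndMap.degen_comp_degen i j h)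
  d_comp_s_castSucc _ i := P.mapAlong_comp_mapAlong_eq_id (EndMap.face_comp_degen_castSucc i)
  d_comp_s_succ _ i := P.mapAlong_comp_mapAlong_eq_id (EndMap.face_comp_degen_succ i)
  d_comp_s_of_lt _ i j h := P.mapAlong_comp_mapAlong_eq (EndMap.face_comp_degen_of_le i j h)
  d_comp_s_of_gt _ i j h := P.mapAlong_comp_mapAlong_eq (EndMap.face_comp_degen_of_lt i j h)

end Cooperad

end Kan

end WreathCooperad

end

theorem mainTheorem1 {C : Type u} [Category.{v} C] [MonoidalCategory C] [SymmetricCategory C]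
    [HasLimitsOfSize.{0, 0} C] (P : WreathCooperad.Cooperad C) :
    -- the cosimplicial identities
    WreathCooperad.IsCoaugmentedCosimplicialWithTwoExtra
      (fun k => WreathCooperad.compPow P.O (k + 1))
      (fun k (i : Fin (k + 1)) => P.coface i)
      (fun k (j : Fin (k + 2)) => P.codegen j) ∧
    -- the first term is `O`, and the first coface is the map `O ⟶ O ∘̂ O` corresponding to `Δ`
    IsIso (WreathCooperad.ranLift (WreathCooperad.unitHom P.O)) ∧
    WreathCooperad.ranLift (WreathCooperad.unitHom P.O) ≫ P.coface (0 : Fin 1) =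
      WreathCooperad.ranLift P.Δ ∧
    -- the universal properties of the cofaces and the codegeneracies
    (∀ (n : ℕ) (k : Fin n)
      (t : WreathCooperad.compPow P.O n ⟶ WreathCooperad.compPow P.O (n + 1)),
      t = P.coface k ↔
        Functor.whiskerLeft (WreathCooperad.LevelTree.gamma (n + 1)) t ≫
            WreathCooperad.ranι (WreathCooperad.circPow P.O (n + 1)) =
          WreathCooperad.restrict (WreathCooperad.EndMap.face k)
            (WreathCooperad.ranι (WreathCooperad.circPow P.O n)) ≫ P.treeCoface k) ∧
    (∀ (n : ℕ) (i : Fin (n + 1))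
      (t : WreathCooperad.compPow P.O (n + 1) ⟶ WreathCooperad.compPow P.O n),
      t = P.codegen i ↔
        Functor.whiskerLeft (WreathCooperad.LevelTree.gamma n) t ≫
            WreathCooperad.ranι (WreathCooperad.circPow P.O n) =
          WreathCooperad.restrict (WreathCooperad.EndMap.degen i)
            (WreathCooperad.ranι (WreathCooperad.circPow P.O (n + 1))) ≫ P.treeCodegen i) :=
  ⟨P.isCoaugmentedCosimplicialWithTwoExtra,
    WreathCooperad.isIso_ranLift_unitHom P.O,
    P.ranLift_unitHom_comp_mapAlong (WreathCooperad.EndMap.face 0) _ le_rfl,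
    fun _ k => P.eq_mapAlong_iff (WreathCooperad.EndMap.face k) _,
    fun _ i => P.eq_mapAlong_iff (WreathCooperad.EndMap.degen i) _⟩
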